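/- **Conventions.** Let $\Gamma$ be a countable discrete group and $A$ a finite abelian group. A *measured $\Gamma$-Boolean algebra* $(\mathrm P,\mu)$ is a Boolean algebra $\mathrm P$ with a map $\mu\colon \mathrm P\to[0,1]$ satisfying $\mu(X\cup Y)+\mu(X\cap Y)=\mu(X)+\mu(Y)$, $\mu(0)=0$, $\mu(1)=1$, and with a $\mu$-preserving action of $\Gamma$ by Boolean automorphisms. It is a *finite action* if $\mathrm P$ is finite, and a *finite transitive action* if moreover $\Gamma$ permutes the atoms of $\mathrm P$ transitively. Write $\mathrm P(A)$ for the abelian group generated by symbols $X\otimes a$ ($X\in \mathrm P$, $a\in A$) subject to $X\otimes a+Y\otimes b=(X\setminus Y)\otimes a+(Y\setminus X)\otimes b+(X\cap Y)\otimes(a+b)$. Every element is uniquely of the form $\sum_{a\ne0}X_a\otimes a$ with the $X_a$ pairwise disjoint; put $\mu\big(\sum_{a\neq 0} X_a\otimes a\big)=\sum_{a\ne0}\mu(X_a)$. The group $\Gamma$ acts on $\mathrm P(A)$ by $g(X\otimes a)=gX\otimes a$. The group $\Gamma$ is *of finite type* if it has a finite classifying space $B\Gamma$, i.e. there is a contractible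 simplicial complex $E\Gamma$ with a free simplicial $\Gamma$-action (no nontrivial element maps a simplex to itself) having finitely many orbits of simplices; $B\Gamma=E\Gamma/\Gamma$. Fix such a model and, for each $i$, strictly positive weights $\nu_i$ on the finite set $B\Gamma(i)$ of its $i$-simplices, of total mass $1$ if $B\Gamma(i)\neq\emptyset$. Let $H^i(B\Gamma,\mathrm P(A))$ be the cohomology of the complex $C^i=\mathrm{Hom}_{\mathbb Z\Gamma}(C_i(E\Gamma),\mathrm P(A))$. For $c\in C^i$ put $\|c\|=\sum_{x\in B\Gamma(i)}\mu(c(x))\,\nu_i(x)$, where $c(x)$ is evaluated on any oriented simplex of $E\Gamma$ above $x$, and for $\alpha\in H^i(B\Gamma,\mathrm P(A))$ let $\|\alpha\|$ be the infimum of $\|z\|$ over the cocycles $z$ representing $\alpha$. Then $\Gamma$ satisfies a *cosystolic inequality* in dimension $i$ with coefficients in $A$ for all finite transitive actions if there is $\varepsilon>0$ such that $\|\alpha\|\ge\varepsilon$ for all finite transitive actions $(\mathrm P,\mu)$ of $\Gamma$ and all $0\ne\alpha\in H^i(B\Gamma,\mathrm P(A))$. The *metric ultraproduct* of measured $\Gamma$-Boolean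 algebras $(\mathrm P_j,\mu_j)_{j\in I}$ along a non-principal ultrafilter $\mathcal U$ on $I$ is the quotient of $\prod_j\mathrm P_j$ by the relation $\lim_{j\to\mathcal U}\big(\mu_j(X_j\cup Y_j)-\mu_j(X_j\cap Y_j)\big)=0$, with measure $\lim_{j\to\mathcal U}\mu_j(X_j)$ and the induced $\Gamma$-action. A measured $\Gamma$-Boolean algebra is *weakly contained* in a family if it admits a measure-preserving $\Gamma$-equivariant Boolean homomorphism into a metric ultraproduct of members of the family. Let $\ell_k(\sigma)=\frac1k|\{i:\sigma(i)\ne i\}|$ for $\sigma\in\mathrm{Sym}(k)$. For a finite presentation $\pi\colon F\twoheadrightarrow\Gamma$ ($F$ free of finite rank, $\ker\pi$ the normal closure of a finite set $R$), a *sofic representation* of $\Gamma$ is a sequence of homomorphisms $\sigma_n\colon F\to\mathrm{Sym}(k_n)$, $k_n\geq 1$, with $\ell_{k_n}(\sigma_n(r))\to0$ for all $r\in R$ and $\ell_{k_n}(\sigma_n(g))\to1$ for all $g\notin\ker\pi$. Its *limit action* along a non-principal ultrafilter on $\mathbb N$ is the metric ultraproduct of the power sets of $\{1,\dots,k_n\}$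 with normalized counting measure and the $F$-action through $\sigma_n$; the kernel of $\pi$ acts trivially on it, so it is a measured $\Gamma$-Boolean algebra. A finitely presented group $\Gamma$ is *stable in finite actions* if, for a finite presentation of $\Gamma$ (the choice is immaterial), the limit action of every sofic representation along every non-principal ultrafilter on $\mathbb N$ is weakly contained in the family of finite actions of $\Gamma$. A group $G$ is *sofic* if for every finite $K\subset G$ and $\varepsilon>0$ there are $k\ge1$ and a map $\varphi\colon G\to\mathrm{Sym}(k)$ with $\ell_k\big(\varphi(gh)(\varphi(g)\varphi(h))^{-1}\big)<\varepsilon$ for $g,h\in K$ and $\ell_k(\varphi(g))>1-\varepsilon$ for $1\ne g\in K$. **Theorem.** Let $\Gamma$ be a countable discrete group and let $A$ be a finite abelian group. Assume that 1. $\Gamma$ is residually finite and of finite type; 2. $\Gamma$ satisfies a cosystolic inequality in dimension $2$, with coefficients in $A$, for all finite transitive actions (with respect to some finite model of $B\Gamma$ and some weights $\nu_2$ as above); 3. $\tilde\Gamma$ is a central extension of $\Gamma$ by $A$ which is not residually finite. If $\Gamma$ is stable in finite actions, then $\tilde\Gamma$ is not sofic. -/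

import Mathlib

namespace SoficStability

open Filter Topology

universe u v w x

/-! ### Measured Boolean algebras with a measure-preserving group action -/

/-- A measured `Γ`-Boolean algebra: a Boolean algebra with a finitely additive probability measure
and an action of the group `Γ` by measure-preserving Boolean automorphisms. -/
structure MeasuredBoolAlg (Γ : Type u) [Group Γ] where
  carrier : Type v
  [boolAlg : BooleanAlgebra carrier]
  [action : MulAction Γ carrier]
  smul_inf : ∀ (g : Γ) (X Y : carrier), g • (X ⊓ Y) = g • X ⊓ g • Y
  smul_compl : ∀ (g : Γ) (X : carrier), g • Xᶜ = (g • X)ᶜ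
  measure : carrier → ℝ
  measure_nonneg : ∀ X, 0 ≤ measure X
  measure_le_one : ∀ X, measure X ≤ 1
  measure_sup_add_inf : ∀ X Y, measure (X ⊔ Y) + measure (X ⊓ Y) = measure X + measure Y
  measure_bot : measure ⊥ = 0
  measure_top : measure ⊤ = 1
  measure_smul : ∀ (g : Γ) (X : carrier), measure (g • X) = measure X

attribute [instance] MeasuredBoolAlg.boolAlg MeasuredBoolAlg.action

namespace MeasuredBoolAlg

variable {Γ : Type u} [Group Γ] (P : MeasuredBoolAlg.{u, v} Γ)

theorem smul_sup (g : Γ) (X Y : P.carrier) : g • (X ⊔ Y) = g • X ⊔ g • Y := by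
  have h : X ⊔ Y = (Xᶜ ⊓ Yᶜ)ᶜ := by simp
  rw [h, P.smul_compl, P.smul_inf, P.smul_compl, P.smul_compl]
  simp

theorem smul_top (g : Γ) : g • (⊤ : P.carrier) = ⊤ := by
  have h : g • ((⊤ : P.carrier) ⊔ ⊤ᶜ) = ⊤ := by rw [P.smul_sup, P.smul_compl, sup_compl_eq_top]
  rwa [sup_compl_eq_top] at h

theorem smul_bot (g : Γ) : g • (⊥ : P.carrier) = ⊥ := by
  rw [← compl_top, P.smul_compl, P.smul_top]

/-- The pseudo-metric `d(X, Y) = μ(X ∪ Y) - μ(X ∩ Y)`. -/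
def dist (X Y : P.carrier) : ℝ := P.measure (X ⊔ Y) - P.measure (X ⊓ Y)

theorem measure_sup_of_disjoint {X Y : P.carrier} (h : Disjoint X Y) :
    P.measure (X ⊔ Y) = P.measure X + P.measure Y := by
  have := P.measure_sup_add_inf X Y
  rw [h.eq_bot, P.measure_bot] at this
  linarith

theorem measure_mono {X Y : P.carrier} (h : X ≤ Y) : P.measure X ≤ P.measure Y := by
  have h1 := P.measure_sup_of_disjoint (disjoint_sdiff_self_right (x := X) (y := Y))
  rw [sup_sdiff_cancel_right h] at h1
  linarith [P.measure_nonneg (Y \ X)]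

theorem measure_sup_le (X Y : P.carrier) : P.measure (X ⊔ Y) ≤ P.measure X + P.measure Y := by
  linarith [P.measure_sup_add_inf X Y, P.measure_nonneg (X ⊓ Y)]

theorem dist_eq (X Y : P.carrier) : P.dist X Y = P.measure (symmDiff X Y) := by
  have h := P.measure_sup_of_disjoint (disjoint_symmDiff_inf X Y)
  rw [symmDiff_sup_inf] at h
  unfold dist
  linarith

theorem dist_nonneg (X Y : P.carrier) : 0 ≤ P.dist X Y := by
  rw [dist_eq]; exact P.measure_nonneg _

theorem dist_self (X : P.carrier) : P.dist X X = 0 := by simp [dist]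

theorem dist_comm (X Y : P.carrier) : P.dist X Y = P.dist Y X := by
  simp [dist, sup_comm, inf_comm]

theorem dist_triangle (X Y Z : P.carrier) : P.dist X Z ≤ P.dist X Y + P.dist Y Z := by
  simp only [dist_eq]
  exact (P.measure_mono (symmDiff_triangle X Y Z)).trans (P.measure_sup_le _ _)

theorem dist_inf_le (X X' Y Y' : P.carrier) :
    P.dist (X ⊓ X') (Y ⊓ Y') ≤ P.dist X Y + P.dist X' Y' := by
  simp only [dist_eq]
  refine (P.measure_mono ?_).trans (P.measure_sup_le _ _)
  rw [symmDiff_def, symmDiff_def, symmDiff_def, sdiff_inf, sdiff_inf]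
  refine sup_le (sup_le ?_ ?_) (sup_le ?_ ?_)
  · exact (sdiff_le_sdiff_right inf_le_left).trans (le_sup_left.trans le_sup_left)
  · exact (sdiff_le_sdiff_right inf_le_right).trans (le_sup_left.trans le_sup_right)
  · exact (sdiff_le_sdiff_right inf_le_left).trans (le_sup_right.trans le_sup_left)
  · exact (sdiff_le_sdiff_right inf_le_right).trans (le_sup_right.trans le_sup_right)

theorem dist_compl (X Y : P.carrier) : P.dist Xᶜ Yᶜ = P.dist X Y := by
  rw [dist_eq, dist_eq, compl_symmDiff_compl]

theorem dist_smul (g : Γ) (X Y : P.carrier) : P.dist (g • X) (g • Y) = P.dist X Y := by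
  simp only [dist, ← P.smul_sup, ← P.smul_inf, P.measure_smul]

theorem abs_measure_sub_le (X Y : P.carrier) : |P.measure X - P.measure Y| ≤ P.dist X Y := by
  have h1 := P.measure_mono (le_sup_left : X ≤ X ⊔ Y)
  have h2 := P.measure_mono (le_sup_right : Y ≤ X ⊔ Y)
  have h3 := P.measure_mono (inf_le_left : X ⊓ Y ≤ X)
  have h4 := P.measure_mono (inf_le_right : X ⊓ Y ≤ Y)
  unfold dist
  rw [abs_le]
  constructor <;> linarith

/-- `P` is contained in `Q`: there is a measure-preserving, equivariant homomorphism of Boolean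
algebras from `P` to `Q`. -/
def IsContainedIn (P : MeasuredBoolAlg.{u, v} Γ) (Q : MeasuredBoolAlg.{u, w} Γ) : Prop :=
  ∃ f : BoundedLatticeHom P.carrier Q.carrier,
    (∀ (g : Γ) (X : P.carrier), f (g • X) = g • f X) ∧
      ∀ X : P.carrier, Q.measure (f X) = P.measure X

variable (Γ) in
/-- The finite actions: all finite measured `Γ`-Boolean algebras. -/
def finiteActions : Set (MeasuredBoolAlg.{u, v} Γ) := {P | Finite P.carrier}

variable (Γ) in
/-- The finite transitive actions: the finite measured `Γ`-Boolean algebras whose atoms (the points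
of the corresponding finite `Γ`-set) are permuted transitively. -/
def finiteTransitiveActions : Set (MeasuredBoolAlg.{u, v} Γ) :=
  {P | Finite P.carrier ∧
    ∀ X Y : P.carrier, IsAtom X → IsAtom Y → ∃ g : Γ, g • X = Y}

/-- The power set of a finite nonempty set with normalized counting measure, acted upon through a
homomorphism into the group of permutations. -/
noncomputable def ofPerm (X : Type v) [Finite X] [Nonempty X] (σ : Γ →* Equiv.Perm X) :
    MeasuredBoolAlg.{u, v} Γ :=
  letI : MulAction Γ (Set X) :=
    { smul := fun g S => σ g '' S
      one_smul := fun S => by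
        change (σ 1) '' S = S
        simp
      mul_smul := fun g h S => by
        change (σ (g * h)) '' S = σ g '' (σ h '' S)
        simp [Set.image_image] }
  { carrier := Set X
    smul_inf := fun g S T => Set.image_inter (σ g).injective
    smul_compl := fun g S => Set.image_compl_eq (σ g).bijective
    measure := fun S => (S.ncard : ℝ) / (Nat.card X : ℝ)
    measure_nonneg := fun S => by positivity
    measure_le_one := fun S => by
      have h : S.ncard ≤ Nat.card X := Set.ncard_le_card S
      exact div_le_one_of_le₀ (by exact_mod_cast h) (by positivity)
    measure_sup_add_inf := fun S T => by
      have h := Set.ncard_union_add_ncard_inter S T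
      rw [← add_div, ← add_div]
      congr 1
      exact_mod_cast h
    measure_bot := by simp
    measure_top := by
      have h : (Nat.card X : ℝ) ≠ 0 := by exact_mod_cast Nat.card_pos.ne'
      simp [Set.ncard_univ, h]
    measure_smul := fun g S => by
      change ((σ g '' S).ncard : ℝ) / _ = _
      rw [Set.ncard_image_of_injective _ (σ g).injective] }

/-! ### Metric ultraproducts -/

section Ultraproduct

variable {I : Type w} (𝒰 : Ultrafilter I) (Q : I → MeasuredBoolAlg.{u, v} Γ)

/-- Two families are identified if their distance tends to zero along the ultrafilter. -/
def ultraSetoid : Setoid (∀ j, (Q j).carrier) where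
  r X Y := Tendsto (fun j => (Q j).dist (X j) (Y j)) 𝒰 (𝓝 0)
  iseqv :=
    { refl := fun X => by simp [dist_self]
      symm := fun {X Y} h => by simpa only [dist_comm] using h
      trans := fun {X Y Z} h h' => by
        refine squeeze_zero (fun j => (Q j).dist_nonneg _ _)
          (fun j => (Q j).dist_triangle _ (Y j) _) ?_
        simpa using h.add h' }

/-- The underlying set of the metric ultraproduct. -/
def UltraCarrier : Type (max v w) := Quotient (ultraSetoid 𝒰 Q)

/-- The class of a family in the metric ultraproduct. -/
def UltraCarrier.mk (X : ∀ j, (Q j).carrier) : UltraCarrier 𝒰 Q :=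
  Quotient.mk (ultraSetoid 𝒰 Q) X

instance : Min (UltraCarrier 𝒰 Q) where
  min := Quotient.map₂ (fun X Y j => X j ⊓ Y j) (fun X X' h Y Y' h' => by
    refine squeeze_zero (fun j => (Q j).dist_nonneg _ _)
      (fun j => (Q j).dist_inf_le _ _ _ _) ?_
    simpa using Tendsto.add (h : Tendsto _ _ _) (h' : Tendsto _ _ _))

instance : Max (UltraCarrier 𝒰 Q) where
  max := Quotient.map₂ (fun X Y j => X j ⊔ Y j) (fun X X' h Y Y' h' => by
    have hle : ∀ j, (Q j).dist (X j ⊔ Y j) (X' j ⊔ Y' j) ≤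
        (Q j).dist (X j) (X' j) + (Q j).dist (Y j) (Y' j) := fun j => by
      rw [← (Q j).dist_compl, compl_sup, compl_sup, ← (Q j).dist_compl (X j),
        ← (Q j).dist_compl (Y j)]
      exact (Q j).dist_inf_le _ _ _ _
    refine squeeze_zero (fun j => (Q j).dist_nonneg _ _) hle ?_
    simpa using Tendsto.add (h : Tendsto _ _ _) (h' : Tendsto _ _ _))

instance : Compl (UltraCarrier 𝒰 Q) where
  compl := Quotient.map (fun X j => (X j)ᶜ) (fun X X' h => by
    change Tendsto _ _ _
    simp only [dist_compl]
    exact h)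

theorem ultra_ind {p : UltraCarrier 𝒰 Q → Prop} (h : ∀ X, p (UltraCarrier.mk 𝒰 Q X))
    (a : UltraCarrier 𝒰 Q) : p a := Quotient.ind h a

instance : Lattice (UltraCarrier 𝒰 Q) :=
  Lattice.mk'
    (ultra_ind 𝒰 Q fun X => ultra_ind 𝒰 Q fun Y => congrArg (UltraCarrier.mk 𝒰 Q) (sup_comm X Y))
    (ultra_ind 𝒰 Q fun X => ultra_ind 𝒰 Q fun Y => ultra_ind 𝒰 Q fun Z =>
      congrArg (UltraCarrier.mk 𝒰 Q) (sup_assoc X Y Z))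
    (ultra_ind 𝒰 Q fun X => ultra_ind 𝒰 Q fun Y => congrArg (UltraCarrier.mk 𝒰 Q) (inf_comm X Y))
    (ultra_ind 𝒰 Q fun X => ultra_ind 𝒰 Q fun Y => ultra_ind 𝒰 Q fun Z =>
      congrArg (UltraCarrier.mk 𝒰 Q) (inf_assoc X Y Z))
    (ultra_ind 𝒰 Q fun X => ultra_ind 𝒰 Q fun Y =>
      congrArg (UltraCarrier.mk 𝒰 Q) (sup_inf_self (a := X) (b := Y)))
    (ultra_ind 𝒰 Q fun X => ultra_ind 𝒰 Q fun Y =>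
      congrArg (UltraCarrier.mk 𝒰 Q) (inf_sup_self (a := X) (b := Y)))

instance : BooleanAlgebra (UltraCarrier 𝒰 Q) where
  le_sup_inf := ultra_ind 𝒰 Q fun X => ultra_ind 𝒰 Q fun Y => ultra_ind 𝒰 Q fun Z =>
    le_of_eq (congrArg (UltraCarrier.mk 𝒰 Q) (sup_inf_left X Y Z).symm)
  top := UltraCarrier.mk 𝒰 Q ⊤
  bot := UltraCarrier.mk 𝒰 Q ⊥
  inf_compl_le_bot := ultra_ind 𝒰 Q fun X =>
    le_of_eq (congrArg (UltraCarrier.mk 𝒰 Q) (inf_compl_eq_bot (a := X)))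
  top_le_sup_compl := ultra_ind 𝒰 Q fun X =>
    le_of_eq (congrArg (UltraCarrier.mk 𝒰 Q) (sup_compl_eq_top (x := X)).symm)
  le_top := ultra_ind 𝒰 Q fun X =>
    inf_eq_left.mp (congrArg (UltraCarrier.mk 𝒰 Q) (inf_top_eq X))
  bot_le := ultra_ind 𝒰 Q fun X =>
    inf_eq_left.mp (congrArg (UltraCarrier.mk 𝒰 Q) (bot_inf_eq X))

theorem mk_inf (X Y : ∀ j, (Q j).carrier) :
    UltraCarrier.mk 𝒰 Q X ⊓ UltraCarrier.mk 𝒰 Q Y = UltraCarrier.mk 𝒰 Q (X ⊓ Y) := rfl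

theorem mk_sup (X Y : ∀ j, (Q j).carrier) :
    UltraCarrier.mk 𝒰 Q X ⊔ UltraCarrier.mk 𝒰 Q Y = UltraCarrier.mk 𝒰 Q (X ⊔ Y) := rfl

theorem mk_compl (X : ∀ j, (Q j).carrier) :
    (UltraCarrier.mk 𝒰 Q X)ᶜ = UltraCarrier.mk 𝒰 Q Xᶜ := rfl

instance : MulAction Γ (UltraCarrier 𝒰 Q) where
  smul g := Quotient.map (fun X j => g • X j) (fun X X' h => by
    change Tendsto _ _ _
    simp only [dist_smul]
    exact h)
  one_smul := ultra_ind 𝒰 Q fun X =>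
    congrArg (UltraCarrier.mk 𝒰 Q) (funext fun j => one_smul Γ (X j))
  mul_smul g h := ultra_ind 𝒰 Q fun X =>
    congrArg (UltraCarrier.mk 𝒰 Q) (funext fun j => mul_smul g h (X j))

theorem smul_mk (g : Γ) (X : ∀ j, (Q j).carrier) :
    g • UltraCarrier.mk 𝒰 Q X = UltraCarrier.mk 𝒰 Q (fun j => g • X j) := rfl

theorem tendsto_measure (X : ∀ j, (Q j).carrier) :
    Tendsto (fun j => (Q j).measure (X j)) 𝒰
      (𝓝 (limUnder (𝒰 : Filter I) fun j => (Q j).measure (X j))) := by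
  refine tendsto_nhds_limUnder ?_
  obtain ⟨a, -, ha⟩ := (isCompact_Icc (a := (0 : ℝ)) (b := 1)).ultrafilter_le_nhds
    (𝒰.map fun j => (Q j).measure (X j)) (by
      rw [le_principal_iff]
      exact mem_map.mpr (Filter.univ_mem' fun j =>
        ⟨(Q j).measure_nonneg _, (Q j).measure_le_one _⟩))
  exact ⟨a, ha⟩

/-- The measure on the metric ultraproduct: the limit of the measures along the ultrafilter. -/
noncomputable def ultraMeasure : UltraCarrier 𝒰 Q → ℝ :=
  Quotient.lift (fun X => limUnder (𝒰 : Filter I) fun j => (Q j).measure (X j))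
    (fun X Y h => by
      have h1 := (tendsto_measure 𝒰 Q X).sub (tendsto_measure 𝒰 Q Y)
      have h2 : Tendsto (fun j => (Q j).measure (X j) - (Q j).measure (Y j)) 𝒰 (𝓝 0) :=
        squeeze_zero_norm (fun j => (Q j).abs_measure_sub_le _ _) h
      exact sub_eq_zero.mp (tendsto_nhds_unique h1 h2))

theorem ultraMeasure_mk_tendsto (X : ∀ j, (Q j).carrier) :
    Tendsto (fun j => (Q j).measure (X j)) 𝒰 (𝓝 (ultraMeasure 𝒰 Q (UltraCarrier.mk 𝒰 Q X))) :=
  tendsto_measure 𝒰 Q X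

/-- The metric ultraproduct of a family of measured `Γ`-Boolean algebras. -/
noncomputable def ultraproduct : MeasuredBoolAlg.{u, max v w} Γ where
  carrier := UltraCarrier 𝒰 Q
  smul_inf g := ultra_ind 𝒰 Q fun X => ultra_ind 𝒰 Q fun Y =>
    congrArg (UltraCarrier.mk 𝒰 Q) (funext fun j => (Q j).smul_inf g (X j) (Y j))
  smul_compl g := ultra_ind 𝒰 Q fun X =>
    congrArg (UltraCarrier.mk 𝒰 Q) (funext fun j => (Q j).smul_compl g (X j))
  measure := ultraMeasure 𝒰 Q
  measure_nonneg := ultra_ind 𝒰 Q fun X =>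
    ge_of_tendsto' (ultraMeasure_mk_tendsto 𝒰 Q X) fun j => (Q j).measure_nonneg _
  measure_le_one := ultra_ind 𝒰 Q fun X =>
    le_of_tendsto' (ultraMeasure_mk_tendsto 𝒰 Q X) fun j => (Q j).measure_le_one _
  measure_sup_add_inf := ultra_ind 𝒰 Q fun X => ultra_ind 𝒰 Q fun Y => by
    change ultraMeasure 𝒰 Q (UltraCarrier.mk 𝒰 Q (X ⊔ Y)) +
      ultraMeasure 𝒰 Q (UltraCarrier.mk 𝒰 Q (X ⊓ Y)) = _
    refine tendsto_nhds_unique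
      ((ultraMeasure_mk_tendsto 𝒰 Q _).add (ultraMeasure_mk_tendsto 𝒰 Q _)) ?_
    refine ((ultraMeasure_mk_tendsto 𝒰 Q X).add (ultraMeasure_mk_tendsto 𝒰 Q Y)).congr ?_
    exact fun j => ((Q j).measure_sup_add_inf (X j) (Y j)).symm
  measure_bot := by
    refine tendsto_nhds_unique (ultraMeasure_mk_tendsto 𝒰 Q ⊥) ?_
    simp [measure_bot]
  measure_top := by
    refine tendsto_nhds_unique (ultraMeasure_mk_tendsto 𝒰 Q ⊤) ?_
    simp [measure_top]
  measure_smul g := ultra_ind 𝒰 Q fun X => by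
    rw [smul_mk]
    refine tendsto_nhds_unique (ultraMeasure_mk_tendsto 𝒰 Q _) ?_
    simpa only [measure_smul] using ultraMeasure_mk_tendsto 𝒰 Q X

end Ultraproduct

/-- `P` is weakly contained in the family `𝓕`: it is contained in a metric ultraproduct, along a
non-principal ultrafilter, of members of `𝓕`. -/
def IsWeaklyContainedIn (P : MeasuredBoolAlg.{u, v} Γ) (𝓕 : Set (MeasuredBoolAlg.{u, w} Γ)) :
    Prop :=
  ∃ (I : Type v) (𝒰 : Ultrafilter I) (Q : I → MeasuredBoolAlg.{u, w} Γ),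
    (𝒰 : Filter I) ≤ cofinite ∧ (∀ j, Q j ∈ 𝓕) ∧ P.IsContainedIn (ultraproduct 𝒰 Q)

/-- If the kernel of a surjection `π : F → Γ` acts trivially on a measured `F`-Boolean algebra, this
is the resulting measured `Γ`-Boolean algebra. -/
noncomputable def descend {F : Type w} [Group F] (Q : MeasuredBoolAlg.{w, v} F) (π : F →* Γ)
    (hπ : Function.Surjective π) (hQ : ∀ g ∈ π.ker, ∀ X : Q.carrier, g • X = X) :
    MeasuredBoolAlg.{u, v} Γ :=
  have key : ∀ (g h : F), π g = π h → ∀ X : Q.carrier, g • X = h • X := fun g h e X => by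
    have := hQ (h⁻¹ * g) (by simp [MonoidHom.mem_ker, e]) X
    rw [mul_smul, inv_smul_eq_iff] at this
    exact this
  letI : MulAction Γ Q.carrier :=
    { smul := fun γ X => Function.surjInv hπ γ • X
      one_smul := fun X =>
        (key _ 1 (by rw [Function.surjInv_eq hπ, map_one]) X).trans (one_smul F X)
      mul_smul := fun γ γ' X =>
        (key _ (Function.surjInv hπ γ * Function.surjInv hπ γ')
          (by rw [map_mul, Function.surjInv_eq hπ, Function.surjInv_eq hπ, Function.surjInv_eq hπ]) X).trans (mul_smul _ _ X) }
  { carrier := Q.carrier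
    smul_inf := fun _ => Q.smul_inf _
    smul_compl := fun _ => Q.smul_compl _
    measure := Q.measure
    measure_nonneg := Q.measure_nonneg
    measure_le_one := Q.measure_le_one
    measure_sup_add_inf := Q.measure_sup_add_inf
    measure_bot := Q.measure_bot
    measure_top := Q.measure_top
    measure_smul := fun _ => Q.measure_smul _ }

end MeasuredBoolAlg

/-! ### Sofic representations and stability -/

/-- The normalized Hamming length of a permutation: the proportion of points that are moved. -/
noncomputable def hammingLength {k : ℕ} (σ : Equiv.Perm (Fin k)) : ℝ :=
  (σ.support.card : ℝ) / k

/-- A group is sofic if, for every finite subset `K` and every `ε > 0`, there is a map into some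
finite symmetric group that is `ε`-multiplicative on `K` and moves, for every nontrivial element of
`K`, all but an `ε`-proportion of the points. -/
def IsSofic (G : Type u) [Group G] : Prop :=
  ∀ (K : Finset G) (ε : ℝ), 0 < ε →
    ∃ (k : ℕ) (_ : 0 < k) (φ : G → Equiv.Perm (Fin k)),
      (∀ g ∈ K, ∀ h ∈ K, hammingLength (φ (g * h) * (φ g * φ h)⁻¹) < ε) ∧
        ∀ g ∈ K, g ≠ 1 → 1 - ε < hammingLength (φ g)

/-- A finite presentation of `Γ`: a surjection from a free group of finite rank and a finite set of
relators that generates the kernel as a normal subgroup. -/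
structure FinitePresentation (Γ : Type u) [Group Γ] where
  rank : ℕ
  π : FreeGroup (Fin rank) →* Γ
  surjective : Function.Surjective π
  relators : Finset (FreeGroup (Fin rank))
  normalClosure_relators : Subgroup.normalClosure (relators : Set (FreeGroup (Fin rank))) = π.ker

/-- A sofic representation (or sofic approximation) of a finitely presented group. -/
structure SoficRepresentation {Γ : Type u} [Group Γ] (S : FinitePresentation Γ) where
  k : ℕ → ℕ
  k_pos : ∀ n, 0 < k n
  σ : ∀ n, FreeGroup (Fin S.rank) →* Equiv.Perm (Fin (k n))
  tendsto_relators : ∀ r ∈ S.relators, Tendsto (fun n => hammingLength (σ n r)) atTop (𝓝 0)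
  tendsto_not_mem_ker : ∀ g, g ∉ S.π.ker → Tendsto (fun n => hammingLength (σ n g)) atTop (𝓝 1)

namespace SoficRepresentation

variable {Γ : Type u} [Group Γ] {S : FinitePresentation Γ} (ρ : SoficRepresentation S)

theorem hammingLength_nonneg {k : ℕ} (σ : Equiv.Perm (Fin k)) : 0 ≤ hammingLength σ := by
  unfold hammingLength; positivity

theorem tendsto_ker (g : FreeGroup (Fin S.rank)) (hg : g ∈ S.π.ker) :
    Tendsto (fun n => hammingLength (ρ.σ n g)) atTop (𝓝 0) := by
  let N : Subgroup (FreeGroup (Fin S.rank)) :=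
    { carrier := {g | Tendsto (fun n => hammingLength (ρ.σ n g)) atTop (𝓝 0)}
      one_mem' := by simp [hammingLength]
      mul_mem' := fun {a b} ha hb => by
        refine squeeze_zero (fun n => hammingLength_nonneg _) (fun n => ?_)
          (by simpa using Tendsto.add (show Tendsto _ _ _ from ha) (show Tendsto _ _ _ from hb))
        simp only [hammingLength, map_mul, ← add_div]
        gcongr
        have h1 := Finset.card_le_card (Equiv.Perm.support_mul_le (ρ.σ n a) (ρ.σ n b))
        have h2 := Finset.card_union_le (ρ.σ n a).support (ρ.σ n b).support
        exact_mod_cast h1.trans h2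
      inv_mem' := fun {a} ha => by simpa [hammingLength] using ha }
  have hN : N.Normal := ⟨fun a ha b => by
    change Tendsto _ _ _
    have : ∀ n, hammingLength (ρ.σ n (b * a * b⁻¹)) = hammingLength (ρ.σ n a) := fun n => by
      simp only [hammingLength, map_mul, map_inv, Equiv.Perm.card_support_conj]
    simp only [this]
    exact ha⟩
  have hle : Subgroup.normalClosure (S.relators : Set (FreeGroup (Fin S.rank))) ≤ N :=
    Subgroup.normalClosure_le_normal fun r hr => ρ.tendsto_relators r hr
  rw [S.normalClosure_relators] at hle
  exact hle hg

/-- The power set of `{1, …, k n}` with the action of the free group given by `σ n`. -/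
noncomputable def level (n : ℕ) : MeasuredBoolAlg.{0, 0} (FreeGroup (Fin S.rank)) :=
  haveI : Nonempty (Fin (ρ.k n)) := ⟨⟨0, ρ.k_pos n⟩⟩
  MeasuredBoolAlg.ofPerm (Fin (ρ.k n)) (ρ.σ n)

theorem dist_level_le (n : ℕ) (g : FreeGroup (Fin S.rank)) (X : (ρ.level n).carrier) :
    (ρ.level n).dist (g • X) X ≤ hammingLength (ρ.σ n g) := by
  rw [MeasuredBoolAlg.dist_eq]
  change ((symmDiff (ρ.σ n g '' X) X : Set (Fin (ρ.k n))).ncard : ℝ) / (Nat.card (Fin (ρ.k n)) : ℝ)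
    ≤ _
  rw [Nat.card_fin]
  unfold hammingLength
  gcongr
  rw [← Set.ncard_coe_finset]
  refine Set.ncard_le_ncard ?_ (Set.toFinite _)
  intro y hy
  simp only [Finset.mem_coe, Equiv.Perm.mem_support]
  intro hfix
  rcases hy with ⟨⟨z, hz, hzy⟩, hy⟩ | ⟨hy, hy'⟩
  · have : z = y := (ρ.σ n g).injective (hzy.trans hfix.symm)
    exact hy (this ▸ hz)
  · exact hy' ⟨y, hy, hfix⟩

/-- The limit action of a sofic representation along a non-principal ultrafilter on `ℕ`: the metric
ultraproduct of the measured Boolean algebras given by the `σ n`. The kernel of the presentation acts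
trivially on it, so it is a measured `Γ`-Boolean algebra. -/
noncomputable def limitAction (𝒰 : Ultrafilter ℕ) (h𝒰 : (𝒰 : Filter ℕ) ≤ cofinite) :
    MeasuredBoolAlg.{u, 0} Γ :=
  MeasuredBoolAlg.descend (MeasuredBoolAlg.ultraproduct 𝒰 ρ.level) S.π S.surjective
    (fun g hg => MeasuredBoolAlg.ultra_ind 𝒰 ρ.level fun X => Quotient.sound (by
      refine squeeze_zero (fun n => MeasuredBoolAlg.dist_nonneg _ _ _)
        (fun n => ρ.dist_level_le n g (X n)) ?_
      exact (ρ.tendsto_ker g hg).mono_left (h𝒰.trans Nat.cofinite_eq_atTop.le)))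

end SoficRepresentation

/-- `Γ` is stable in finite actions: fixing a finite presentation of `Γ` (the choice is immaterial),
the limit action of every sofic representation, along every non-principal ultrafilter, is weakly
contained in the family of finite actions of `Γ`. -/
def IsStableInFiniteActions (Γ : Type u) [Group Γ] : Prop :=
  ∃ S : FinitePresentation Γ, ∀ (ρ : SoficRepresentation S) (𝒰 : Ultrafilter ℕ)
    (h𝒰 : (𝒰 : Filter ℕ) ≤ cofinite),
    (ρ.limitAction 𝒰 h𝒰).IsWeaklyContainedIn (MeasuredBoolAlg.finiteActions.{u, 0} Γ)

/-! ### The group of `A`-valued elements of a Boolean algebra -/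

/-- The abelian group `P(A)` generated by symbols `X ⊗ a` with `X ∈ P`, `a ∈ A`, subject to
`X ⊗ a + Y ⊗ b = (X \ Y) ⊗ a + (Y \ X) ⊗ b + (X ⊓ Y) ⊗ (a + b)`.
Every element has a unique expression `∑ a ≠ 0, X a ⊗ a` with pairwise disjoint `X a`; it is
recorded here by the partition of unity `(X a)` indexed by `A`, where `X 0` is the complement of the
others. The symbols are `PTensor.tmul`; see `PTensor.tmul_add_tmul` and `PTensor.sum_tmul`. -/
structure PTensor (P : Type v) [BooleanAlgebra P] (A : Type w) [Fintype A] where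
  part : A → P
  disjoint : ∀ a b, a ≠ b → Disjoint (part a) (part b)
  sup_eq_top : Finset.univ.sup part = ⊤

namespace PTensor

variable {P : Type v} [BooleanAlgebra P] {A : Type w} [Fintype A]

theorem ext_of_le {s t : PTensor P A} (h : ∀ a, s.part a ≤ t.part a) : s = t := by
  have : s.part = t.part := by
    funext a
    refine le_antisymm (h a) ?_
    calc t.part a = t.part a ⊓ Finset.univ.sup s.part := by rw [s.sup_eq_top, inf_top_eq]
      _ ≤ s.part a := by
        rw [Finset.sup_inf_distrib_left]
        refine Finset.sup_le fun b _ => ?_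
        by_cases hab : a = b
        · subst hab; exact inf_le_right
        · exact ((t.disjoint a b hab).mono_right (h b)).eq_bot.trans_le bot_le
  cases s; cases t; congr

theorem ext_of_cover {ι : Type x} [Fintype ι] (Z : ι → P) (hZ : Finset.univ.sup Z = ⊤)
    {s t : PTensor P A} (h : ∀ i, ∃ a, Z i ≤ s.part a ∧ Z i ≤ t.part a) : s = t := by
  refine ext_of_le fun a => ?_
  calc s.part a = s.part a ⊓ Finset.univ.sup Z := by rw [hZ, inf_top_eq]
    _ ≤ t.part a := by
      rw [Finset.sup_inf_distrib_left]
      refine Finset.sup_le fun i _ => ?_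
      obtain ⟨b, hs, ht⟩ := h i
      by_cases hab : a = b
      · subst hab; exact inf_le_right.trans ht
      · exact ((s.disjoint a b hab).mono_right hs).eq_bot.trans_le bot_le

theorem sup_prod (s t : PTensor P A) :
    (Finset.univ.sup fun p : A × A => s.part p.1 ⊓ t.part p.2) = ⊤ := by
  rw [← Finset.univ_product_univ, ← Finset.sup_inf_sup, s.sup_eq_top, t.sup_eq_top, inf_top_eq]

variable [AddCommGroup A]

open Classical in
/-- The symbol `X ⊗ a`: it has value `a` on `X` and value `0` off `X`. -/
noncomputable def tmul (X : P) (a : A) : PTensor P A where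
  part c := (if c = a then X else ⊥) ⊔ (if c = 0 then Xᶜ else ⊥)
  disjoint c d hcd := by
    by_cases h1 : c = a <;> by_cases h2 : d = a <;> by_cases h3 : c = 0 <;> by_cases h4 : d = 0 <;>
      simp_all [disjoint_compl_left, disjoint_compl_right]
  sup_eq_top := by
    rw [eq_top_iff, ← sup_compl_eq_top (x := X)]
    refine sup_le ?_ ?_
    · refine le_trans ?_ (Finset.le_sup (Finset.mem_univ a))
      simp
    · refine le_trans ?_ (Finset.le_sup (Finset.mem_univ (0 : A)))
      simp

theorem le_tmul {X Z : P} (a : A) (h : Z ≤ X) : Z ≤ (tmul X a).part a :=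
  h.trans (by simp [tmul])

theorem le_tmul_zero {X Z : P} (a : A) (h : Z ≤ Xᶜ) : Z ≤ (tmul X a).part 0 :=
  h.trans (by simp [tmul])

noncomputable instance : Zero (PTensor P A) := ⟨tmul ⊤ 0⟩

/-- Addition of values: `s + t` has value `c` where `s` has some value `a` and `t` has value
`c - a`. -/
instance : Add (PTensor P A) where
  add s t :=
    { part := fun c => Finset.univ.sup fun a => s.part a ⊓ t.part (c - a)
      disjoint := fun c d hcd => by
        rw [Finset.disjoint_sup_left]
        intro a _
        rw [Finset.disjoint_sup_right]
        intro b _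
        by_cases hab : a = b
        · subst hab
          exact (t.disjoint (c - a) (d - a) (by simpa using hcd)).mono inf_le_right inf_le_right
        · exact (s.disjoint a b hab).mono inf_le_left inf_le_left
      sup_eq_top := by
        rw [eq_top_iff, ← inf_top_eq (⊤ : P)]
        nth_rewrite 1 [← s.sup_eq_top]
        rw [← t.sup_eq_top, Finset.sup_inf_distrib_right]
        refine Finset.sup_le fun a _ => ?_
        rw [Finset.sup_inf_distrib_left]
        refine Finset.sup_le fun b _ => ?_
        refine le_trans ?_ (Finset.le_sup (Finset.mem_univ (a + b)))
        refine le_trans ?_ (Finset.le_sup (Finset.mem_univ a))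
        simp }

instance : Neg (PTensor P A) where
  neg s :=
    { part := fun c => s.part (-c)
      disjoint := fun c d hcd => s.disjoint _ _ (by simpa using hcd)
      sup_eq_top := by
        rw [eq_top_iff, ← s.sup_eq_top]
        refine Finset.sup_le fun a _ => ?_
        refine le_trans ?_ (Finset.le_sup (Finset.mem_univ (-a)))
        simp }

theorem le_add {s t : PTensor P A} {Z : P} {a b : A} (hs : Z ≤ s.part a) (ht : Z ≤ t.part b) :
    Z ≤ (s + t).part (a + b) := by
  refine le_trans ?_ (Finset.le_sup (f := fun c => s.part c ⊓ t.part (a + b - c))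
    (Finset.mem_univ a))
  simpa using ⟨hs, ht⟩

theorem le_zero (Z : P) : Z ≤ (0 : PTensor P A).part 0 := le_tmul 0 le_top

noncomputable instance : AddCommGroup (PTensor P A) where
  add_assoc s t r := by
    refine ext_of_cover (fun p : (A × A) × A => (s.part p.1.1 ⊓ t.part p.1.2) ⊓ r.part p.2) ?_ ?_
    · rw [← Finset.univ_product_univ]
      rw [← Finset.sup_inf_sup Finset.univ Finset.univ
        (fun p : A × A => s.part p.1 ⊓ t.part p.2) r.part, sup_prod, r.sup_eq_top, inf_top_eq]
    · rintro ⟨⟨a, b⟩, c⟩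
      have h1 : s.part a ⊓ t.part b ⊓ r.part c ≤ s.part a := inf_le_left.trans inf_le_left
      have h2 : s.part a ⊓ t.part b ⊓ r.part c ≤ t.part b := inf_le_left.trans inf_le_right
      have h3 : s.part a ⊓ t.part b ⊓ r.part c ≤ r.part c := inf_le_right
      exact ⟨a + b + c, le_add (le_add h1 h2) h3, add_assoc a b c ▸ le_add h1 (le_add h2 h3)⟩
  zero_add s := ext_of_cover s.part s.sup_eq_top fun a =>
    ⟨a, by simpa using le_add (le_zero (s.part a)) (le_refl (s.part a)), le_rfl⟩
  add_zero s := ext_of_cover s.part s.sup_eq_top fun a =>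
    ⟨a, by simpa using le_add (le_refl (s.part a)) (le_zero (s.part a)), le_rfl⟩
  nsmul := nsmulRec
  zsmul := zsmulRec
  neg_add_cancel s := ext_of_cover s.part s.sup_eq_top fun a => by
    refine ⟨0, ?_, le_zero _⟩
    have h : s.part a ≤ (-s).part (-a) := by
      change _ ≤ s.part (- -a)
      rw [neg_neg]
    simpa using le_add h (le_refl (s.part a))
  add_comm s t := by
    refine ext_of_cover (fun p : A × A => s.part p.1 ⊓ t.part p.2) (sup_prod s t) ?_
    rintro ⟨a, b⟩
    exact ⟨a + b, le_add inf_le_left inf_le_right,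
      add_comm b a ▸ le_add inf_le_right inf_le_left⟩

/-- The defining relation between the symbols. -/
theorem tmul_add_tmul (X Y : P) (a b : A) :
    tmul X a + tmul Y b = tmul (X \ Y) a + tmul (Y \ X) b + tmul (X ⊓ Y) (a + b) := by
  refine ext_of_cover ![X ⊓ Y, X \ Y, Y \ X, (X ⊔ Y)ᶜ] ?_ ?_
  · rw [eq_top_iff]
    nth_rewrite 1 [← sup_compl_eq_top (x := X ⊔ Y)]
    refine sup_le (sup_le ?_ ?_) (Finset.le_sup (f := ![X ⊓ Y, X \ Y, Y \ X, (X ⊔ Y)ᶜ])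
      (Finset.mem_univ 3))
    · conv_lhs => rw [← sup_inf_sdiff X Y]
      exact sup_le
        (by simpa using Finset.le_sup (f := ![X ⊓ Y, X \ Y, Y \ X, (X ⊔ Y)ᶜ]) (Finset.mem_univ 0))
        (by simpa using Finset.le_sup (f := ![X ⊓ Y, X \ Y, Y \ X, (X ⊔ Y)ᶜ]) (Finset.mem_univ 1))
    · conv_lhs => rw [← sup_inf_sdiff Y X, inf_comm]
      exact sup_le
        (by simpa [inf_comm] using
          Finset.le_sup (f := ![X ⊓ Y, X \ Y, Y \ X, (X ⊔ Y)ᶜ]) (Finset.mem_univ 0))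
        (by simpa using Finset.le_sup (f := ![X ⊓ Y, X \ Y, Y \ X, (X ⊔ Y)ᶜ]) (Finset.mem_univ 2))
  · have e1 : X ⊓ Y ≤ (X \ Y)ᶜ := by
      rw [le_compl_iff_disjoint_right]; exact disjoint_sdiff_self_right.mono_left inf_le_right
    have e2 : X ⊓ Y ≤ (Y \ X)ᶜ := by
      rw [le_compl_iff_disjoint_right]; exact disjoint_sdiff_self_right.mono_left inf_le_left
    have e3 : X \ Y ≤ (Y \ X)ᶜ := by
      rw [le_compl_iff_disjoint_right]; exact disjoint_sdiff_sdiff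
    have e4 : X \ Y ≤ Yᶜ := by rw [sdiff_eq]; exact inf_le_right
    have e5 : Y \ X ≤ Xᶜ := by rw [sdiff_eq]; exact inf_le_right
    have e6 : (X ⊔ Y)ᶜ ≤ Xᶜ := compl_le_compl le_sup_left
    have e7 : (X ⊔ Y)ᶜ ≤ Yᶜ := compl_le_compl le_sup_right
    intro i
    fin_cases i
    · exact ⟨a + b, le_add (le_tmul a inf_le_left) (le_tmul b inf_le_right), by
        simpa using le_add (le_add (le_tmul_zero a e1) (le_tmul_zero b e2))
          (le_tmul (a + b) (le_refl (X ⊓ Y)))⟩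
    · refine ⟨a, by simpa using le_add (le_tmul a sdiff_le) (le_tmul_zero b e4), ?_⟩
      simpa using le_add (le_add (le_tmul a (le_refl (X \ Y))) (le_tmul_zero b e3))
        (le_tmul_zero (a + b) (e4.trans (compl_le_compl inf_le_right)))
    · refine ⟨b, by simpa using le_add (le_tmul_zero a e5) (le_tmul b sdiff_le), ?_⟩
      simpa using le_add (le_add (le_tmul_zero a (le_compl_comm.mp e3))
        (le_tmul b (le_refl (Y \ X)))) (le_tmul_zero (a + b)
          (e5.trans (compl_le_compl inf_le_left)))
    · refine ⟨0, by simpa using le_add (le_tmul_zero a e6) (le_tmul_zero b e7), ?_⟩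
      simpa using le_add (le_add (le_tmul_zero a (e6.trans (compl_le_compl sdiff_le)))
        (le_tmul_zero b (e7.trans (compl_le_compl sdiff_le))))
        (le_tmul_zero (a + b) (e6.trans (compl_le_compl inf_le_left)))

theorem le_sum {ι : Type x} (T : Finset ι) (s : ι → PTensor P A) (a : ι → A) {Z : P}
    (h : ∀ i ∈ T, Z ≤ (s i).part (a i)) : Z ≤ (∑ i ∈ T, s i).part (∑ i ∈ T, a i) := by
  classical
  induction T using Finset.induction_on with
  | empty => simpa using le_zero Z
  | insert i T hi ih =>
    rw [Finset.sum_insert hi, Finset.sum_insert hi]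
    exact le_add (h i (Finset.mem_insert_self i T))
      (ih fun j hj => h j (Finset.mem_insert_of_mem hj))

/-- Every element is the sum of the symbols given by its parts. -/
theorem sum_tmul (s : PTensor P A) : ∑ a, tmul (s.part a) a = s := by
  classical
  refine ext_of_cover s.part s.sup_eq_top fun c => ⟨c, ?_, le_rfl⟩
  have h := le_sum (Z := s.part c) Finset.univ (fun a => tmul (s.part a) a)
    (fun a => if a = c then c else 0) (fun a _ => by
      by_cases hac : a = c
      · subst hac; simpa using le_tmul a (le_refl (s.part a))
      · simp only [hac, if_false]
        refine le_tmul_zero a ?_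
        rw [le_compl_iff_disjoint_right]
        exact s.disjoint c a (Ne.symm hac))
  simpa using h

end PTensor

namespace MeasuredBoolAlg

variable {Γ : Type u} [Group Γ] (P : MeasuredBoolAlg.{u, v} Γ) (A : Type w) [AddCommGroup A]
  [Fintype A]

/-- The coefficient module `P(A)` of a measured `Γ`-Boolean algebra. -/
abbrev Coeff : Type (max v w) := PTensor P.carrier A

noncomputable instance : DistribMulAction Γ (P.Coeff A) where
  smul g s :=
    { part := fun a => g • s.part a
      disjoint := fun a b hab => by
        rw [disjoint_iff, ← P.smul_inf, (s.disjoint a b hab).eq_bot, P.smul_bot]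
      sup_eq_top := by
        have h := Finset.apply_sup_eq_sup_comp (s := Finset.univ) (f := s.part)
          (fun X : P.carrier => g • X) (P.smul_sup g) (P.smul_bot g)
        rw [s.sup_eq_top, P.smul_top] at h
        exact h.symm }
  one_smul s := PTensor.ext_of_le fun a => (one_smul Γ (s.part a)).le
  mul_smul g h s := PTensor.ext_of_le fun a => (mul_smul g h (s.part a)).le
  smul_zero g := by
    refine PTensor.ext_of_cover (fun _ : Unit => (⊤ : P.carrier)) (by simp) fun _ =>
      ⟨0, ?_, PTensor.le_zero _⟩
    change _ ≤ g • PTensor.part 0 0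
    rw [top_le_iff.mp (PTensor.le_zero (A := A) (⊤ : P.carrier)), P.smul_top]
  smul_add g s t := by
    have hmono : ∀ {X Y : P.carrier}, X ≤ Y → g • X ≤ g • Y := fun {X Y} h => by
      rw [← inf_eq_left, ← P.smul_inf, inf_eq_left.mpr h]
    refine PTensor.ext_of_cover (fun p : A × A => g • (s.part p.1 ⊓ t.part p.2)) ?_ ?_
    · have h := Finset.apply_sup_eq_sup_comp (s := Finset.univ)
        (f := fun p : A × A => s.part p.1 ⊓ t.part p.2)
        (fun X : P.carrier => g • X) (P.smul_sup g) (P.smul_bot g)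
      rw [PTensor.sup_prod, P.smul_top] at h
      exact h.symm
    · rintro ⟨a, b⟩
      exact ⟨a + b, hmono (PTensor.le_add inf_le_left inf_le_right),
        PTensor.le_add (hmono inf_le_left) (hmono inf_le_right)⟩

open Classical in
/-- The extension of the measure to `P(A)`: `μ(∑ a ≠ 0, X a ⊗ a) = ∑ a ≠ 0, μ(X a)` for disjoint
`X a`. -/
noncomputable def coeffMeasure {A : Type w} [AddCommGroup A] [Fintype A] (s : P.Coeff A) : ℝ :=
  ∑ a ∈ Finset.univ.filter (fun a : A => a ≠ 0), P.measure (s.part a)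

end MeasuredBoolAlg

/-! ### Simplicial complexes and finite classifying spaces -/

/-- The geometric realization of an abstract simplicial complex, by barycentric coordinates. -/
def Realization {V : Type w} (K : AbstractSimplicialComplex V) : Type w :=
  {p : V → ℝ // (∀ a, 0 ≤ p a) ∧ ∃ s ∈ K.faces, (∀ a, a ∉ s → p a = 0) ∧ ∑ a ∈ s, p a = 1}

open Classical in
/-- The inclusion of the closed simplex spanned by a face. -/
noncomputable def faceInclusion {V : Type w} (K : AbstractSimplicialComplex V) (s : K.faces)
    (q : stdSimplex ℝ {a // a ∈ s.1}) : Realization K :=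
  ⟨fun a => if h : a ∈ s.1 then q.1 ⟨a, h⟩ else 0,
    fun a => by
      by_cases h : a ∈ s.1
      · simpa [h] using q.2.1 ⟨a, h⟩
      · simp [h],
    s.1, s.2, fun a h => by simp [h], by
      rw [← Finset.sum_attach, ← q.2.2]
      exact Finset.sum_congr rfl fun a _ => by simp [a.2]⟩

/-- The weak topology on the geometric realization: a set is open if and only if its intersection
with every closed simplex is open in that simplex. -/
noncomputable instance {V : Type w} (K : AbstractSimplicialComplex V) : TopologicalSpace (Realization K) :=
  ⨆ s : K.faces, TopologicalSpace.coinduced (faceInclusion K s) inferInstance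

/-- The translate of a finite set of vertices by a group element. -/
def translate {Γ : Type u} [Group Γ] {V : Type w} [MulAction Γ V] (g : Γ) (s : Finset V) :
    Finset V :=
  s.map (MulAction.toPerm g).toEmbedding

/-- A finite model for the classifying space `BΓ`, given by a contractible simplicial complex `EΓ`
with a simplicial action of `Γ` that is free (no nontrivial element maps a simplex to itself) and has
finitely many orbits of simplices. -/
structure FiniteClassifyingSpace (Γ : Type u) [Group Γ] where
  V : Type w
  [action : MulAction Γ V]
  K : AbstractSimplicialComplex V
  translate_mem : ∀ (g : Γ), ∀ s ∈ K.faces, translate g s ∈ K.faces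
  contractible : ContractibleSpace (Realization K)
  free : ∀ (g : Γ), ∀ s ∈ K.faces, translate g s = s → g = 1
  cofinite : ∃ T : Set (Finset V), T.Finite ∧ ∀ s ∈ K.faces, ∃ g : Γ, translate g s ∈ T

attribute [instance] FiniteClassifyingSpace.action

namespace FiniteClassifyingSpace

variable {Γ : Type u} [Group Γ] (E : FiniteClassifyingSpace.{u, w} Γ)

/-- The `i`-simplices of `EΓ`. -/
def Simplex (i : ℕ) : Type w := {s : Finset E.V // s ∈ E.K.faces ∧ s.card = i + 1}

instance (i : ℕ) : MulAction Γ (E.Simplex i) where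
  smul g s := ⟨translate g s.1, E.translate_mem g _ s.2.1, by simp [translate, s.2.2]⟩
  one_smul s := Subtype.ext (by
    change translate 1 s.1 = s.1
    ext a; simp [translate])
  mul_smul g h s := Subtype.ext (by
    change translate (g * h) s.1 = translate g (translate h s.1)
    ext a; simp [translate, mul_smul])

/-- The `i`-simplices of `BΓ`, that is, the orbits of `i`-simplices of `EΓ`. -/
def Cell (i : ℕ) : Type w := MulAction.orbitRel.Quotient Γ (E.Simplex i)

/-- The cell of `BΓ` below a simplex of `EΓ`. -/
def cellOf {i : ℕ} (s : E.Simplex i) : E.Cell i :=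
  Quotient.mk (MulAction.orbitRel Γ (E.Simplex i)) s

instance (i : ℕ) : Finite (E.Cell i) := by
  obtain ⟨T, hT, h⟩ := E.cofinite
  have : Finite {s : E.Simplex i // s.1 ∈ T} :=
    haveI := hT.to_subtype
    Finite.of_injective (fun s => (⟨s.1.1, s.2⟩ : T)) fun s t hst =>
      Subtype.ext (Subtype.ext (Subtype.mk.inj hst))
  refine Finite.of_surjective (fun s : {s : E.Simplex i // s.1 ∈ T} => E.cellOf s.1) ?_
  refine Quotient.ind fun s => ?_
  obtain ⟨g, hg⟩ := h s.1 s.2.1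
  exact ⟨⟨g • s, hg⟩, Quotient.sound ⟨g, rfl⟩⟩

noncomputable instance (i : ℕ) : Fintype (E.Cell i) := Fintype.ofFinite _

/-- The ordered (nondegenerate) `i`-simplices of `EΓ`: the simplices with a total order of their
vertices. -/
def OrderedSimplex (i : ℕ) : Type w :=
  {s : Fin (i + 1) ↪ E.V // Finset.univ.map s ∈ E.K.faces}

variable {E}

/-- The underlying simplex. -/
def OrderedSimplex.toSimplex {i : ℕ} (s : E.OrderedSimplex i) : E.Simplex i :=
  ⟨Finset.univ.map s.1, s.2, by simp⟩

/-- The translate of an ordered simplex by a group element. -/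
def OrderedSimplex.translate {i : ℕ} (g : Γ) (s : E.OrderedSimplex i) : E.OrderedSimplex i :=
  ⟨s.1.trans (MulAction.toPerm g).toEmbedding, by
    rw [← Finset.map_map]; exact E.translate_mem g _ s.2⟩

/-- The reordering of an ordered simplex by a permutation. -/
def OrderedSimplex.permute {i : ℕ} (τ : Equiv.Perm (Fin (i + 1))) (s : E.OrderedSimplex i) :
    E.OrderedSimplex i :=
  ⟨τ.toEmbedding.trans s.1, by
    rw [← Finset.map_map, Finset.map_univ_equiv]; exact s.2⟩

/-- The `j`-th face of an ordered simplex, obtained by omitting the `j`-th vertex. -/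
def OrderedSimplex.face {i : ℕ} (s : E.OrderedSimplex (i + 1)) (j : Fin (i + 2)) :
    E.OrderedSimplex i :=
  ⟨(Fin.succAboveEmb j).trans s.1, by
    refine (E.K.isRelLowerSet_faces s.2).2 ?_ (by simp)
    rw [← Finset.map_map]
    exact Finset.map_subset_map.mpr (Finset.subset_univ _)⟩

theorem exists_orderedSimplex {i : ℕ} (x : E.Cell i) :
    ∃ s : E.OrderedSimplex i, E.cellOf s.toSimplex = x := by
  induction x using Quotient.ind with
  | _ t =>
    obtain ⟨t, ht, hcard⟩ := t
    have hmap : Finset.univ.map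
        ((t.equivFinOfCardEq hcard).symm.toEmbedding.trans (Function.Embedding.subtype _)) = t := by
      rw [← Finset.map_map, Finset.map_univ_equiv]
      ext a; simp
    refine ⟨⟨(t.equivFinOfCardEq hcard).symm.toEmbedding.trans (Function.Embedding.subtype _),
      by rw [hmap]; exact ht⟩, ?_⟩
    exact congrArg E.cellOf (Subtype.ext hmap)

/-- A choice of an ordered simplex of `EΓ` above each simplex of `BΓ`. -/
noncomputable def lift {i : ℕ} (x : E.Cell i) : E.OrderedSimplex i :=
  (exists_orderedSimplex x).choose

/-- A faithful probability measure on the finite set of `i`-simplices of `BΓ` (if there are any),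
given by its weights. -/
structure FaithfulWeights (E : FiniteClassifyingSpace.{u, w} Γ) (i : ℕ) where
  weight : E.Cell i → ℝ
  pos : ∀ x, 0 < weight x
  sum_eq_one : Nonempty (E.Cell i) → ∑ x, weight x = 1

/-! ### Metric group cohomology -/

section Cohomology

variable (E) (M : Type v) [AddCommGroup M] [DistribMulAction Γ M]

/-- The cochains `C^i(BΓ, M) = Hom_{ℤΓ}(C_i(EΓ), M)`, where `C_i(EΓ)` is the group of oriented
simplicial chains: the alternating, equivariant functions on ordered simplices. -/
def cochains (i : ℕ) : AddSubgroup (E.OrderedSimplex i → M) where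
  carrier := {c | (∀ (τ : Equiv.Perm (Fin (i + 1))) (s : E.OrderedSimplex i),
      c (s.permute τ) = ((Equiv.Perm.sign τ : ℤˣ) : ℤ) • c s) ∧
    ∀ (g : Γ) (s : E.OrderedSimplex i), c (s.translate g) = g • c s}
  zero_mem' := by simp
  add_mem' := fun {c d} hc hd => by
    refine ⟨fun τ s => ?_, fun g s => ?_⟩
    · simp only [Pi.add_apply, hc.1 τ s, hd.1 τ s, smul_add]
    · simp only [Pi.add_apply, hc.2 g s, hd.2 g s, smul_add]
  neg_mem' := fun {c} hc => by
    refine ⟨fun τ s => ?_, fun g s => ?_⟩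
    · simp only [Pi.neg_apply, hc.1 τ s, smul_neg]
    · simp only [Pi.neg_apply, hc.2 g s, smul_neg]

/-- The simplicial coboundary `(δ c)(v₀, …, v_{i+1}) = ∑ j, (-1)^j c(v₀, …, v̂_j, …, v_{i+1})`. -/
def coboundary (i : ℕ) : (E.OrderedSimplex i → M) →+ (E.OrderedSimplex (i + 1) → M) where
  toFun c s := ∑ j : Fin (i + 2), (-1 : ℤ) ^ (j : ℕ) • c (s.face j)
  map_zero' := by ext; simp
  map_add' c d := by ext; simp [Finset.sum_add_distrib]

/-- The cocycles `Z^i(BΓ, M)`. -/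
def cocycles (i : ℕ) : AddSubgroup (E.OrderedSimplex i → M) :=
  E.cochains M i ⊓ (E.coboundary M i).ker

/-- The coboundaries `B^i(BΓ, M)`. -/
def coboundaries : (i : ℕ) → AddSubgroup (E.OrderedSimplex i → M)
  | 0 => ⊥
  | i + 1 => (E.cochains M i).map (E.coboundary M i)

/-- The cohomology `H^i(BΓ, M)`. -/
abbrev Cohomology (i : ℕ) : Type (max v w) :=
  E.cocycles M i ⧸ (E.coboundaries M i).addSubgroupOf (E.cocycles M i)

end Cohomology

section Metric

variable {i : ℕ} (ν : E.FaithfulWeights i) (P : MeasuredBoolAlg.{u, v} Γ) {A : Type x}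
  [AddCommGroup A] [Fintype A]

/-- The length of a cochain with values in `P(A)`: the sum over the `i`-simplices `x` of `BΓ` of
`μ(c(x)) ν(x)`. -/
noncomputable def cochainLength (c : E.OrderedSimplex i → P.Coeff A) : ℝ :=
  ∑ x : E.Cell i, P.coeffMeasure (c (lift x)) * ν.weight x

/-- The quotient pseudo-norm of a cohomology class: the infimum of the lengths of the cocycles
representing it. -/
noncomputable def classLength (α : E.Cohomology (P.Coeff A) i) : ℝ :=
  ⨅ z : {z : E.cocycles (P.Coeff A) i // (QuotientAddGroup.mk z : E.Cohomology _ i) = α},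
    cochainLength ν P z.1.1

variable (A) in
/-- The cosystolic inequality in dimension `i` with respect to the family `𝓕` and coefficients in
`A`: the lengths of the nonzero classes in `H^i(BΓ, P(A))`, for `P` in the family, are uniformly
bounded away from zero. -/
def CosystolicInequality (𝓕 : Set (MeasuredBoolAlg.{u, v} Γ)) : Prop :=
  ∃ ε : ℝ, 0 < ε ∧ ∀ P ∈ 𝓕, ∀ α : E.Cohomology (P.Coeff A) i, α ≠ 0 → ε ≤ classLength ν P α

end Metric

end FiniteClassifyingSpace

end SoficStability

namespace SoficStability

universe u v w x y z

/-! ### Contractible simplicial complexes have no nontrivial flat bundles -/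

/-! Suppose that the central extension `G` of `Γ` by `A` is sofic. The claim is that `G` is then
residually finite, a contradiction.

In a sofic approximation of `G` the finite kernel `A` acts almost freely. A transversal of this
almost action carries an approximate action `σ` of `G` that is trivial on `A`, that is, a sofic
representation of `Γ`. It also carries functions `β g` with values in `A` that record how far `g`
moves the transversal off itself (`SoficApproximation.nonempty_quotientApproximation`). In the limit
action `P` the `β g` become a crossed homomorphism `B : G → P(A)` that maps each `a` in `A` to the
constant `a` (`QuotientApproximation.limitFunction_crossed`,
`QuotientApproximation.limitFunction_inl`). Hence the class of the extension dies in `H²(BΓ, P(A))`.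

By stability `P` embeds in an ultraproduct of finite actions `Q j`. The 1-cochain bounding the class
lifts to equivariant 1-cochains over the `Q j`, because `Γ` acts freely on the simplices of `EΓ`.
Their coboundaries come arbitrarily close to the cocycle of the extension
(`EdgeLift.residuallyFinite_of_weaklyContained`). The length over a finite action is a weighted
average of lengths over transitive ones, so over some transitive action the cocycle is closer than
`ε` to a coboundary. The cosystolic inequality then makes it an exact coboundary
(`EdgeLift.residuallyFinite_of_cochainLength_lt`).

Evaluation at an atom turns this into the vanishing of the class on the stabilizer of the atom, a
subgroup `Λ` of finite index. The corrected lift of the edge cochain to `G` is flat, and by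
contractibility of `EΓ` it has a potential, from which a splitting over `Λ` is read off
(`EdgeLift.residuallyFinite`). An extension of a residually finite group with finite kernel that
splits over a subgroup of finite index is residually finite (`residuallyFinite_of_virtual_section`).
-/

theorem FiberBundleCore.exists_section {ι : Type u} {B : Type v} {F : Type w} [TopologicalSpace B]
    [TopologicalSpace F] [DiscreteTopology F] [Nonempty F] [ContractibleSpace B]
    (Z : FiberBundleCore ι B F) : ∃ s : C(B, Z.TotalSpace), ∀ x, (s x).proj = x := by
  have cov : IsCoveringMap Z.proj := FiberBundle.isCoveringMap (F := F) (E := Z.Fiber)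
  obtain ⟨y, ⟨H⟩⟩ := id_nullhomotopic B
  obtain ⟨g⟩ := ‹Nonempty F›
  let f : C(B, Z.TotalSpace) := ContinuousMap.const B ⟨y, g⟩
  have h0 : ∀ a, H.symm.toContinuousMap (0, a) = Z.proj (f a) := fun a => by
    change H.symm (0, a) = _
    rw [ContinuousMap.Homotopy.apply_zero]
    rfl
  -- With discrete fibre the projection is a covering. The contraction, run backwards from a
  -- constant map to the identity, lifts, and the end of the lift is a section.
  let L := cov.liftHomotopy H.symm.toContinuousMap f h0
  refine ⟨⟨fun a => L (1, a), by fun_prop⟩, fun a => ?_⟩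
  have h1 := congrFun (cov.liftHomotopy_lifts H.symm.toContinuousMap f h0) (1, a)
  have h2 : H.symm (1, a) = a := by rw [ContinuousMap.Homotopy.apply_one]; rfl
  exact h1.trans h2

namespace Realization

variable {V : Type w} {K : AbstractSimplicialComplex V}

theorem isOpen_iff {U : Set (Realization K)} :
    IsOpen U ↔ ∀ s : K.faces, IsOpen (faceInclusion K s ⁻¹' U) := by
  rw [isOpen_iSup_iff]
  rfl

theorem continuous_faceInclusion (s : K.faces) : Continuous (faceInclusion K s) :=
  continuous_def.mpr fun _ hU => isOpen_iff.mp hU s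

/-- The open star of a vertex. -/
def openStar (K : AbstractSimplicialComplex V) (a : V) : Set (Realization K) := {p | 0 < p.1 a}

theorem isOpen_openStar (a : V) : IsOpen (openStar K a) := by
  classical
  refine isOpen_iff.mpr fun s => ?_
  by_cases h : a ∈ s.1
  · have : faceInclusion K s ⁻¹' openStar K a = {q | 0 < q.1 ⟨a, h⟩} := by
      ext q; simp [openStar, faceInclusion, h]
    rw [this]
    exact isOpen_lt continuous_const ((continuous_apply _).comp continuous_subtype_val)
  · have : faceInclusion K s ⁻¹' openStar K a = ∅ := by
      ext q; simp [openStar, faceInclusion, h]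
    rw [this]
    exact isOpen_empty

theorem exists_mem_openStar (p : Realization K) : ∃ a, p ∈ openStar K a := by
  obtain ⟨h0, s, -, -, h1⟩ := p.2
  by_contra! h
  have : ∑ a ∈ s, p.1 a = 0 := Finset.sum_eq_zero fun a _ => le_antisymm (not_lt.mp (h a)) (h0 a)
  linarith

theorem exists_face (p : Realization K) : ∃ s ∈ K.faces, ∀ a, p ∈ openStar K a → a ∈ s := by
  obtain ⟨-, s, hs, h, -⟩ := p.2
  refine ⟨s, hs, fun a ha => ?_⟩
  by_contra has
  exact (h a has).not_gt ha

open Classical in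
/-- The point of the realization given by a vertex. -/
noncomputable def vertex (K : AbstractSimplicialComplex V) (a : V) : Realization K :=
  ⟨Pi.single a 1, fun b => by by_cases h : b = a <;> simp [h],
    {a}, K.singleton_mem a, fun b hb => by simp_all, by simp⟩

theorem vertex_mem_openStar (a : V) : vertex K a ∈ openStar K a := by
  classical
  change (0 : ℝ) < (Pi.single a 1 : V → ℝ) a
  simp

-- The straight segment inside the closed simplex: the barycentric coordinate of `a` is positive
-- before the end and that of `b` after the start. Continuity holds because closed simplices include
-- continuously into the weak topology.
open Classical in
theorem exists_segment {s : Finset V} (hs : s ∈ K.faces) {a b : V} (ha : a ∈ s) (hb : b ∈ s) :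
    ∃ γ : C(unitInterval, Realization K), γ 0 = vertex K a ∧ γ 1 = vertex K b ∧
      (∀ t : unitInterval, (t : ℝ) < 1 → γ t ∈ openStar K a) ∧
      ∀ t : unitInterval, 0 < (t : ℝ) → γ t ∈ openStar K b := by
  let e : {c // c ∈ s} → {c // c ∈ s} → ℝ := fun c => Pi.single c 1
  have hmem : ∀ c : {c // c ∈ s}, e c ∈ stdSimplex ℝ {c // c ∈ s} := fun c =>
    single_mem_stdSimplex ℝ c
  let q : unitInterval → stdSimplex ℝ {c // c ∈ s} := fun t =>
    ⟨(1 - (t : ℝ)) • e ⟨a, ha⟩ + (t : ℝ) • e ⟨b, hb⟩,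
      convex_stdSimplex ℝ _ (hmem _) (hmem _) (by linarith [t.2.2]) t.2.1 (by ring)⟩
  have hq : Continuous q := by
    refine Continuous.subtype_mk ?_ _
    fun_prop
  have hvert : ∀ (c : {c // c ∈ s}) (r : stdSimplex ℝ {c // c ∈ s}), r.1 = e c →
      faceInclusion K ⟨s, hs⟩ r = vertex K c := fun c r hr => by
    refine Subtype.ext (funext fun d => ?_)
    simp only [faceInclusion, hr, e, vertex, Pi.single_apply, Subtype.ext_iff]
    by_cases hd : d ∈ s
    · simp [hd]
    · have : d ≠ c := fun h => hd (h ▸ c.2)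
      simp [hd, this]
  refine ⟨⟨fun t => faceInclusion K ⟨s, hs⟩ (q t), (continuous_faceInclusion _).comp hq⟩,
    hvert ⟨a, ha⟩ _ (by simp [q]), hvert ⟨b, hb⟩ _ (by simp [q]), fun t ht => ?_, fun t ht => ?_⟩
  · change 0 < (faceInclusion K ⟨s, hs⟩ (q t)).1 a
    simp only [faceInclusion, ha, dif_pos, q, e, Pi.add_apply, Pi.smul_apply, Pi.single_eq_same,
      smul_eq_mul]
    have : (0 : ℝ) ≤ (Pi.single (⟨b, hb⟩ : {c // c ∈ s}) (1 : ℝ) : _ → ℝ) ⟨a, ha⟩ :=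
      (single_mem_stdSimplex ℝ _).1 _
    nlinarith [mul_nonneg t.2.1 this]
  · change 0 < (faceInclusion K ⟨s, hs⟩ (q t)).1 b
    simp only [faceInclusion, hb, dif_pos, q, e, Pi.add_apply, Pi.smul_apply, Pi.single_eq_same,
      smul_eq_mul]
    have : (0 : ℝ) ≤ (Pi.single (⟨a, ha⟩ : {c // c ∈ s}) (1 : ℝ) : _ → ℝ) ⟨b, hb⟩ :=
      (single_mem_stdSimplex ℝ _).1 _
    nlinarith [mul_nonneg (sub_nonneg.mpr t.2.2) this]

/-- The open stars form an open cover, and vertices whose open stars meet at a point lie in a common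
face. So `φ` induces a locally constant function on a connected space. -/
theorem vertex_function_constant [PreconnectedSpace (Realization K)] {S : Type u} (φ : V → S)
    (hφ : ∀ s ∈ K.faces, ∀ a ∈ s, ∀ b ∈ s, φ a = φ b) (a b : V) : φ a = φ b := by
  choose i hi using exists_mem_openStar (K := K)
  have key : ∀ c, ∀ p ∈ openStar K c, φ (i p) = φ c := fun c p hp => by
    obtain ⟨s, hs, h⟩ := exists_face p
    exact hφ s hs _ (h _ (hi p)) _ (h _ hp)
  have hloc : IsLocallyConstant fun p => φ (i p) := by
    rw [IsLocallyConstant.iff_exists_open]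
    exact fun p => ⟨openStar K (i p), isOpen_openStar _, hi p, fun p' hp' => key _ _ hp'⟩
  rw [← key a _ (vertex_mem_openStar a), ← key b _ (vertex_mem_openStar b)]
  exact hloc.apply_eq_of_isPreconnected isPreconnected_univ trivial trivial

/-- The principal bundle over the realization given by a flat cochain on the edges. -/
noncomputable def flatBundle {G : Type u} [Group G] [TopologicalSpace G] [DiscreteTopology G]
    (c : V → V → G)
    (hc : ∀ s ∈ K.faces, ∀ a₁ ∈ s, ∀ a₂ ∈ s, ∀ a₃ ∈ s, c a₁ a₂ * c a₂ a₃ = c a₁ a₃) :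
    FiberBundleCore V (Realization K) G where
  baseSet := openStar K
  isOpen_baseSet := isOpen_openStar
  indexAt p := (exists_mem_openStar p).choose
  mem_baseSet_at p := (exists_mem_openStar p).choose_spec
  coordChange a b _ g := g * c a b
  coordChange_self a p hp g := by
    obtain ⟨s, hs, h⟩ := exists_face p
    have := hc s hs a (h a hp) a (h a hp) a (h a hp)
    rw [mul_eq_left.mp this, mul_one]
  continuousOn_coordChange a b := by
    have : Continuous fun g : G => g * c a b := continuous_of_discreteTopology
    exact (this.comp continuous_snd).continuousOn
  coordChange_comp a₁ a₂ a₃ p hp g := by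
    obtain ⟨s, hs, h⟩ := exists_face p
    rw [mul_assoc, hc s hs a₁ (h _ hp.1.1) a₂ (h _ hp.1.2) a₃ (h _ hp.2)]

/-- The flat cochain `c` is the transition cocycle of a bundle with discrete fibre, which has a
section. The potential at `a` is the value of the section at the vertex `a`, in the chart of `a`.
Along an edge each chart coordinate is constant inside its star, so the two ends can be compared at
the midpoint, where they differ by `c a b`. -/
theorem exists_potential [ContractibleSpace (Realization K)] {G : Type u} [Group G] (c : V → V → G)
    (hc : ∀ s ∈ K.faces, ∀ a₁ ∈ s, ∀ a₂ ∈ s, ∀ a₃ ∈ s, c a₁ a₂ * c a₂ a₃ = c a₁ a₃) :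
    ∃ h : V → G, ∀ s ∈ K.faces, ∀ a ∈ s, ∀ b ∈ s, h a * c a b = h b := by
  classical
  let : TopologicalSpace G := ⊥
  have : DiscreteTopology G := ⟨rfl⟩
  let Z := flatBundle c hc
  obtain ⟨σ, hσ⟩ := FiberBundleCore.exists_section Z
  let f : V → Realization K → G := fun a p => (Z.localTriv a (σ p)).2
  have hf : ∀ a, ContinuousOn (f a) (openStar K a) := fun a =>
    continuous_snd.comp_continuousOn ((Z.localTriv a).continuousOn_toFun.comp
      σ.continuous.continuousOn fun p hp => by
        change (σ p).proj ∈ openStar K a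
        rwa [hσ])
  have hchange : ∀ a b p, p ∈ openStar K a → p ∈ openStar K b → f a p * c a b = f b p :=
    fun a b p ha hb => by
      obtain ⟨s, hs, h⟩ := exists_face p
      have hi : Z.indexAt (σ p).proj ∈ s := h _ (by
        have := Z.mem_baseSet_at (σ p).proj
        rw [hσ] at this ⊢
        exact this)
      change (show G from (σ p).2) * c _ a * c a b = (show G from (σ p).2) * c _ b
      rw [mul_assoc, hc s hs _ hi _ (h a ha) _ (h b hb)]
  refine ⟨fun a => f a (vertex K a), fun s hs a ha b hb => ?_⟩
  obtain ⟨γ, h0, h1, hγa, hγb⟩ := exists_segment hs ha hb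
  let m : unitInterval := ⟨1 / 2, by norm_num, by norm_num⟩
  have hm1 : (m : ℝ) < 1 := by norm_num [m]
  have hm0 : 0 < (m : ℝ) := by norm_num [m]
  have e1 : f a (γ 0) = f a (γ m) :=
    (isPreconnected_Iio (a := (1 : unitInterval))).constant
      (((hf a).comp γ.continuous.continuousOn fun t ht => hγa t ht)) (by simp) hm1
  have e2 : f b (γ m) = f b (γ 1) :=
    (isPreconnected_Ioi (a := (0 : unitInterval))).constant
      (((hf b).comp γ.continuous.continuousOn fun t ht => hγb t ht)) hm0 (by simp)
  change f a (vertex K a) * c a b = f b (vertex K b)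
  rw [← h0, ← h1, e1, ← e2]
  exact hchange a b _ (hγa m hm1) (hγb m hm0)

end Realization

/-! ### Residual finiteness from a virtual splitting -/

/-- The images under `τ` of finite-index subgroups of `Λ` have finite index in `G`, because the
kernel of `p` is finite. Their intersection is trivial, because `τ` is injective and `Γ` is
residually finite. -/
theorem residuallyFinite_of_virtual_section {Γ : Type u} [Group Γ] {G : Type v} [Group G]
    [hΓ : Group.ResiduallyFinite Γ] (p : G →* Γ) (hp : Function.Surjective p) [Finite p.ker]
    (Λ : Subgroup Γ) [Λ.FiniteIndex] (τ : Λ →* G) (hτ : ∀ l : Λ, p (τ l) = l) :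
    Group.ResiduallyFinite G := by
  have key : ∀ N : Subgroup Γ, N.FiniteIndex → ((N.subgroupOf Λ).map τ).FiniteIndex := fun N hN => by
    let H := (N.subgroupOf Λ).map τ
    have hfin : Finite (Γ ⧸ (Λ ⊓ N)) := Subgroup.finite_quotient_of_finiteIndex
    -- Each `g` factors as `s * z * τ l`, with `s` the chosen lift of a representative of the coset
    -- of `p g`, `z` in the kernel and `l` in `Λ ⊓ N`.
    let q : p.ker × (Γ ⧸ (Λ ⊓ N)) → G ⧸ H := fun z =>
      ((Function.surjInv hp z.2.out * z.1 : G) : G ⧸ H)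
    have hq : Function.Surjective q := by
      intro y
      induction y using QuotientGroup.induction_on with
      | H g =>
        let γ := ((p g : Γ) : Γ ⧸ (Λ ⊓ N)).out
        have hγ : γ⁻¹ * p g ∈ Λ ⊓ N :=
          QuotientGroup.eq.mp (QuotientGroup.out_eq' _)
        let l : Λ := ⟨γ⁻¹ * p g, hγ.1⟩
        let s := Function.surjInv hp γ
        have hs : p s = γ := Function.surjInv_eq hp γ
        refine ⟨(⟨s⁻¹ * g * (τ l)⁻¹, ?_⟩, (p g : Γ ⧸ (Λ ⊓ N))), ?_⟩
        · rw [MonoidHom.mem_ker]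
          simp [hτ, hs, l]
        · refine QuotientGroup.eq.mpr ?_
          refine ⟨l, hγ.2, ?_⟩
          change τ l = (s * (s⁻¹ * g * (τ l)⁻¹))⁻¹ * g
          group
    have : Finite (G ⧸ H) := Finite.of_surjective q hq
    exact Subgroup.finiteIndex_of_finite_quotient
  rw [Group.residuallyFinite_iff_forall_finiteIndex]
  intro g hg
  have h1 := key ⊤ inferInstance
  obtain ⟨l, -, rfl⟩ := hg ((Subgroup.subgroupOf ⊤ Λ).map τ)
  have hl : (l : Γ) = 1 := by
    refine Group.residuallyFinite_iff_forall_finiteIndex.mp hΓ l fun N hN => ?_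
    have h2 := key N hN
    obtain ⟨l', hl', he⟩ := hg ((N.subgroupOf Λ).map τ)
    have : (l' : Γ) = l := by rw [← hτ, ← hτ, he]
    exact this ▸ hl'
  rw [show l = 1 from Subtype.ext hl, map_one]

/-! ### Equivariant choices on the vertices and edges of `EΓ` -/

namespace FiniteClassifyingSpace

variable {Γ : Type u} [Group Γ] (E : FiniteClassifyingSpace.{u, w} Γ)

/-- Two vertices span a (possibly degenerate) simplex. -/
def Joined (a b : E.V) : Prop := ∃ s ∈ E.K.faces, a ∈ s ∧ b ∈ s

variable {E}

theorem mem_translate {g : Γ} {s : Finset E.V} {a : E.V} (h : a ∈ s) : g • a ∈ translate g s := by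
  simpa [translate] using h

theorem Joined.symm {a b : E.V} (h : E.Joined a b) : E.Joined b a :=
  let ⟨s, hs, ha, hb⟩ := h
  ⟨s, hs, hb, ha⟩

theorem Joined.smul {a b : E.V} (h : E.Joined a b) (g : Γ) : E.Joined (g • a) (g • b) :=
  let ⟨s, hs, ha, hb⟩ := h
  ⟨translate g s, E.translate_mem g s hs, mem_translate ha, mem_translate hb⟩

theorem joined_smul_iff {a b : E.V} {g : Γ} : E.Joined (g • a) (g • b) ↔ E.Joined a b :=
  ⟨fun h => by simpa using h.smul g⁻¹, fun h => h.smul g⟩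

open Classical in
theorem Joined.pair_mem {a b : E.V} (h : E.Joined a b) : ({a, b} : Finset E.V) ∈ E.K.faces := by
  obtain ⟨s, hs, ha, hb⟩ := h
  refine (E.K.isRelLowerSet_faces hs).2 ?_ (by simp)
  intro c hc
  simp only [Finset.mem_insert, Finset.mem_singleton] at hc
  rcases hc with rfl | rfl <;> assumption

theorem eq_one_of_smul_vertex {g : Γ} {a : E.V} (h : g • a = a) : g = 1 :=
  E.free g {a} (E.K.singleton_mem a) (by simp [translate, h])

/-- No edge is inverted: an element exchanging its ends would map the edge to itself, and freeness
makes it trivial. -/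
theorem Joined.eq_of_swap {a b : E.V} (hab : E.Joined a b) {g : Γ} (h : g • a = b)
    (h' : g • b = a) : a = b := by
  classical
  have := E.free g {a, b} hab.pair_mem (by
    simp only [translate, Finset.map_insert, Finset.map_singleton]
    change ({g • a, g • b} : Finset E.V) = _
    rw [h, h', Finset.pair_comm])
  simpa [this] using h

/-- An equivariant map from the vertices to the group. -/
theorem exists_equivariant_vertex_map :
    ∃ γ : E.V → Γ, ∀ (g : Γ) (a : E.V), γ (g • a) = g * γ a := by
  let S := MulAction.orbitRel Γ E.V
  have h : ∀ a : E.V, ∃ g : Γ, g • (Quotient.mk S a).out = a := fun a =>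
    S.symm (Quotient.mk_out a)
  choose γ hγ using h
  refine ⟨γ, fun g a => ?_⟩
  have e : Quotient.mk S (g • a) = Quotient.mk S a :=
    Quotient.sound ⟨g, rfl⟩
  have h1 := hγ (g • a)
  rw [e] at h1
  have := eq_one_of_smul_vertex (g := (g * γ a)⁻¹ * γ (g • a)) (a := (Quotient.mk S a).out) (by
    rw [mul_smul, h1, mul_inv_rev, mul_smul, inv_smul_smul, inv_smul_eq_iff, hγ])
  rw [← mul_one (g * γ a), ← this]
  group

/-- Extension of a choice of values on edges to a function that is equivariant under the group and
under reversal of the edges. -/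
theorem exists_equivariant_edge_map {M : Type v} [MulAction Γ M] (inv : M → M)
    (inv_inv : ∀ m, inv (inv m) = m) (smul_inv : ∀ (g : Γ) m, g • inv m = inv (g • m))
    (R : E.V → E.V → M → Prop) (hR : ∀ a b, ∃ m, R a b m)
    (hdiag : ∀ a, ∃ m, R a a m ∧ inv m = m)
    (hsmul : ∀ (g : Γ) a b m, R a b m → R (g • a) (g • b) (g • m))
    (hswap : ∀ a b m, R a b m → R b a (inv m)) :
    ∃ c : E.V → E.V → M, ∀ a b, E.Joined a b → R a b (c a b) ∧
      (∀ g : Γ, c (g • a) (g • b) = g • c a b) ∧ c b a = inv (c a b) := by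
  classical
  -- Pairs are identified up to the group and up to reversal, so that one value per class determines
  -- the whole function.
  let S : Setoid (E.V × E.V) :=
    { r := fun e e' => ∃ g : Γ, e' = (g • e.1, g • e.2) ∨ e' = (g • e.2, g • e.1)
      iseqv :=
        { refl := fun e => ⟨1, Or.inl (by simp)⟩
          symm := by
            rintro e e' ⟨g, rfl | rfl⟩
            · exact ⟨g⁻¹, Or.inl (by simp)⟩
            · exact ⟨g⁻¹, Or.inr (by simp)⟩
          trans := by
            rintro e e' e'' ⟨g, rfl | rfl⟩ ⟨g', rfl | rfl⟩
            · exact ⟨g' * g, Or.inl (by simp [mul_smul])⟩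
            · exact ⟨g' * g, Or.inr (by simp [mul_smul])⟩
            · exact ⟨g' * g, Or.inr (by simp [mul_smul])⟩
            · exact ⟨g' * g, Or.inl (by simp [mul_smul])⟩ } }
  -- A degenerate pair is its own reversal, so its value must be fixed by `inv`.
  have h0 : ∀ e : E.V × E.V, ∃ m, R e.1 e.2 m ∧ (e.1 = e.2 → inv m = m) := fun e => by
    by_cases h : e.1 = e.2
    · obtain ⟨m, hm, hm'⟩ := hdiag e.1
      exact ⟨m, h ▸ hm, fun _ => hm'⟩
    · obtain ⟨m, hm⟩ := hR e.1 e.2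
      exact ⟨m, hm, fun h' => absurd h' h⟩
  choose m₀ hm₀ hm₀' using h0
  let rep : E.V × E.V → E.V × E.V := fun e => (Quotient.mk S e).out
  have hrep : ∀ e e', S.r e e' → rep e = rep e' := fun e e' h =>
    congrArg Quotient.out (Quotient.sound h)
  let T : E.V → E.V → M → Prop := fun a b m => ∃ g : Γ,
    (a = g • (rep (a, b)).1 ∧ b = g • (rep (a, b)).2 ∧ m = g • m₀ (rep (a, b))) ∨
    (a = g • (rep (a, b)).2 ∧ b = g • (rep (a, b)).1 ∧ m = g • inv (m₀ (rep (a, b))))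
  have hT : ∀ a b, ∃ m, T a b m := fun a b => by
    obtain ⟨g, h | h⟩ : S.r (rep (a, b)) (a, b) := Quotient.mk_out (s := S) (a, b)
    · exact ⟨_, g, Or.inl ⟨congrArg Prod.fst h, congrArg Prod.snd h, rfl⟩⟩
    · exact ⟨_, g, Or.inr ⟨congrArg Prod.fst h, congrArg Prod.snd h, rfl⟩⟩
  have hTR : ∀ a b m, T a b m → R a b m := by
    rintro a b m ⟨g, ⟨ha, hb, rfl⟩ | ⟨ha, hb, rfl⟩⟩
    · have := hsmul g _ _ _ (hm₀ (rep (a, b)))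
      rwa [← ha, ← hb] at this
    · have := hsmul g _ _ _ (hswap _ _ _ (hm₀ (rep (a, b))))
      rwa [← ha, ← hb] at this
  have hTsmul : ∀ (g : Γ) a b m, T a b m → T (g • a) (g • b) (g • m) := by
    rintro g a b m ⟨k, h⟩
    have e : rep (g • a, g • b) = rep (a, b) := (hrep (a, b) _ ⟨g, Or.inl rfl⟩).symm
    refine ⟨g * k, ?_⟩
    rw [e]
    rcases h with ⟨ha, hb, rfl⟩ | ⟨ha, hb, rfl⟩
    · exact Or.inl ⟨by rw [mul_smul, ← ha], by rw [mul_smul, ← hb], by rw [mul_smul]⟩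
    · exact Or.inr ⟨by rw [mul_smul, ← ha], by rw [mul_smul, ← hb], by rw [mul_smul]⟩
  have hTswap : ∀ a b m, T a b m → T b a (inv m) := by
    rintro a b m ⟨k, h⟩
    have e : rep (b, a) = rep (a, b) := hrep _ _ ⟨1, Or.inr (by simp)⟩
    refine ⟨k, ?_⟩
    rw [e]
    rcases h with ⟨ha, hb, rfl⟩ | ⟨ha, hb, rfl⟩
    · exact Or.inr ⟨hb, ha, by rw [smul_inv]⟩
    · exact Or.inl ⟨hb, ha, by rw [smul_inv, inv_inv]⟩
  -- Well-definedness: two transports with the same orientation use the same group element by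
  -- freeness. Opposite orientations force a degenerate pair, where the chosen value is fixed by
  -- `inv`.
  have hTuniq : ∀ a b m m', E.Joined a b → T a b m → T a b m' → m = m' := by
    intro a b m m' hab ⟨g, h⟩ ⟨g', h'⟩
    generalize rep (a, b) = r at h h'
    have cancel : ∀ x y : E.V, g • x = g' • y → (g'⁻¹ * g) • x = y := fun x y h => by
      rw [mul_smul, h, inv_smul_smul]
    have same : ∀ x : E.V, g • x = g' • x → g = g' := fun x h =>
      (inv_mul_eq_one.mp (eq_one_of_smul_vertex (cancel x x h))).symm
    have hr : E.Joined r.1 r.2 := by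
      rcases h with ⟨rfl, rfl, -⟩ | ⟨rfl, rfl, -⟩
      · exact joined_smul_iff.mp hab
      · exact (joined_smul_iff.mp hab).symm
    rcases h with ⟨ha, hb, rfl⟩ | ⟨ha, hb, rfl⟩ <;> rcases h' with ⟨ha', hb', rfl⟩ | ⟨ha', hb', rfl⟩
    · rw [same _ (ha.symm.trans ha')]
    · have hd := hr.eq_of_swap (cancel _ _ (ha.symm.trans ha')) (cancel _ _ (hb.symm.trans hb'))
      rw [hm₀' r hd, same r.1 (ha.symm.trans (by rw [ha', hd]))]
    · have hd := hr.eq_of_swap (cancel _ _ (hb.symm.trans hb')) (cancel _ _ (ha.symm.trans ha'))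
      rw [hm₀' r hd, same r.1 (hb.symm.trans (by rw [hb', hd]))]
    · rw [same _ (ha.symm.trans ha')]
  choose c hc using hT
  refine ⟨c, fun a b hab => ⟨hTR _ _ _ (hc a b), fun g => ?_, ?_⟩⟩
  · exact hTuniq _ _ _ _ (hab.smul g) (hc _ _) (hTsmul g _ _ _ (hc a b))
  · exact hTuniq _ _ _ _ hab.symm (hc _ _) (hTswap _ _ _ (hc a b))

/-! ### Lifting the edge cochain to a group extension -/

section Extension

variable {A : Type x} [AddCommGroup A] {G : Type v} [Group G]
  (ext : GroupExtension (Multiplicative A) G Γ)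

/-- A lift to a group extension of the edge cochain `(a, b) ↦ (γ a)⁻¹ * γ b`, where `γ` is an
equivariant map from the vertices to the group. -/
structure EdgeLift (E : FiniteClassifyingSpace.{u, w} Γ)
    (ext : GroupExtension (Multiplicative A) G Γ) where
  γ : E.V → Γ
  c : E.V → E.V → G
  γ_smul : ∀ (g : Γ) (a : E.V), γ (g • a) = g * γ a
  rightHom_c : ∀ {a b}, E.Joined a b → ext.rightHom (c a b) = (γ a)⁻¹ * γ b
  c_smul : ∀ {a b}, E.Joined a b → ∀ g : Γ, c (g • a) (g • b) = c a b
  c_swap : ∀ {a b}, E.Joined a b → c b a = (c a b)⁻¹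
  c_self : ∀ a, c a a = 1

-- The quotient `(γ a)⁻¹ * γ b` is unchanged when `Γ` translates both vertices, so an equivariant
-- lift for the trivial action on `G` is what is needed.
variable (E) in
theorem nonempty_edgeLift : Nonempty (EdgeLift E ext) := by
  classical
  obtain ⟨γ, hγ⟩ := exists_equivariant_vertex_map (E := E)
  let _ : MulAction Γ G := { smul := fun _ m => m, one_smul := fun _ => rfl, mul_smul := fun _ _ _ => rfl }
  obtain ⟨c, hc⟩ := exists_equivariant_edge_map (E := E) (M := G) (fun m => m⁻¹) inv_inv
    (fun _ _ => rfl) (fun a b m => ext.rightHom m = (γ a)⁻¹ * γ b)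
    (fun a b => ext.rightHom_surjective _) (fun a => ⟨1, by simp, inv_one⟩)
    (fun g a b m h => by
      change ext.rightHom m = _
      rw [h, hγ, hγ]; group)
    (fun a b m h => by rw [map_inv, h]; group)
  have hself : ∀ a, E.Joined a a := fun a =>
    ⟨{a}, E.K.singleton_mem a, Finset.mem_singleton_self a, Finset.mem_singleton_self a⟩
  exact ⟨{
    γ := γ
    -- Antisymmetry alone only gives `c a a = (c a a)⁻¹`, so the diagonal is reset to `1`.
    c := fun a b => if a = b then 1 else c a b
    γ_smul := hγ
    rightHom_c := fun {a b} h => by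
      by_cases hab : a = b
      · simp [hab]
      · simpa [hab] using (hc a b h).1
    c_smul := fun {a b} h g => by
      by_cases hab : a = b
      · simp [hab]
      · have : c (g • a) (g • b) = c a b := (hc a b h).2.1 g
        simpa [hab] using this
    c_swap := fun {a b} h => by
      by_cases hab : a = b
      · simp [hab]
      · simpa [hab, Ne.symm hab] using (hc a b h).2.2
    c_self := fun a => by simp }⟩

namespace EdgeLift

variable {ext} (L : EdgeLift E ext)

theorem exists_curvature {s : Finset E.V} (hs : s ∈ E.K.faces) {a₁ a₂ a₃ : E.V} (h₁ : a₁ ∈ s)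
    (h₂ : a₂ ∈ s) (h₃ : a₃ ∈ s) :
    ∃ z : A, ext.inl (Multiplicative.ofAdd z) = L.c a₁ a₂ * L.c a₂ a₃ * L.c a₃ a₁ := by
  have : L.c a₁ a₂ * L.c a₂ a₃ * L.c a₃ a₁ ∈ ext.inl.range := by
    rw [ext.range_inl_eq_ker_rightHom, MonoidHom.mem_ker, map_mul, map_mul,
      L.rightHom_c ⟨s, hs, h₁, h₂⟩, L.rightHom_c ⟨s, hs, h₂, h₃⟩, L.rightHom_c ⟨s, hs, h₃, h₁⟩]
    group
  obtain ⟨z, hz⟩ := this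
  exact ⟨z.toAdd, hz⟩

/-- If the restriction of the cocycle of the extension to a subgroup of finite index is a
coboundary, then a residually finite quotient has a residually finite extension. -/
theorem residuallyFinite [Finite A] [Group.ResiduallyFinite Γ]
    (hcentral : ext.inl.range ≤ Subgroup.center G) (Λ : Subgroup Γ) [Λ.FiniteIndex]
    (b : E.V → E.V → A) (hb : ∀ a₁ a₂, E.Joined a₁ a₂ → b a₂ a₁ = -b a₁ a₂)
    (hb_smul : ∀ a₁ a₂, E.Joined a₁ a₂ → ∀ l ∈ Λ, b (l • a₁) (l • a₂) = b a₁ a₂)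
    (hflat : ∀ s ∈ E.K.faces, ∀ a₁ ∈ s, ∀ a₂ ∈ s, ∀ a₃ ∈ s,
      ext.inl (Multiplicative.ofAdd (b a₁ a₂ + b a₂ a₃ + b a₃ a₁)) =
        L.c a₁ a₂ * L.c a₂ a₃ * L.c a₃ a₁) :
    Group.ResiduallyFinite G := by
  have := E.contractible
  have hcomm : ∀ (z : Multiplicative A) (g : G), ext.inl z * g = g * ext.inl z := fun z g =>
    (Subgroup.mem_center_iff.mp (hcentral ⟨z, rfl⟩) g).symm
  let z : E.V → E.V → Multiplicative A := fun a₁ a₂ => Multiplicative.ofAdd (b a₁ a₂)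
  -- Dividing the lift by the central cochain `b` cancels its curvature and makes it flat.
  let d : E.V → E.V → G := fun a₁ a₂ => L.c a₁ a₂ * (ext.inl (z a₁ a₂))⁻¹
  have hd : ∀ s ∈ E.K.faces, ∀ a₁ ∈ s, ∀ a₂ ∈ s, ∀ a₃ ∈ s, d a₁ a₂ * d a₂ a₃ = d a₁ a₃ := by
    intro s hs a₁ h₁ a₂ h₂ a₃ h₃
    have h := hflat s hs a₁ h₁ a₂ h₂ a₃ h₃
    rw [hb a₁ a₃ ⟨s, hs, h₁, h₃⟩, L.c_swap ⟨s, hs, h₁, h₃⟩, ofAdd_add, ofAdd_add, ofAdd_neg,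
      map_mul, map_mul, map_inv, eq_mul_inv_iff_mul_eq, mul_assoc] at h
    have h' : ext.inl (z a₁ a₂) * ext.inl (z a₂ a₃) * (ext.inl (z a₁ a₃))⁻¹ * L.c a₁ a₃ =
      L.c a₁ a₂ * L.c a₂ a₃ := by simpa only [mul_assoc] using h
    calc L.c a₁ a₂ * (ext.inl (z a₁ a₂))⁻¹ * (L.c a₂ a₃ * (ext.inl (z a₂ a₃))⁻¹)
        = L.c a₁ a₂ * L.c a₂ a₃ * ext.inl ((z a₁ a₂)⁻¹ * (z a₂ a₃)⁻¹) := by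
          rw [map_mul, map_inv, map_inv, mul_assoc, ← mul_assoc _ (L.c a₂ a₃), ← map_inv, hcomm]
          simp only [mul_assoc]
      _ = L.c a₁ a₃ * ext.inl (z a₁ a₂ * z a₂ a₃ * (z a₁ a₃)⁻¹ *
            ((z a₁ a₂)⁻¹ * (z a₂ a₃)⁻¹)) := by
          rw [← h', ← map_mul, ← map_inv, ← map_mul, hcomm, mul_assoc, ← map_mul]
      _ = L.c a₁ a₃ * (ext.inl (z a₁ a₃))⁻¹ := by
          rw [← mul_inv, mul_inv_cancel_comm, map_inv]
  obtain ⟨h, hh⟩ := Realization.exists_potential d hd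
  have hpd : ∀ a₁ a₂, E.Joined a₁ a₂ → ext.rightHom (d a₁ a₂) = (L.γ a₁)⁻¹ * L.γ a₂ :=
    fun a₁ a₂ h12 => by
      have : ext.rightHom (ext.inl (z a₁ a₂)) = 1 := by
        rw [← MonoidHom.mem_ker, ← ext.range_inl_eq_ker_rightHom]; exact ⟨_, rfl⟩
      simp only [d, map_mul, map_inv, this, L.rightHom_c h12, inv_one, mul_one]
  obtain ⟨p₀⟩ : Nonempty (Realization E.K) := inferInstance
  obtain ⟨a₀, -⟩ := Realization.exists_mem_openStar p₀
  -- In `Γ` both the image of `h` and `γ` are potentials of the same edge cochain, so they differ by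
  -- a left constant.
  have hconst : ∀ a, ext.rightHom (h a) * (L.γ a)⁻¹ = ext.rightHom (h a₀) * (L.γ a₀)⁻¹ := fun a =>
    Realization.vertex_function_constant (K := E.K) (fun a => ext.rightHom (h a) * (L.γ a)⁻¹)
      (fun s hs a₁ h₁ a₂ h₂ => by
        rw [← hh s hs a₁ h₁ a₂ h₂, map_mul, hpd _ _ ⟨s, hs, h₁, h₂⟩]; group) a a₀
  -- Since `d` is `Λ`-invariant, the translate of `h` by `l` is again a potential and differs from
  -- `h` by a left constant. These constants multiply like the elements `l`.
  have htrans : ∀ l ∈ Λ, ∀ a, h (l • a) * (h a)⁻¹ = h (l • a₀) * (h a₀)⁻¹ := fun l hl a =>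
    Realization.vertex_function_constant (K := E.K) (fun a => h (l • a) * (h a)⁻¹)
      (fun s hs a₁ h₁ a₂ h₂ => by
        have e : d (l • a₁) (l • a₂) = d a₁ a₂ := by
          simp only [d, z, L.c_smul ⟨s, hs, h₁, h₂⟩, hb_smul _ _ ⟨s, hs, h₁, h₂⟩ l hl]
        rw [← hh s hs a₁ h₁ a₂ h₂, ← hh _ (E.translate_mem l s hs) _ (mem_translate h₁) _
          (mem_translate h₂), e]
        group) a a₀
  -- The translation constants map to the conjugates of `l` by the constant in `hconst`; conjugating
  -- by a lift `κ` of it gives a true section.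
  obtain ⟨κ, hκ⟩ := ext.rightHom_surjective (ext.rightHom (h a₀) * (L.γ a₀)⁻¹)
  let τ : Λ →* G := MonoidHom.mk' (fun l => κ⁻¹ * (h ((l : Γ) • a₀) * (h a₀)⁻¹) * κ) (fun l m => by
    change κ⁻¹ * (h (((l : Γ) * m) • a₀) * (h a₀)⁻¹) * κ = _
    have := htrans l l.2 ((m : Γ) • a₀)
    rw [← this, mul_smul]
    group)
  have hτ : ∀ l : Λ, ext.rightHom (τ l) = l := fun l => by
    change ext.rightHom (κ⁻¹ * (h ((l : Γ) • a₀) * (h a₀)⁻¹) * κ) = l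
    have h1 := hconst ((l : Γ) • a₀)
    rw [L.γ_smul, mul_inv_eq_iff_eq_mul] at h1
    simp only [map_mul, map_inv, hκ, h1]
    group
  have : Finite ext.rightHom.ker := by
    rw [← ext.range_inl_eq_ker_rightHom]
    exact Set.finite_range ext.inl
  exact residuallyFinite_of_virtual_section ext.rightHom ext.rightHom_surjective Λ τ hτ

end EdgeLift

end Extension

end FiniteClassifyingSpace

/-! ### Cochains given by functions on pairs of vertices -/

namespace PTensor

variable {P : Type v} [BooleanAlgebra P] {A : Type w} [Fintype A] [AddCommGroup A]

/-- The constants `⊤ ⊗ a`. -/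
noncomputable def const (P : Type v) [BooleanAlgebra P] {A : Type w} [Fintype A] [AddCommGroup A] :
    A →+ PTensor P A where
  toFun := tmul ⊤
  map_zero' := rfl
  map_add' a b := ext_of_cover (fun _ : Unit => (⊤ : P)) (by simp) fun _ =>
    ⟨a + b, le_tmul _ le_rfl, le_add (le_tmul _ le_rfl) (le_tmul _ le_rfl)⟩

theorem le_const (Z : P) (a : A) : Z ≤ (const P a).part a := le_tmul a le_top

end PTensor

theorem MeasuredBoolAlg.smul_const {Γ : Type u} [Group Γ] (P : MeasuredBoolAlg.{u, v} Γ)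
    {A : Type w} [AddCommGroup A] [Fintype A] (g : Γ) (a : A) :
    g • (PTensor.const P.carrier a : P.Coeff A) = PTensor.const P.carrier a := by
  refine PTensor.ext_of_cover (fun _ : Unit => (⊤ : P.carrier)) (by simp) fun _ =>
    ⟨a, ?_, PTensor.le_const _ _⟩
  change _ ≤ g • (PTensor.const P.carrier a).part a
  rw [top_le_iff.mp (PTensor.le_const (⊤ : P.carrier) a), P.smul_top]

namespace FiniteClassifyingSpace

variable {Γ : Type u} [Group Γ] {E : FiniteClassifyingSpace.{u, w} Γ}

theorem OrderedSimplex.joined {i : ℕ} (s : E.OrderedSimplex i) (j k : Fin (i + 1)) :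
    E.Joined (s.1 j) (s.1 k) :=
  ⟨_, s.2, by simp, by simp⟩

section Edge

variable {M : Type v} [AddCommGroup M]

/-- The cochain given by a function on pairs of vertices. -/
def edgeCochain (b : E.V → E.V → M) (s : E.OrderedSimplex 1) : M := b (s.1 0) (s.1 1)

/-- Antisymmetry turns the alternating sum into a sum around the boundary loop, the form in which it
is compared with the product of `L.c` around a triangle. -/
theorem coboundary_edgeCochain {b : E.V → E.V → M}
    (hb : ∀ a₁ a₂, E.Joined a₁ a₂ → b a₂ a₁ = -b a₁ a₂) (s : E.OrderedSimplex 2) :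
    E.coboundary M 1 (edgeCochain b) s =
      b (s.1 0) (s.1 1) + b (s.1 1) (s.1 2) + b (s.1 2) (s.1 0) := by
  change ∑ j : Fin 3, (-1 : ℤ) ^ (j : ℕ) • edgeCochain b (s.face j) = _
  rw [hb _ _ (s.joined 0 2)]
  simp only [Fin.sum_univ_three, edgeCochain]
  change (-1 : ℤ) ^ 0 • b (s.1 1) (s.1 2) + (-1 : ℤ) ^ 1 • b (s.1 0) (s.1 2) +
    (-1 : ℤ) ^ 2 • b (s.1 0) (s.1 1) = _
  simp only [pow_zero, pow_one, one_smul, neg_smul, even_two, Even.neg_pow, one_pow]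
  abel

theorem coboundary_coboundary_edgeCochain {b : E.V → E.V → M}
    (hb : ∀ a₁ a₂, E.Joined a₁ a₂ → b a₂ a₁ = -b a₁ a₂) :
    E.coboundary M 2 (E.coboundary M 1 (edgeCochain b)) = 0 := by
  ext s
  change ∑ j : Fin 4, (-1 : ℤ) ^ (j : ℕ) • E.coboundary M 1 (edgeCochain b) (s.face j) = 0
  simp only [Fin.sum_univ_four, coboundary_edgeCochain hb]
  change (-1 : ℤ) ^ 0 • (b (s.1 1) (s.1 2) + b (s.1 2) (s.1 3) + b (s.1 3) (s.1 1)) +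
    (-1 : ℤ) ^ 1 • (b (s.1 0) (s.1 2) + b (s.1 2) (s.1 3) + b (s.1 3) (s.1 0)) +
    (-1 : ℤ) ^ 2 • (b (s.1 0) (s.1 1) + b (s.1 1) (s.1 3) + b (s.1 3) (s.1 0)) +
    (-1 : ℤ) ^ 3 • (b (s.1 0) (s.1 1) + b (s.1 1) (s.1 2) + b (s.1 2) (s.1 0)) = 0
  rw [hb _ _ (s.joined 1 3), hb _ _ (s.joined 0 2)]
  simp only [pow_zero, one_smul, neg_smul, pow_succ, mul_neg, mul_one, neg_neg]
  abel

/-- Adjacent transpositions generate the symmetric group, and the permutations obeying the sign rule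
form a submonoid. -/
theorem alternating_of_swap {i : ℕ} {c : E.OrderedSimplex i → M}
    (h : ∀ (j : Fin i) s, c (s.permute (Equiv.swap j.castSucc j.succ)) = -c s)
    (τ : Equiv.Perm (Fin (i + 1))) (s : E.OrderedSimplex i) :
    c (s.permute τ) = ((Equiv.Perm.sign τ : ℤˣ) : ℤ) • c s := by
  let N : Submonoid (Equiv.Perm (Fin (i + 1))) :=
    { carrier := {τ | ∀ s, c (s.permute τ) = ((Equiv.Perm.sign τ : ℤˣ) : ℤ) • c s}
      one_mem' := fun s => by
        rw [map_one, Units.val_one, one_smul]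
        rfl
      mul_mem' := fun {τ τ'} h h' s => by
        have e : s.permute (τ * τ') = (s.permute τ).permute τ' := rfl
        rw [e, h' _, h s, map_mul, Units.val_mul, mul_comm, mul_smul] }
  have hN : N = ⊤ := by
    rw [eq_top_iff, ← Equiv.Perm.mclosure_swap_castSucc_succ, Submonoid.closure_le]
    rintro _ ⟨j, rfl⟩ s
    rw [h, Equiv.Perm.sign_swap (Fin.castSucc_lt_succ).ne]
    simp
  have : τ ∈ N := hN ▸ Submonoid.mem_top τ
  exact this s

variable [DistribMulAction Γ M]

theorem edgeCochain_mem_cochains {b : E.V → E.V → M}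
    (hb : ∀ a₁ a₂, E.Joined a₁ a₂ → b a₂ a₁ = -b a₁ a₂)
    (hb' : ∀ (g : Γ) a₁ a₂, E.Joined a₁ a₂ → b (g • a₁) (g • a₂) = g • b a₁ a₂) :
    edgeCochain b ∈ E.cochains M 1 := by
  refine ⟨alternating_of_swap fun j s => ?_, fun g s => hb' g _ _ (s.joined 0 1)⟩
  obtain rfl : j = 0 := Subsingleton.elim _ _
  exact hb _ _ (s.joined 0 1)

theorem coboundary_edgeCochain_mem_cocycles {b : E.V → E.V → M}
    (hb : ∀ a₁ a₂, E.Joined a₁ a₂ → b a₂ a₁ = -b a₁ a₂)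
    (hb' : ∀ (g : Γ) a₁ a₂, E.Joined a₁ a₂ → b (g • a₁) (g • a₂) = g • b a₁ a₂) :
    E.coboundary M 1 (edgeCochain b) ∈ E.cocycles M 2 := by
  refine ⟨⟨alternating_of_swap fun j s => ?_, fun g s => ?_⟩,
    coboundary_coboundary_edgeCochain hb⟩
  · rw [coboundary_edgeCochain hb, coboundary_edgeCochain hb, hb _ _ (s.joined 0 2)]
    fin_cases j
    · change b (s.1 1) (s.1 0) + b (s.1 0) (s.1 2) + b (s.1 2) (s.1 1) = _
      rw [hb _ _ (s.joined 0 1), hb _ _ (s.joined 1 2)]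
      abel
    · change b (s.1 0) (s.1 2) + b (s.1 2) (s.1 1) + b (s.1 1) (s.1 0) = _
      rw [hb _ _ (s.joined 0 1), hb _ _ (s.joined 1 2)]
      abel
  · rw [coboundary_edgeCochain hb, coboundary_edgeCochain hb]
    change b (g • s.1 0) (g • s.1 1) + b (g • s.1 1) (g • s.1 2) + b (g • s.1 2) (g • s.1 0) = _
    rw [hb' g _ _ (s.joined 0 1), hb' g _ _ (s.joined 1 2), hb' g _ _ (s.joined 2 0), smul_add,
      smul_add]

/-- Functions on vertex pairs allow degenerate edges and spare the ordered simplices. Extension by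
`0` keeps antisymmetry and equivariance. -/
theorem exists_edgeCochain_eq {c : E.OrderedSimplex 1 → M} (hc : c ∈ E.cochains M 1) :
    ∃ b : E.V → E.V → M, edgeCochain b = c ∧ (∀ a₁ a₂, E.Joined a₁ a₂ → b a₂ a₁ = -b a₁ a₂) ∧
      ∀ (g : Γ) a₁ a₂, E.Joined a₁ a₂ → b (g • a₁) (g • a₂) = g • b a₁ a₂ := by
  classical
  let edge : ∀ a₁ a₂ : E.V, a₁ ≠ a₂ ∧ E.Joined a₁ a₂ → E.OrderedSimplex 1 := fun a₁ a₂ h =>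
    ⟨⟨![a₁, a₂], by
      intro i j hij
      fin_cases i <;> fin_cases j <;> simp_all [h.1, Ne.symm h.1]⟩, by
      convert h.2.pair_mem
      ext x
      simp only [Finset.mem_map, Finset.mem_univ, true_and, Finset.mem_insert,
        Finset.mem_singleton]
      change (∃ i : Fin 2, ![a₁, a₂] i = x) ↔ _
      rw [Fin.exists_fin_two]
      exact or_congr eq_comm eq_comm⟩
  have hedge : ∀ (s : E.OrderedSimplex 1) h, edge (s.1 0) (s.1 1) h = s := fun s h => by
    refine Subtype.ext (Function.Embedding.ext fun i => ?_)
    fin_cases i <;> rfl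
  refine ⟨fun a₁ a₂ => if h : a₁ ≠ a₂ ∧ E.Joined a₁ a₂ then c (edge a₁ a₂ h) else 0, ?_, ?_, ?_⟩
  · ext s
    have h : s.1 0 ≠ s.1 1 ∧ E.Joined (s.1 0) (s.1 1) :=
      ⟨fun h => by simpa using s.1.injective h, s.joined 0 1⟩
    simp only [edgeCochain, dif_pos h, hedge]
  · intro a₁ a₂ h
    by_cases h12 : a₁ = a₂
    · simp [h12]
    · have h1 : a₁ ≠ a₂ ∧ E.Joined a₁ a₂ := ⟨h12, h⟩
      have h2 : a₂ ≠ a₁ ∧ E.Joined a₂ a₁ := ⟨Ne.symm h12, h.symm⟩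
      beta_reduce
      rw [dif_pos h1, dif_pos h2]
      have e : (edge a₁ a₂ h1).permute (Equiv.swap 0 1) = edge a₂ a₁ h2 := by
        refine Subtype.ext (Function.Embedding.ext fun i => ?_)
        fin_cases i <;> rfl
      rw [← e, hc.1, Equiv.Perm.sign_swap (by decide)]
      simp
  · intro g a₁ a₂ h
    by_cases h12 : a₁ = a₂
    · simp [h12]
    · have h1 : a₁ ≠ a₂ ∧ E.Joined a₁ a₂ := ⟨h12, h⟩
      have h2 : g • a₁ ≠ g • a₂ ∧ E.Joined (g • a₁) (g • a₂) := ⟨by simpa using h12, h.smul g⟩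
      beta_reduce
      rw [dif_pos h1, dif_pos h2, ← hc.2]
      congr 1
      refine Subtype.ext (Function.Embedding.ext fun i => ?_)
      fin_cases i <;> rfl

end Edge

/-! ### The curvature cocycle of a central extension -/

namespace EdgeLift

variable {A : Type x} [AddCommGroup A] {G : Type v} [Group G]
  {ext : GroupExtension (Multiplicative A) G Γ} (L : EdgeLift E ext)

/-- The simplicial cocycle of the group extension. -/
noncomputable def curvature (s : E.OrderedSimplex 2) : A :=
  (L.exists_curvature s.2 (a₁ := s.1 0) (a₂ := s.1 1) (a₃ := s.1 2)
    (by simp) (by simp) (by simp)).choose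

theorem inl_curvature (s : E.OrderedSimplex 2) :
    ext.inl (Multiplicative.ofAdd (L.curvature s)) =
      L.c (s.1 0) (s.1 1) * L.c (s.1 1) (s.1 2) * L.c (s.1 2) (s.1 0) :=
  (L.exists_curvature s.2 (a₁ := s.1 0) (a₂ := s.1 1) (a₃ := s.1 2)
    (by simp) (by simp) (by simp)).choose_spec

theorem curvature_eq_of {s : E.OrderedSimplex 2} {z : A}
    (h : ext.inl (Multiplicative.ofAdd z) =
      L.c (s.1 0) (s.1 1) * L.c (s.1 1) (s.1 2) * L.c (s.1 2) (s.1 0)) : L.curvature s = z :=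
  Multiplicative.ofAdd.injective (ext.inl_injective ((L.inl_curvature s).trans h.symm))

theorem curvature_translate (g : Γ) (s : E.OrderedSimplex 2) :
    L.curvature (s.translate g) = L.curvature s := by
  refine L.curvature_eq_of ?_
  change _ = L.c (g • s.1 0) (g • s.1 1) * L.c (g • s.1 1) (g • s.1 2) *
    L.c (g • s.1 2) (g • s.1 0)
  rw [L.c_smul (s.joined 0 1), L.c_smul (s.joined 1 2), L.c_smul (s.joined 2 0), L.inl_curvature]

theorem inl_mul_comm (hcentral : ext.inl.range ≤ Subgroup.center G)
    (z : Multiplicative A) (g : G) : ext.inl z * g = g * ext.inl z :=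
  (Subgroup.mem_center_iff.mp (hcentral ⟨z, rfl⟩) g).symm

/-- A transposition reverses the boundary loop. For the first one the loop also starts at another
vertex, which conjugates its product; centrality makes this harmless. -/
theorem curvature_swap (hcentral : ext.inl.range ≤ Subgroup.center G)
    (j : Fin 2) (s : E.OrderedSimplex 2) :
    L.curvature (s.permute (Equiv.swap j.castSucc j.succ)) = -L.curvature s := by
  have hs := L.inl_curvature s
  have hc01 := L.c_swap (s.joined 0 1)
  have hc12 := L.c_swap (s.joined 1 2)
  have hc20 := L.c_swap (s.joined 2 0)
  refine L.curvature_eq_of ?_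
  rw [ofAdd_neg, map_inv, hs]
  fin_cases j
  · change _ = L.c (s.1 1) (s.1 0) * L.c (s.1 0) (s.1 2) * L.c (s.1 2) (s.1 1)
    have h := inl_mul_comm hcentral (Multiplicative.ofAdd (L.curvature s)) (L.c (s.1 0) (s.1 1))
    rw [hs, mul_assoc, mul_assoc, mul_left_cancel_iff] at h
    rw [← h, hc01, hc12, hc20]
    group
  · change _ = L.c (s.1 0) (s.1 2) * L.c (s.1 2) (s.1 1) * L.c (s.1 1) (s.1 0)
    rw [hc01, hc12, hc20]
    group

/-- The loops around the three faces at vertex `0` compose to the loop around the opposite face,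
conjugated by the edge from `0` to `1`. The conjugation disappears by centrality. -/
theorem coboundary_curvature (hcentral : ext.inl.range ≤ Subgroup.center G)
    (s : E.OrderedSimplex 3) :
    ∑ j : Fin 4, (-1 : ℤ) ^ (j : ℕ) • L.curvature (s.face j) = 0 := by
  have h : L.curvature (s.face 0) = L.curvature (s.face 3) + L.curvature (s.face 1) -
      L.curvature (s.face 2) := by
    refine L.curvature_eq_of ?_
    have hc := inl_mul_comm hcentral (Multiplicative.ofAdd (L.curvature (s.face 3) +
      L.curvature (s.face 1) - L.curvature (s.face 2))) (L.c (s.1 0) (s.1 1))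
    rw [eq_inv_mul_of_mul_eq hc.symm, ofAdd_sub, ofAdd_add, map_div, map_mul, div_eq_mul_inv,
      L.inl_curvature, L.inl_curvature, L.inl_curvature]
    change (L.c (s.1 0) (s.1 1))⁻¹ * (L.c (s.1 0) (s.1 1) * L.c (s.1 1) (s.1 2) *
      L.c (s.1 2) (s.1 0) * (L.c (s.1 0) (s.1 2) * L.c (s.1 2) (s.1 3) * L.c (s.1 3) (s.1 0)) *
      (L.c (s.1 0) (s.1 1) * L.c (s.1 1) (s.1 3) * L.c (s.1 3) (s.1 0))⁻¹ * L.c (s.1 0) (s.1 1)) =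
      L.c (s.1 1) (s.1 2) * L.c (s.1 2) (s.1 3) * L.c (s.1 3) (s.1 1)
    rw [L.c_swap (s.joined 0 2), L.c_swap (s.joined 1 3)]
    group
  rw [Fin.sum_univ_four, h]
  change (-1 : ℤ) ^ 0 • _ + (-1 : ℤ) ^ 1 • _ + (-1 : ℤ) ^ 2 • _ + (-1 : ℤ) ^ 3 • _ = _
  simp only [pow_zero, one_smul, neg_smul, pow_succ, mul_neg, mul_one, neg_neg]
  abel

variable [Fintype A]

/-- The simplicial cocycle of the group extension with values in the constants of `P(A)`. -/
noncomputable def constCurvature (P : MeasuredBoolAlg.{u, y} Γ) (s : E.OrderedSimplex 2) :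
    P.Coeff A :=
  PTensor.const P.carrier (L.curvature s)

theorem constCurvature_mem_cocycles (hcentral : ext.inl.range ≤ Subgroup.center G)
    (P : MeasuredBoolAlg.{u, y} Γ) :
    L.constCurvature P ∈ E.cocycles (P.Coeff A) 2 := by
  refine ⟨⟨alternating_of_swap fun j s => ?_, fun g s => ?_⟩, ?_⟩
  · simp only [constCurvature, L.curvature_swap hcentral, map_neg]
  · simp only [constCurvature, L.curvature_translate, P.smul_const]
  · ext s : 1
    change ∑ j : Fin 4, (-1 : ℤ) ^ (j : ℕ) • PTensor.const P.carrier (L.curvature (s.face j)) = 0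
    simp only [← map_zsmul, ← map_sum, L.coboundary_curvature hcentral, map_zero]

/-- If the cocycle of the extension is close to a coboundary then the cosystolic inequality shows
that it is a coboundary. -/
theorem exists_constCurvature_eq_coboundary (hcentral : ext.inl.range ≤ Subgroup.center G)
    {ν : E.FaithfulWeights 2}
    {P : MeasuredBoolAlg.{u, y} Γ} {ε : ℝ}
    (hε : ∀ α : E.Cohomology (P.Coeff A) 2, α ≠ 0 → ε ≤ classLength ν P α)
    {b : E.OrderedSimplex 1 → P.Coeff A} (hb : b ∈ E.cochains (P.Coeff A) 1)
    (hlt : cochainLength ν P (L.constCurvature P - E.coboundary (P.Coeff A) 1 b) < ε) :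
    ∃ b' ∈ E.cochains (P.Coeff A) 1, E.coboundary (P.Coeff A) 1 b' = L.constCurvature P := by
  obtain ⟨e, rfl, he, he'⟩ := exists_edgeCochain_eq hb
  have hδ : E.coboundary (P.Coeff A) 1 (edgeCochain e) ∈ E.cocycles (P.Coeff A) 2 :=
    coboundary_edgeCochain_mem_cocycles he he'
  let z₀ : E.cocycles (P.Coeff A) 2 := ⟨_, L.constCurvature_mem_cocycles hcentral P⟩
  let z : E.cocycles (P.Coeff A) 2 := ⟨_, sub_mem (L.constCurvature_mem_cocycles hcentral P) hδ⟩
  by_contra hne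
  have hα : (QuotientAddGroup.mk z₀ : E.Cohomology (P.Coeff A) 2) ≠ 0 := fun h => by
    rw [QuotientAddGroup.eq_zero_iff] at h
    exact hne h
  refine absurd (hε _ hα) (not_le.mpr (lt_of_le_of_lt ?_ hlt))
  -- The difference `z` represents the same class as the curvature, so its length bounds the norm of
  -- that class from above.
  have hz : (QuotientAddGroup.mk z : E.Cohomology (P.Coeff A) 2) = QuotientAddGroup.mk z₀ := by
    refine QuotientAddGroup.eq.mpr ?_
    refine ⟨_, hb, ?_⟩
    change E.coboundary (P.Coeff A) 1 (edgeCochain e) =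
      -(L.constCurvature P - E.coboundary (P.Coeff A) 1 (edgeCochain e)) + L.constCurvature P
    abel
  refine ciInf_le (f := fun z : {z : E.cocycles (P.Coeff A) 2 //
    (QuotientAddGroup.mk z : E.Cohomology _ 2) = QuotientAddGroup.mk z₀} =>
      cochainLength ν P z.1.1) ⟨0, ?_⟩ ⟨z, hz⟩
  rintro _ ⟨y, rfl⟩
  exact Finset.sum_nonneg fun x _ => mul_nonneg
    (Finset.sum_nonneg fun a _ => P.measure_nonneg _) (ν.pos x).le

end EdgeLift

end FiniteClassifyingSpace

/-! ### Finite actions and their transitive components -/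

namespace PTensor

variable {P : Type v} [BooleanAlgebra P] {Q : Type x} [BooleanAlgebra Q] {A : Type w} [Fintype A]
  [AddCommGroup A]

/-- The homomorphism of coefficient groups given by a homomorphism of Boolean algebras. -/
noncomputable def map (f : BoundedLatticeHom P Q) : PTensor P A →+ PTensor Q A :=
  AddMonoidHom.mk' (fun s =>
    { part := fun a => f (s.part a)
      disjoint := fun a b hab => by
        rw [disjoint_iff, ← map_inf, (s.disjoint a b hab).eq_bot, map_bot]
      sup_eq_top := by
        have h := map_finset_sup f Finset.univ s.part
        rw [s.sup_eq_top, map_top] at h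
        exact h.symm }) (fun s t => by
    refine ext_of_cover (fun p : A × A => f (s.part p.1 ⊓ t.part p.2)) ?_ ?_
    · have h := map_finset_sup f Finset.univ (fun p : A × A => s.part p.1 ⊓ t.part p.2)
      rw [sup_prod, map_top] at h
      exact h.symm
    · rintro ⟨a, b⟩
      exact ⟨a + b, OrderHomClass.mono f (le_add inf_le_left inf_le_right),
        le_add (OrderHomClass.mono f inf_le_left) (OrderHomClass.mono f inf_le_right)⟩)

theorem map_part (f : BoundedLatticeHom P Q) (s : PTensor P A) (a : A) :
    (map f s).part a = f (s.part a) := rfl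

theorem map_const (f : BoundedLatticeHom P Q) (a : A) : map f (const P a) = const Q a :=
  ext_of_cover (fun _ : Unit => (⊤ : Q)) (by simp) fun _ => ⟨a, by
    rw [map_part, top_le_iff.mp (le_const (⊤ : P) a), map_top], le_const _ _⟩

theorem exists_le_part {x : P} (hx : IsAtom x) {A : Type w} [Fintype A]
    (s : PTensor P A) : ∃ a, x ≤ s.part a := by
  by_contra! h
  have hd : ∀ a, Disjoint x (s.part a) := fun a => hx.not_le_iff_disjoint.mp (h a)
  have : Disjoint x (Finset.univ.sup s.part) := Finset.disjoint_sup_right.mpr fun a _ => hd a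
  rw [s.sup_eq_top, disjoint_top] at this
  exact hx.1 this

theorem eq_of_le_part {x : P} (hx : x ≠ ⊥) {A : Type w} [Fintype A]
    {s : PTensor P A} {a b : A} (ha : x ≤ s.part a)
    (hb : x ≤ s.part b) : a = b := by
  by_contra h
  exact hx (le_bot_iff.mp ((s.disjoint a b h) ha hb))

/-- The value of an element of `P(A)` at an atom of `P`. -/
noncomputable def eval {x : P} (hx : IsAtom x) : PTensor P A →+ A :=
  AddMonoidHom.mk' (fun s => (exists_le_part hx s).choose) fun s t =>
    eq_of_le_part hx.1 (exists_le_part hx (s + t)).choose_spec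
      (le_add (exists_le_part hx s).choose_spec (exists_le_part hx t).choose_spec)

theorem le_part_eval {x : P} (hx : IsAtom x) (s : PTensor P A) : x ≤ s.part (eval hx s) :=
  (exists_le_part hx s).choose_spec

theorem eval_eq_of_le {x : P} (hx : IsAtom x) {s : PTensor P A} {a : A} (h : x ≤ s.part a) :
    eval hx s = a :=
  eq_of_le_part hx.1 (le_part_eval hx s) h

end PTensor

namespace MeasuredBoolAlg

variable {Γ : Type u} [Group Γ] (P : MeasuredBoolAlg.{u, v} Γ) {A : Type w} [AddCommGroup A]
  [Fintype A]

theorem smul_mono (g : Γ) {X Y : P.carrier} (h : X ≤ Y) : g • X ≤ g • Y := by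
  rw [← inf_eq_left, ← P.smul_inf, inf_eq_left.mpr h]

theorem smul_le_iff (g : Γ) {X Y : P.carrier} : g • X ≤ g • Y ↔ X ≤ Y :=
  ⟨fun h => by simpa using P.smul_mono g⁻¹ h, P.smul_mono g⟩

/-- Evaluation at an atom turns `Γ`-equivariance into invariance under the stabilizer, which becomes
the subgroup `Λ` of the splitting. -/
theorem eval_smul {x : P.carrier} (hx : IsAtom x) {g : Γ} (hg : g • x = x) (s : P.Coeff A) :
    PTensor.eval hx (g • s) = PTensor.eval hx s := by
  refine PTensor.eval_eq_of_le hx ?_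
  have := P.smul_mono g (PTensor.le_part_eval hx s)
  rwa [hg] at this

theorem isAtom_smul {x : P.carrier} (hx : IsAtom x) (g : Γ) : IsAtom (g • x) := by
  refine ⟨fun h => hx.1 ?_, fun y hy => ?_⟩
  · rw [← inv_smul_smul g x, h, P.smul_bot]
  · have h1 : g⁻¹ • y < x := by
      rw [lt_iff_le_not_ge] at hy ⊢
      rw [← P.smul_le_iff g, smul_inv_smul, ← P.smul_le_iff g (X := x), smul_inv_smul]
      exact hy
    rw [← smul_inv_smul g y, hx.2 _ h1, P.smul_bot]

theorem exists_isAtom [Finite P.carrier] : ∃ x : P.carrier, IsAtom x := by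
  have hne : (⊤ : P.carrier) ≠ ⊥ := fun h => by
    have := P.measure_top
    rw [h, P.measure_bot] at this
    exact zero_ne_one this
  obtain h | ⟨x, hx, -⟩ := eq_bot_or_exists_atom_le (⊤ : P.carrier)
  · exact absurd h hne
  · exact ⟨x, hx⟩

open Classical in
theorem measure_eq_sum_atoms [Fintype P.carrier] (Z : P.carrier) :
    P.measure Z = ∑ y : P.carrier with IsAtom y ∧ y ≤ Z, P.measure y := by
  have h1 : ∀ S : Finset P.carrier, (∀ y ∈ S, IsAtom y) →
      P.measure (S.sup id) = ∑ y ∈ S, P.measure y := fun S => by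
    induction S using Finset.induction_on with
    | empty => intro; simp [P.measure_bot]
    | insert y S hy ih =>
      intro h
      have hS : ∀ z ∈ S, IsAtom z := fun z hz => h z (Finset.mem_insert_of_mem hz)
      rw [Finset.sup_insert, Finset.sum_insert hy, ← ih hS]
      refine P.measure_sup_of_disjoint (Finset.disjoint_sup_right.mpr fun z hz => ?_)
      exact (h y (Finset.mem_insert_self y S)).disjoint_of_ne (hS z hz) fun e => hy (e ▸ hz)
  rw [← h1 _ fun y hy => (Finset.mem_filter.mp hy).2.1]
  congr 1
  refine le_antisymm ?_ (Finset.sup_le fun y hy => (Finset.mem_filter.mp hy).2.2)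
  -- If `Z` exceeded the join of the atoms below it, the difference would contain a further atom
  -- below `Z`.
  rw [← sdiff_eq_bot_iff]
  by_contra hne
  obtain ⟨x, hx, hxZ⟩ := (eq_bot_or_exists_atom_le _).resolve_left hne
  refine hx.1 (le_bot_iff.mp ?_)
  exact disjoint_sdiff_self_right (Finset.le_sup (f := id)
    (Finset.mem_filter.mpr ⟨Finset.mem_univ x, hx, hxZ.trans sdiff_le⟩)) hxZ

/-- The finite transitive action given by the orbit of an atom. -/
noncomputable def orbitAlg [Finite P.carrier] (x : P.carrier) : MeasuredBoolAlg.{u, v} Γ :=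
  have : Nonempty (MulAction.orbit Γ x) := ⟨⟨x, MulAction.mem_orbit_self x⟩⟩
  ofPerm (MulAction.orbit Γ x) (MulAction.toPermHom Γ (MulAction.orbit Γ x))

theorem orbitAlg_mem [Finite P.carrier] (x : P.carrier) :
    P.orbitAlg x ∈ finiteTransitiveActions Γ := by
  refine ⟨inferInstanceAs (Finite (Set (MulAction.orbit Γ x))), fun X Y hX hY => ?_⟩
  obtain ⟨y, rfl⟩ := Set.isAtom_iff.mp (show IsAtom (show Set (MulAction.orbit Γ x) from X) from hX)
  obtain ⟨z, rfl⟩ := Set.isAtom_iff.mp (show IsAtom (show Set (MulAction.orbit Γ x) from Y) from hY)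
  obtain ⟨g, hg⟩ := MulAction.exists_smul_eq Γ y z
  refine ⟨g, ?_⟩
  change (MulAction.toPerm g) '' {y} = _
  rw [Set.image_singleton]
  exact congrArg _ hg

/-- The restriction of the elements of a finite algebra to the orbit of an atom. -/
noncomputable def restrict [Finite P.carrier] {x : P.carrier} (hx : IsAtom x) :
    BoundedLatticeHom P.carrier (P.orbitAlg x).carrier where
  toFun Z := ({y | y.1 ≤ Z} : Set (MulAction.orbit Γ x))
  map_sup' Z Z' := by
    refine Set.ext (α := MulAction.orbit Γ x) fun y => ?_
    have hy : IsAtom y.1 := by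
      obtain ⟨_, g, rfl⟩ := y
      exact P.isAtom_smul hx g
    refine ⟨fun h => ?_, fun h => h.elim le_sup_of_le_left le_sup_of_le_right⟩
    by_contra! hne
    have hd : Disjoint y.1 (Z ⊔ Z') := disjoint_sup_right.mpr
      ⟨hy.not_le_iff_disjoint.mp fun h => hne (Or.inl h),
        hy.not_le_iff_disjoint.mp fun h => hne (Or.inr h)⟩
    exact hy.1 (le_bot_iff.mp (hd le_rfl h))
  map_inf' Z Z' := by
    refine Set.ext (α := MulAction.orbit Γ x) fun y => ?_
    exact le_inf_iff
  map_top' := by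
    refine Set.ext (α := MulAction.orbit Γ x) fun y => ?_
    exact ⟨fun _ => trivial, fun _ => le_top⟩
  map_bot' := by
    refine Set.ext (α := MulAction.orbit Γ x) fun y => ?_
    have hy : IsAtom y.1 := by
      obtain ⟨_, g, rfl⟩ := y
      exact P.isAtom_smul hx g
    exact ⟨fun h => hy.1 (le_bot_iff.mp h), fun h => h.elim⟩

theorem restrict_smul [Finite P.carrier] {x : P.carrier} (hx : IsAtom x) (g : Γ) (Z : P.carrier) :
    P.restrict hx (g • Z) = g • P.restrict hx Z := by
  change ({y | y.1 ≤ g • Z} : Set (MulAction.orbit Γ x)) = (MulAction.toPerm g) '' {y | y.1 ≤ Z}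
  ext y
  rw [Equiv.image_eq_preimage_symm]
  change y.1 ≤ g • Z ↔ g⁻¹ • y.1 ≤ Z
  rw [← P.smul_le_iff g (X := g⁻¹ • y.1), smul_inv_smul]

open Classical in
theorem measure_restrict [Fintype P.carrier] {x : P.carrier} (hx : IsAtom x) (Z : P.carrier) :
    (P.orbitAlg x).measure (P.restrict hx Z) =
      ({y | y ∈ MulAction.orbit Γ x ∧ y ≤ Z} : Finset P.carrier).card /
        ({y | y ∈ MulAction.orbit Γ x} : Finset P.carrier).card := by
  change ((({y | y.1 ≤ Z} : Set (MulAction.orbit Γ x)).ncard : ℝ)) /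
    (Nat.card (MulAction.orbit Γ x) : ℝ) = _
  congr 2
  · rw [← Set.ncard_image_of_injective _ Subtype.val_injective, ← Set.ncard_coe_finset]
    congr 1
    ext y
    simp [and_comm]
  · rw [Nat.card_eq_fintype_card, Fintype.card_subtype]

-- Atoms of one orbit have equal measure, so `P` is a mixture of uniform measures on orbits. Summing
-- over atoms instead of orbits lists an orbit once per point, each time with the mass of one point,
-- which adds up to the mass of the orbit.
open Classical in
theorem measure_eq_average [Fintype P.carrier] (Z : P.carrier) :
    P.measure Z = ∑ x : {x : P.carrier // IsAtom x},
      P.measure x.1 * (P.orbitAlg x.1).measure (P.restrict x.2 Z) := by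
  have horb : ∀ {x y : P.carrier}, y ∈ MulAction.orbit Γ x →
      MulAction.orbit Γ y = MulAction.orbit Γ x := fun h => MulAction.orbit_eq_iff.mpr h
  have hsub : ∑ x : {x : P.carrier // IsAtom x},
      P.measure x.1 * (P.orbitAlg x.1).measure (P.restrict x.2 Z) =
      ∑ x : P.carrier with IsAtom x, ∑ y : P.carrier with IsAtom y ∧ y ≤ Z,
        if y ∈ MulAction.orbit Γ x then P.measure x /
          ({y | y ∈ MulAction.orbit Γ x} : Finset P.carrier).card else 0 := by
    rw [Finset.sum_subtype (p := IsAtom) (Finset.univ.filter fun x : P.carrier => IsAtom x)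
      (by simp)]
    refine Finset.sum_congr rfl fun x _ => ?_
    rw [P.measure_restrict x.2, ← Finset.sum_filter, Finset.sum_const, nsmul_eq_mul,
      Finset.filter_filter, mul_div_left_comm]
    congr 3
    ext y
    simp only [Finset.mem_filter, Finset.mem_univ, true_and]
    constructor
    · rintro ⟨⟨g, rfl⟩, h⟩
      exact ⟨⟨P.isAtom_smul x.2 g, h⟩, ⟨g, rfl⟩⟩
    · rintro ⟨⟨-, h⟩, h'⟩
      exact ⟨h', h⟩
  rw [hsub, Finset.sum_comm, P.measure_eq_sum_atoms Z]
  refine Finset.sum_congr rfl fun y hy => ?_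
  have hy : IsAtom y := (Finset.mem_filter.mp hy).2.1
  -- After exchanging the sums, `x` and `y` swap roles: lying in one orbit is symmetric, and measure
  -- and orbit size agree for both.
  have hcongr : ∀ x ∈ Finset.univ.filter (fun x : P.carrier => IsAtom x),
      (if y ∈ MulAction.orbit Γ x then P.measure x /
        ({y | y ∈ MulAction.orbit Γ x} : Finset P.carrier).card else 0) =
      if x ∈ MulAction.orbit Γ y then P.measure y /
        ({z | z ∈ MulAction.orbit Γ y} : Finset P.carrier).card else 0 := fun x _ => by
    by_cases h : y ∈ MulAction.orbit Γ x
    · have h' : x ∈ MulAction.orbit Γ y := MulAction.mem_orbit_symm.mp h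
      rw [if_pos h, if_pos h', horb h]
      obtain ⟨g, rfl⟩ := h
      rw [P.measure_smul]
    · have h' : x ∉ MulAction.orbit Γ y := fun h' => h (MulAction.mem_orbit_symm.mp h')
      rw [if_neg h, if_neg h']
  rw [Finset.sum_congr rfl hcongr, ← Finset.sum_filter, Finset.sum_const, nsmul_eq_mul,
    Finset.filter_filter]
  have hset : (Finset.univ.filter fun x : P.carrier => IsAtom x ∧ x ∈ MulAction.orbit Γ y) =
      ({z | z ∈ MulAction.orbit Γ y} : Finset P.carrier) := by
    refine Finset.filter_congr fun x _ => ⟨And.right, fun h => ⟨?_, h⟩⟩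
    obtain ⟨g, rfl⟩ := h
    exact P.isAtom_smul hy g
  rw [hset, mul_div_cancel₀]
  exact_mod_cast (Finset.card_pos.mpr ⟨y, by simp⟩).ne'

end MeasuredBoolAlg

/-! ### Cosystolic inequality: from transitive to finite actions -/

namespace FiniteClassifyingSpace

variable {Γ : Type u} [Group Γ] {E : FiniteClassifyingSpace.{u, w} Γ} {A : Type x} [AddCommGroup A]
  [Fintype A]

-- The length is linear in the measure, so `measure_eq_average` applies part by part. This is what
-- brings the inequality for transitive actions to bear on all finite ones.
open Classical in
theorem cochainLength_eq_average (ν : E.FaithfulWeights 2) (P : MeasuredBoolAlg.{u, v} Γ)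
    [Fintype P.carrier] (z : E.OrderedSimplex 2 → P.Coeff A) :
    cochainLength ν P z = ∑ x : {x : P.carrier // IsAtom x},
      P.measure x.1 * cochainLength ν (P.orbitAlg x.1)
        (fun s => PTensor.map (P.restrict x.2) (z s)) := by
  have h : ∀ s : P.Coeff A, P.coeffMeasure s = ∑ x : {x : P.carrier // IsAtom x},
      P.measure x.1 * (P.orbitAlg x.1).coeffMeasure (PTensor.map (P.restrict x.2) s) := fun s => by
    simp only [MeasuredBoolAlg.coeffMeasure, PTensor.map_part, Finset.mul_sum]
    refine Eq.trans ?_ Finset.sum_comm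
    exact Finset.sum_congr rfl fun a _ => P.measure_eq_average _
  simp only [cochainLength, h, Finset.mul_sum, Finset.sum_mul]
  refine Finset.sum_comm.trans ?_
  simp only [mul_assoc]

theorem coboundary_comp_map {M : Type v} {N : Type y} [AddCommGroup M] [AddCommGroup N]
    (f : M →+ N) (i : ℕ) (c : E.OrderedSimplex i → M) (s : E.OrderedSimplex (i + 1)) :
    E.coboundary N i (fun s => f (c s)) s = f (E.coboundary M i c s) := by
  change ∑ j : Fin (i + 2), (-1 : ℤ) ^ (j : ℕ) • f (c (s.face j)) =
    f (∑ j : Fin (i + 2), (-1 : ℤ) ^ (j : ℕ) • c (s.face j))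
  simp only [map_sum, map_zsmul]

variable {G : Type v} [Group G] {ext : GroupExtension (Multiplicative A) G Γ}

/-- If the cocycle of the extension becomes a coboundary over a finite action then the extension
splits over a subgroup of finite index. -/
theorem EdgeLift.residuallyFinite_of_eq_coboundary [Group.ResiduallyFinite Γ] (L : EdgeLift E ext)
    (hcentral : ext.inl.range ≤ Subgroup.center G) (P : MeasuredBoolAlg.{u, 0} Γ)
    [Finite P.carrier] {b : E.OrderedSimplex 1 → P.Coeff A} (hb : b ∈ E.cochains (P.Coeff A) 1)
    (hκ : E.coboundary (P.Coeff A) 1 b = L.constCurvature P) : Group.ResiduallyFinite G := by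
  classical
  obtain ⟨e, rfl, he, he'⟩ := exists_edgeCochain_eq hb
  obtain ⟨x, hx⟩ := P.exists_isAtom
  have : Finite (MulAction.orbit Γ x) := inferInstance
  have : (MulAction.stabilizer Γ x).FiniteIndex := by
    have : Finite (Γ ⧸ MulAction.stabilizer Γ x) :=
      Finite.of_equiv _ (MulAction.orbitEquivQuotientStabilizer Γ x)
    exact Subgroup.finiteIndex_of_finite_quotient
  -- Antisymmetry does not force `e a a = 0` when `A` has 2-torsion, so the diagonal is set to `0`.
  let d : E.V → E.V → A := fun a₁ a₂ => if a₁ = a₂ then 0 else PTensor.eval hx (e a₁ a₂)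
  have hd : ∀ a₁ a₂, E.Joined a₁ a₂ → d a₂ a₁ = -d a₁ a₂ := fun a₁ a₂ h => by
    by_cases h12 : a₁ = a₂
    · simp [d, h12]
    · simp only [d, if_neg h12, if_neg (Ne.symm h12), he _ _ h, map_neg]
  refine L.residuallyFinite hcentral (MulAction.stabilizer Γ x) d hd ?_ ?_
  · intro a₁ a₂ h l hl
    have hl : l • x = x := hl
    simp only [d, smul_left_cancel_iff, he' l _ _ h, P.eval_smul hx hl]
  · intro s hs a₁ h₁ a₂ h₂ a₃ h₃
    have hd0 : ∀ a, d a a = 0 := fun a => if_pos rfl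
    -- Degenerate triangles are not ordered simplices, so the cocycle identity says nothing about
    -- them; both sides are trivial there.
    by_cases h12 : a₁ = a₂
    · subst h12
      rw [hd0, hd _ _ ⟨s, hs, h₁, h₃⟩, L.c_swap ⟨s, hs, h₁, h₃⟩, L.c_self]
      simp
    by_cases h23 : a₂ = a₃
    · subst h23
      rw [hd0, hd _ _ ⟨s, hs, h₁, h₂⟩, L.c_swap ⟨s, hs, h₁, h₂⟩, L.c_self]
      simp
    by_cases h31 : a₃ = a₁
    · subst h31
      rw [hd0, hd _ _ ⟨s, hs, h₂, h₃⟩, L.c_swap ⟨s, hs, h₂, h₃⟩, L.c_self]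
      simp
    let t : E.OrderedSimplex 2 := ⟨⟨![a₁, a₂, a₃], by
      intro i j hij
      have h21 := Ne.symm h12
      have h32 := Ne.symm h23
      have h13 := Ne.symm h31
      fin_cases i <;> fin_cases j <;> first | rfl | contradiction⟩, by
      refine (E.K.isRelLowerSet_faces hs).2 ?_ (by simp)
      intro y hy
      obtain ⟨i, -, rfl⟩ := Finset.mem_map.mp hy
      fin_cases i <;> assumption⟩
    have ht := L.inl_curvature t
    have hκt : e a₁ a₂ + e a₂ a₃ + e a₃ a₁ = PTensor.const P.carrier (L.curvature t) :=
      (coboundary_edgeCochain he t).symm.trans (congrFun hκ t)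
    have hev : L.curvature t = d a₁ a₂ + d a₂ a₃ + d a₃ a₁ := by
      rw [← PTensor.eval_eq_of_le hx (PTensor.le_const x (L.curvature t)), ← hκt, map_add, map_add]
      simp only [d, if_neg h12, if_neg h23, if_neg h31]
    rw [← hev, ht]
    rfl

/-- If the cocycle of the extension is close to a coboundary over a finite action, then the
cosystolic inequality for transitive actions implies that the extension is residually finite. -/
theorem EdgeLift.residuallyFinite_of_cochainLength_lt [Group.ResiduallyFinite Γ]
    (L : EdgeLift E ext) (hcentral : ext.inl.range ≤ Subgroup.center G) {ν : E.FaithfulWeights 2}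
    {ε : ℝ} (hε : ∀ P ∈ MeasuredBoolAlg.finiteTransitiveActions.{u, 0} Γ,
      ∀ α : E.Cohomology (P.Coeff A) 2, α ≠ 0 → ε ≤ classLength ν P α)
    (P : MeasuredBoolAlg.{u, 0} Γ) [Finite P.carrier] {b : E.OrderedSimplex 1 → P.Coeff A}
    (hb : b ∈ E.cochains (P.Coeff A) 1)
    (hlt : cochainLength ν P (L.constCurvature P - E.coboundary (P.Coeff A) 1 b) < ε) :
    Group.ResiduallyFinite G := by
  classical
  have := Fintype.ofFinite P.carrier
  -- The masses of the atoms sum to `1`, so an average below `ε` has a term below `ε`.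
  obtain ⟨x, hx⟩ : ∃ x : {x : P.carrier // IsAtom x},
      cochainLength ν (P.orbitAlg x.1) (fun s => PTensor.map (P.restrict x.2)
        ((L.constCurvature P - E.coboundary (P.Coeff A) 1 b) s)) < ε := by
    by_contra! h
    refine absurd hlt (not_lt.mpr ?_)
    rw [cochainLength_eq_average]
    have h1 : ∑ x : {x : P.carrier // IsAtom x}, P.measure x.1 = 1 := by
      rw [← P.measure_top, P.measure_eq_sum_atoms ⊤, Finset.sum_subtype (p := fun x : P.carrier => IsAtom x)]
      simp
    calc ε = ∑ x : {x : P.carrier // IsAtom x}, P.measure x.1 * ε := by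
          rw [← Finset.sum_mul, h1, one_mul]
      _ ≤ _ := Finset.sum_le_sum fun x _ => mul_le_mul_of_nonneg_left (h x) (P.measure_nonneg _)
  let f : P.Coeff A →+ (P.orbitAlg x.1).Coeff A := PTensor.map (P.restrict x.2)
  have hf : ∀ (g : Γ) s, f (g • s) = g • f s := fun g s =>
    PTensor.ext_of_le fun a => (P.restrict_smul x.2 g (s.part a)).le
  have hb' : (fun s => f (b s)) ∈ E.cochains ((P.orbitAlg x.1).Coeff A) 1 := by
    refine ⟨fun τ s => ?_, fun g s => ?_⟩
    · beta_reduce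
      rw [hb.1, map_zsmul]
    · beta_reduce
      rw [hb.2, hf]
  obtain ⟨b', hb', h⟩ := L.exists_constCurvature_eq_coboundary hcentral
    (hε _ (P.orbitAlg_mem x.1)) hb' (lt_of_eq_of_lt (congrArg _ (funext fun s => by
      rw [Pi.sub_apply, Pi.sub_apply, coboundary_comp_map, map_sub]
      congr 1
      exact (PTensor.map_const _ _).symm)) hx)
  have : Finite (P.orbitAlg x.1).carrier := (P.orbitAlg_mem x.1).1
  exact L.residuallyFinite_of_eq_coboundary hcentral _ hb' h

end FiniteClassifyingSpace

/-! ### Weak containment in finite actions -/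

open Filter Topology

namespace PTensor

variable {P : Type v} [BooleanAlgebra P] {Q : Type x} [BooleanAlgebra Q] {A : Type w} [Fintype A]
  [AddCommGroup A]

theorem map_tmul (f : BoundedLatticeHom P Q) (X : P) (a : A) : map f (tmul X a) = tmul (f X) a := by
  refine ext_of_cover (fun i : Bool => if i then f X else (f X)ᶜ) ?_ ?_
  · rw [Fintype.univ_bool, Finset.sup_insert, Finset.sup_singleton]
    exact sup_compl_eq_top
  · rintro (_ | _)
    · refine ⟨0, ?_, le_tmul_zero a le_rfl⟩
      change (f X)ᶜ ≤ f ((tmul X a).part 0)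
      rw [← map_compl']
      exact OrderHomClass.mono f (le_tmul_zero a le_rfl)
    · exact ⟨a, OrderHomClass.mono f (le_tmul a le_rfl), le_tmul a le_rfl⟩

/-- Lifts of the parts need not form a partition, but the sum of the corresponding symbols is always
defined and maps to the right element. -/
theorem map_surjective {f : BoundedLatticeHom P Q} (hf : Function.Surjective f) :
    Function.Surjective (map f : PTensor P A →+ PTensor Q A) := fun s => by
  choose X hX using fun a => hf (s.part a)
  refine ⟨∑ a, tmul (X a) a, ?_⟩
  simp only [_root_.map_sum, map_tmul, hX, sum_tmul]

end PTensor

namespace MeasuredBoolAlg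

variable {Γ : Type u} [Group Γ] {I : Type w} (𝒰 : Ultrafilter I) (Q : I → MeasuredBoolAlg.{u, v} Γ)

/-- The quotient map onto the metric ultraproduct. -/
def ultraMk : BoundedLatticeHom (∀ j, (Q j).carrier) (UltraCarrier 𝒰 Q) where
  toFun := UltraCarrier.mk 𝒰 Q
  map_sup' _ _ := rfl
  map_inf' _ _ := rfl
  map_top' := rfl
  map_bot' := rfl

/-- The projection to a factor. -/
def proj (j : I) : BoundedLatticeHom (∀ j, (Q j).carrier) (Q j).carrier where
  toFun X := X j
  map_sup' _ _ := rfl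
  map_inf' _ _ := rfl
  map_top' := rfl
  map_bot' := rfl

/-- The action of a group element on the product. -/
def smulProd (g : Γ) : BoundedLatticeHom (∀ j, (Q j).carrier) (∀ j, (Q j).carrier) where
  toFun X j := g • X j
  map_sup' _ _ := funext fun j => (Q j).smul_sup g _ _
  map_inf' _ _ := funext fun j => (Q j).smul_inf g _ _
  map_top' := funext fun j => (Q j).smul_top g
  map_bot' := funext fun j => (Q j).smul_bot g

variable {A : Type x} [AddCommGroup A] [Fintype A]

/-- Vanishing in the ultraproduct means that each part with nonzero label is a null class, that is,
its measures tend to `0`. -/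
theorem tendsto_coeffMeasure {s : PTensor (∀ j, (Q j).carrier) A}
    (hs : PTensor.map (ultraMk 𝒰 Q) s = 0) :
    Tendsto (fun j => (Q j).coeffMeasure (PTensor.map (proj Q j) s)) 𝒰 (𝓝 0) := by
  classical
  have key : ∀ a ∈ Finset.univ.filter (fun a : A => a ≠ 0),
      Tendsto (fun j => (Q j).measure (s.part a j)) 𝒰 (𝓝 0) := fun a ha => by
    have h := ultraMeasure_mk_tendsto 𝒰 Q (s.part a)
    have h0 : UltraCarrier.mk 𝒰 Q (s.part a) = ⊥ := by
      change (PTensor.map (ultraMk 𝒰 Q) s).part a = ⊥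
      rw [hs, ← le_bot_iff]
      have h1 := (0 : PTensor (UltraCarrier 𝒰 Q) A).disjoint a 0 (Finset.mem_filter.mp ha).2
      exact h1 le_rfl (PTensor.le_zero _)
    rw [h0] at h
    have h2 := (ultraproduct 𝒰 Q).measure_bot
    change ultraMeasure 𝒰 Q ⊥ = 0 at h2
    rwa [h2] at h
  have h := tendsto_finsetSum _ key
  rw [Finset.sum_const_zero] at h
  exact h

end MeasuredBoolAlg

/-! ### From a crossed homomorphism in the limit to residual finiteness -/

namespace FiniteClassifyingSpace

variable {Γ : Type u} [Group Γ] {E : FiniteClassifyingSpace.{u, w} Γ} {A : Type x} [AddCommGroup A]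
  [Fintype A] {G : Type y} [Group G] {ext : GroupExtension (Multiplicative A) G Γ}

/-- A crossed homomorphism that restricts to the identity on the kernel exhibits the cocycle of the
extension as a coboundary. -/
theorem EdgeLift.edge_relations (L : EdgeLift E ext) {P : MeasuredBoolAlg.{u, z} Γ}
    {B : G → P.Coeff A} (hB : ∀ g h, B (g * h) = B g + ext.rightHom g • B h)
    (hBA : ∀ a, B (ext.inl (Multiplicative.ofAdd a)) = PTensor.const P.carrier a) :
    (∀ a, L.γ a • B (L.c a a) = 0) ∧
    (∀ a₁ a₂, E.Joined a₁ a₂ → L.γ a₂ • B (L.c a₂ a₁) = -(L.γ a₁ • B (L.c a₁ a₂))) ∧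
    (∀ (g : Γ) a₁ a₂, E.Joined a₁ a₂ →
      L.γ (g • a₁) • B (L.c (g • a₁) (g • a₂)) = g • L.γ a₁ • B (L.c a₁ a₂)) ∧
    ∀ s : E.OrderedSimplex 2, L.γ (s.1 0) • B (L.c (s.1 0) (s.1 1)) +
      L.γ (s.1 1) • B (L.c (s.1 1) (s.1 2)) + L.γ (s.1 2) • B (L.c (s.1 2) (s.1 0)) =
      PTensor.const P.carrier (L.curvature s) := by
  have h1 : B 1 = 0 := by simpa using hB 1 1
  refine ⟨fun a => by rw [L.c_self, h1, smul_zero], fun a₁ a₂ h => ?_, fun g a₁ a₂ h => ?_,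
    fun s => ?_⟩
  · have h2 := hB (L.c a₁ a₂) (L.c a₂ a₁)
    rw [L.c_swap h, mul_inv_cancel, h1, ← L.c_swap h, L.rightHom_c h] at h2
    rw [eq_neg_iff_add_eq_zero, add_comm, ← mul_inv_cancel_left (L.γ a₁) (L.γ a₂), mul_smul,
      ← smul_add, ← h2, smul_zero]
  · rw [L.γ_smul, L.c_smul h, mul_smul]
  · have h2 := hBA (L.curvature s)
    -- The crossed rule expands `B` along the three edges of the triangle; translating by `γ` of the
    -- first vertex then leaves the constant fixed.
    rw [L.inl_curvature, hB, hB, map_mul, L.rightHom_c (s.joined 0 1),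
      L.rightHom_c (s.joined 1 2)] at h2
    have h3 := congrArg (fun t => L.γ (s.1 0) • t) h2
    simp only [smul_add, ← mul_smul, P.smul_const] at h3
    rw [← h3]
    congr 3 <;> group

/-- If the cocycle of the extension becomes a coboundary in an action that is weakly contained in
the finite actions, then the cosystolic inequality implies that the extension is residually
finite. -/
theorem EdgeLift.residuallyFinite_of_weaklyContained [Group.ResiduallyFinite Γ]
    (L : EdgeLift E ext) (hcentral : ext.inl.range ≤ Subgroup.center G) {ν : E.FaithfulWeights 2}
    (hcosys : CosystolicInequality ν A (MeasuredBoolAlg.finiteTransitiveActions.{u, 0} Γ))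
    {P : MeasuredBoolAlg.{u, z} Γ}
    (hP : P.IsWeaklyContainedIn (MeasuredBoolAlg.finiteActions.{u, 0} Γ))
    {B : G → P.Coeff A} (hB : ∀ g h, B (g * h) = B g + ext.rightHom g • B h)
    (hBA : ∀ a, B (ext.inl (Multiplicative.ofAdd a)) = PTensor.const P.carrier a) :
    Group.ResiduallyFinite G := by
  obtain ⟨ε, hε0, hε⟩ := hcosys
  obtain ⟨I, 𝒰, Q, -, hQ, f, hf, -⟩ := hP
  let U := MeasuredBoolAlg.ultraproduct 𝒰 Q
  let B' : G → U.Coeff A := fun g => PTensor.map f (B g)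
  have hfB : ∀ (g : Γ) s, (PTensor.map f (g • s) : U.Coeff A) = g • PTensor.map f s := fun g s =>
    PTensor.ext_of_le fun a => (hf g (s.part a)).le
  obtain ⟨e0, e1, e2, e3⟩ := L.edge_relations (P := U) (B := B')
    (fun g h => by simp only [B', hB, _root_.map_add, hfB])
    (fun a => by simp only [B', hBA]; exact PTensor.map_const f a)
  -- Lifts are chosen in the full product: it maps onto the coefficients of the ultraproduct and
  -- projects equivariantly to every `Q j`, so one equivariant choice serves all `j`.
  let M := PTensor (∀ j, (Q j).carrier) A
  let _ : MulAction Γ M :=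
    { smul := fun g m => PTensor.map (MeasuredBoolAlg.smulProd Q g) m
      one_smul := fun m => PTensor.ext_of_le fun a => (one_smul Γ (m.part a)).le
      mul_smul := fun g h m => PTensor.ext_of_le fun a => (mul_smul g h (m.part a)).le }
  let q : M →+ U.Coeff A := PTensor.map (MeasuredBoolAlg.ultraMk 𝒰 Q)
  have hq : Function.Surjective q := PTensor.map_surjective Quotient.mk_surjective
  have hqsmul : ∀ (g : Γ) m, q (g • m) = g • q m := fun g m => PTensor.ext_of_le fun a => le_rfl
  let r : ∀ j, M →+ (Q j).Coeff A := fun j => PTensor.map (MeasuredBoolAlg.proj Q j)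
  have hrsmul : ∀ j (g : Γ) m, r j (g • m) = g • r j m := fun j g m =>
    PTensor.ext_of_le fun a => le_rfl
  obtain ⟨C, hC⟩ := exists_equivariant_edge_map (E := E) (M := M) (fun m => -m) neg_neg
    (fun g m => (map_neg (PTensor.map (MeasuredBoolAlg.smulProd Q g)) m))
    (fun a₁ a₂ m => E.Joined a₁ a₂ → q m = L.γ a₁ • B' (L.c a₁ a₂))
    (fun a₁ a₂ => (hq (L.γ a₁ • B' (L.c a₁ a₂))).imp fun _ h _ => h)
    (fun a => ⟨0, fun _ => by rw [_root_.map_zero, e0], neg_zero⟩)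
    (fun g a₁ a₂ m h h' => by rw [hqsmul, h (joined_smul_iff.mp h'), e2 _ _ _ (joined_smul_iff.mp h')])
    (fun a₁ a₂ m h h' => by rw [map_neg, h h'.symm, e1 _ _ h'.symm])
  let b : ∀ j, E.V → E.V → (Q j).Coeff A := fun j a₁ a₂ => r j (C a₁ a₂)
  have hb : ∀ j a₁ a₂, E.Joined a₁ a₂ → b j a₂ a₁ = -b j a₁ a₂ := fun j a₁ a₂ h => by
    simp only [b, (hC a₁ a₂ h).2.2]
    exact map_neg (r j) _
  have hb' : ∀ j (g : Γ) a₁ a₂, E.Joined a₁ a₂ → b j (g • a₁) (g • a₂) = g • b j a₁ a₂ :=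
    fun j g a₁ a₂ h => by simp only [b, (hC a₁ a₂ h).2.1, hrsmul]
  -- The defect between curvature and coboundary in the product. It vanishes in the ultraproduct,
  -- hence has small measure in most factors; there are finitely many cells to control.
  let N : E.OrderedSimplex 2 → M := fun s => PTensor.const _ (L.curvature s) -
    (C (s.1 0) (s.1 1) + C (s.1 1) (s.1 2) + C (s.1 2) (s.1 0))
  have hN : ∀ s, q (N s) = 0 := fun s => by
    rw [map_sub, _root_.map_add, _root_.map_add, (hC _ _ (s.joined 0 1)).1 (s.joined 0 1),
      (hC _ _ (s.joined 1 2)).1 (s.joined 1 2), (hC _ _ (s.joined 2 0)).1 (s.joined 2 0), e3,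
      sub_eq_zero]
    exact PTensor.map_const _ _
  have hrN : ∀ j s, (L.constCurvature (Q j) -
      E.coboundary ((Q j).Coeff A) 1 (edgeCochain (b j))) s = r j (N s) := fun j s => by
    rw [Pi.sub_apply, coboundary_edgeCochain (hb j), map_sub, _root_.map_add, _root_.map_add]
    congr 1
    exact (PTensor.map_const _ _).symm
  have hlim : Tendsto (fun j => cochainLength ν (Q j) (L.constCurvature (Q j) -
      E.coboundary ((Q j).Coeff A) 1 (edgeCochain (b j)))) 𝒰 (𝓝 0) := by
    unfold cochainLength
    rw [← Finset.sum_const_zero (s := (Finset.univ : Finset (E.Cell 2)))]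
    refine tendsto_finsetSum _ fun x _ => ?_
    simp only [hrN]
    rw [← zero_mul (ν.weight x)]
    exact (MeasuredBoolAlg.tendsto_coeffMeasure 𝒰 Q (hN _)).mul_const _
  obtain ⟨j, hj⟩ := (hlim.eventually_lt_const hε0).exists
  have : Finite (Q j).carrier := hQ j
  exact L.residuallyFinite_of_cochainLength_lt hcentral hε (Q j)
    (edgeCochain_mem_cochains (hb j) (hb' j)) hj

end FiniteClassifyingSpace

/-! ### The filter of sets of asymptotic density one -/

section Density

open Classical in
/-- The filter of the subsets of a sequence of finite sets whose density tends to one. -/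
noncomputable def densityFilter (k : ℕ → ℕ) : Filter (Σ n, Fin (k n)) where
  sets := {S | Tendsto (fun n => (({x | ⟨n, x⟩ ∉ S} : Finset (Fin (k n))).card : ℝ) / k n)
    atTop (𝓝 0)}
  univ_sets := by simp
  sets_of_superset {S T} hS hST := by
    refine squeeze_zero (fun n => by positivity) (fun n => ?_) hS
    gcongr
  inter_sets {S T} hS hT := by
    refine squeeze_zero (fun n => by positivity) (fun n => ?_)
      (by simpa using Tendsto.add (show Tendsto _ _ _ from hS) (show Tendsto _ _ _ from hT))
    rw [← add_div]
    gcongr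
    rw [← Nat.cast_add, Nat.cast_le]
    refine le_trans (Finset.card_le_card fun x hx => ?_) (Finset.card_union_le _ _)
    simp only [Set.mem_inter_iff, not_and_or, Finset.mem_filter, Finset.mem_univ, true_and,
      Finset.mem_union] at hx ⊢
    exact hx

variable {k : ℕ → ℕ}

open Classical in
theorem eventually_density {p : (Σ n, Fin (k n)) → Prop} :
    (∀ᶠ z in densityFilter k, p z) ↔
      Tendsto (fun n => (({x | ¬ p ⟨n, x⟩} : Finset (Fin (k n))).card : ℝ) / k n) atTop (𝓝 0) :=
  Iff.rfl

/-- Permutations preserve density. This is the change of variables behind all later manipulations of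
approximate identities. -/
theorem eventually_density_perm (σ : ∀ n, Equiv.Perm (Fin (k n))) {p : (Σ n, Fin (k n)) → Prop} :
    (∀ᶠ z in densityFilter k, p ⟨z.1, σ z.1 z.2⟩) ↔ ∀ᶠ z in densityFilter k, p z := by
  classical
  rw [eventually_density, eventually_density]
  refine iff_of_eq ?_
  congr 1
  ext n
  congr 2
  refine Finset.card_bijective (σ n) (σ n).bijective fun x => ?_
  simp

theorem eventually_density_fixed {σ : ∀ n, Equiv.Perm (Fin (k n))} :
    (∀ᶠ z in densityFilter k, σ z.1 z.2 = z.2) ↔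
      Tendsto (fun n => hammingLength (σ n)) atTop (𝓝 0) := by
  classical
  rw [eventually_density]
  refine iff_of_eq ?_
  congr 1
  ext n
  unfold hammingLength
  congr 2
  refine congrArg _ ?_
  ext x
  simp

theorem eventually_density_moved (hk : ∀ n, 0 < k n) {σ : ∀ n, Equiv.Perm (Fin (k n))} :
    (∀ᶠ z in densityFilter k, σ z.1 z.2 ≠ z.2) ↔
      Tendsto (fun n => hammingLength (σ n)) atTop (𝓝 1) := by
  classical
  rw [eventually_density]
  have h : ∀ n, (({x | ¬ σ n x ≠ x} : Finset (Fin (k n))).card : ℝ) / k n =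
      1 - hammingLength (σ n) := fun n => by
    have h1 : ({x | ¬ σ n x ≠ x} : Finset (Fin (k n))) = (σ n).supportᶜ := by
      ext x
      simp
    have h2 : (k n : ℝ) ≠ 0 := by exact_mod_cast (hk n).ne'
    have h3 := (σ n).support.card_compl_add_card
    rw [Fintype.card_fin] at h3
    have h4 : (((σ n).supportᶜ).card : ℝ) + (σ n).support.card = k n := by exact_mod_cast h3
    rw [h1, hammingLength, eq_sub_iff_add_eq, ← add_div, h4, div_self h2]
  simp only [h]
  constructor
  · intro h
    simpa using (tendsto_const_nhds (x := (1 : ℝ))).sub h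
  · intro h
    simpa using (tendsto_const_nhds (x := (1 : ℝ))).sub h

/-- Density one is inherited by sequences of subsets of density bounded away from zero. -/
theorem eventually_density_comap {k' : ℕ → ℕ} {t : ∀ n, Fin (k' n) → Fin (k n)}
    (ht : ∀ n, Function.Injective (t n)) {C : ℕ} (hC : ∀ᶠ n in atTop, k n ≤ C * k' n)
    {p : (Σ n, Fin (k n)) → Prop} (h : ∀ᶠ z in densityFilter k, p z) :
    ∀ᶠ z in densityFilter k', p ⟨z.1, t z.1 z.2⟩ := by
  classical
  rw [eventually_density] at h ⊢
  have h' := h.const_mul (C : ℝ)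
  rw [mul_zero] at h'
  refine squeeze_zero' (Eventually.of_forall fun n => by positivity) ?_ h'
  filter_upwards [hC] with n hn
  have h1 : ({x | ¬ p ⟨n, t n x⟩} : Finset (Fin (k' n))).card ≤
      ({x | ¬ p ⟨n, x⟩} : Finset (Fin (k n))).card :=
    Finset.card_le_card_of_injOn (t n) (fun x hx => by simpa using hx) (ht n).injOn
  rcases Nat.eq_zero_or_pos (k' n) with h0 | h0
  · simp only [h0, Nat.cast_zero, div_zero]
    positivity
  have h0' : (0 : ℝ) < k' n := by exact_mod_cast h0
  rcases Nat.eq_zero_or_pos (k n) with h2 | h2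
  · have : ({x | ¬ p ⟨n, x⟩} : Finset (Fin (k n))).card = 0 := by
      refine Nat.le_zero.mp ((Finset.card_le_univ _).trans ?_)
      rw [Fintype.card_fin, h2]
    rw [this, Nat.le_zero] at h1
    rw [h1]
    simp
    positivity
  have h2' : (0 : ℝ) < k n := by exact_mod_cast h2
  have hn' : (k n : ℝ) ≤ C * k' n := by exact_mod_cast hn
  have h1' : (({x | ¬ p ⟨n, t n x⟩} : Finset (Fin (k' n))).card : ℝ) ≤
      ({x | ¬ p ⟨n, x⟩} : Finset (Fin (k n))).card := by exact_mod_cast h1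
  rw [div_le_iff₀ h0', mul_div_assoc', div_mul_eq_mul_div, le_div_iff₀ h2']
  calc _ ≤ (({x | ¬ p ⟨n, x⟩} : Finset (Fin (k n))).card : ℝ) * (C * k' n) := by gcongr
    _ = _ := by ring

end Density

/-! ### Sofic approximations -/

/-- A sofic approximation of a group by a sequence of maps to symmetric groups. -/
structure SoficApproximation (G : Type u) [Group G] where
  k : ℕ → ℕ
  k_pos : ∀ n, 0 < k n
  φ : ∀ n, G → Equiv.Perm (Fin (k n))
  tendsto_mul : ∀ g h,
    Tendsto (fun n => hammingLength (φ n (g * h) * (φ n g * φ n h)⁻¹)) atTop (𝓝 0)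
  tendsto_free : ∀ g ≠ 1, Tendsto (fun n => hammingLength (φ n g)) atTop (𝓝 1)

theorem hammingLength_le_one {k : ℕ} (σ : Equiv.Perm (Fin k)) : hammingLength σ ≤ 1 := by
  refine div_le_one_of_le₀ ?_ (by positivity)
  exact_mod_cast (Finset.card_le_univ _).trans (Fintype.card_fin k).le

/-- A countable group is exhausted by finite sets; the `n`-th one is used with tolerance `1 / (n +
1)`. -/
theorem IsSofic.nonempty_approximation {G : Type u} [Group G] [Countable G] (hG : IsSofic G) :
    Nonempty (SoficApproximation G) := by
  classical
  obtain ⟨e, he⟩ := exists_surjective_nat G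
  have hpos : ∀ n : ℕ, (0 : ℝ) < 1 / ((n : ℝ) + 1) := fun _ => Nat.one_div_pos_of_nat
  choose k hk φ h1 h2 using fun n : ℕ =>
    hG ((Finset.range (n + 1)).image e) (1 / ((n : ℝ) + 1)) (hpos n)
  have hmem : ∀ g : G, ∀ᶠ n in atTop, g ∈ (Finset.range (n + 1)).image e := fun g => by
    obtain ⟨m, rfl⟩ := he g
    filter_upwards [eventually_ge_atTop m] with n hn
    exact Finset.mem_image_of_mem e (Finset.mem_range.mpr (Nat.lt_succ_of_le hn))
  refine ⟨⟨k, hk, φ, fun g h => ?_, fun g hg => ?_⟩⟩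
  · refine squeeze_zero' (Eventually.of_forall fun n => SoficRepresentation.hammingLength_nonneg _)
      ?_ tendsto_one_div_add_atTop_nhds_zero_nat
    filter_upwards [hmem g, hmem h] with n hg hh
    exact (h1 n g hg h hh).le
  · have h3 : Tendsto (fun n : ℕ => 1 - 1 / ((n : ℝ) + 1)) atTop (𝓝 1) := by
      simpa using tendsto_one_div_add_atTop_nhds_zero_nat.const_sub (1 : ℝ)
    refine tendsto_of_tendsto_of_tendsto_of_le_of_le' h3 tendsto_const_nhds ?_
      (Eventually.of_forall fun n => hammingLength_le_one _)
    filter_upwards [hmem g] with n hn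
    exact (h2 n g hn hg).le

namespace SoficApproximation

variable {G : Type u} [Group G] (Φ : SoficApproximation G)

/-- Omission of the first terms. -/
def shift (N : ℕ) : SoficApproximation G where
  k n := Φ.k (n + N)
  k_pos _ := Φ.k_pos _
  φ n := Φ.φ (n + N)
  tendsto_mul g h := (tendsto_add_atTop_iff_nat N).mpr (Φ.tendsto_mul g h)
  tendsto_free g hg := (tendsto_add_atTop_iff_nat N).mpr (Φ.tendsto_free g hg)

theorem eventually_mul (g h : G) : ∀ᶠ z in densityFilter Φ.k,
    Φ.φ z.1 (g * h) z.2 = Φ.φ z.1 g (Φ.φ z.1 h z.2) := by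
  have h1 := (eventually_density_fixed (σ := fun n => Φ.φ n (g * h) * (Φ.φ n g * Φ.φ n h)⁻¹)).mpr
    (Φ.tendsto_mul g h)
  have h2 := (eventually_density_perm fun n => Φ.φ n g * Φ.φ n h).mpr h1
  filter_upwards [h2] with z hz
  have h3 : (Φ.φ z.1 (g * h) * (Φ.φ z.1 g * Φ.φ z.1 h)⁻¹ * (Φ.φ z.1 g * Φ.φ z.1 h)) z.2 =
    (Φ.φ z.1 g * Φ.φ z.1 h) z.2 := hz
  rwa [inv_mul_cancel_right] at h3

theorem eventually_free {g : G} (hg : g ≠ 1) : ∀ᶠ z in densityFilter Φ.k, Φ.φ z.1 g z.2 ≠ z.2 :=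
  (eventually_density_moved Φ.k_pos (σ := fun n => Φ.φ n g)).mpr (Φ.tendsto_free g hg)

end SoficApproximation

/-! ### Transversals of approximate free actions -/

section Transversal

variable {A : Type v} [AddCommGroup A] {X : Type u} (α : A → Equiv.Perm X)

/-- The points at which an almost action is a free action. -/
def FreePoint (x : X) : Prop := (∀ a b, α (a + b) x = α a (α b x)) ∧ ∀ a, a ≠ 0 → α a x ≠ x

variable {α}

theorem FreePoint.zero {x : X} (h : FreePoint α x) : α 0 x = x := by
  have := h.1 0 0
  rw [add_zero] at this
  exact ((α 0).injective this).symm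

theorem FreePoint.injective {x : X} (h : FreePoint α x) {a b : A} (e : α a x = α b x) : a = b := by
  by_contra hne
  refine h.2 (a - b) (sub_ne_zero.mpr hne) ?_
  have h1 := congrArg (α (-b)) e
  rw [← h.1, ← h.1] at h1
  rw [sub_eq_add_neg, add_comm, h1, neg_add_cancel, h.zero]

variable (α) in
/-- A transversal of the free part of an almost action. -/
structure FreeTransversal where
  k : ℕ
  t : Fin k → X
  free : ∀ y, FreePoint α (t y)
  exists_eq : ∀ x, FreePoint α x → ∃ a y, α a (t y) = x
  eq_of_eq : ∀ {a b y y'}, α a (t y) = α b (t y') → a = b ∧ y = y'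

-- The orbit of a free point may contain points that are not free, so orbits are formed among free
-- points only. The action law at the starting point then yields symmetry and transitivity.
variable (α) in
theorem nonempty_freeTransversal [Finite X] : Nonempty (FreeTransversal α) := by
  classical
  let S : Setoid {x // FreePoint α x} :=
    { r := fun x y => ∃ a, α a x = y.1
      iseqv :=
        { refl := fun x => ⟨0, x.2.zero⟩
          symm := by
            rintro x y ⟨a, h⟩
            exact ⟨-a, by rw [← h, ← x.2.1, neg_add_cancel, x.2.zero]⟩
          trans := by
            rintro x y z ⟨a, h⟩ ⟨b, h'⟩
            exact ⟨b + a, by rw [x.2.1, h, h']⟩ } }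
  have : Finite (Quotient S) := inferInstance
  let e : Quotient S ≃ Fin (Nat.card (Quotient S)) := Finite.equivFin _
  refine ⟨⟨Nat.card (Quotient S), fun y => (e.symm y).out.1, fun y => (e.symm y).out.2,
    fun x hx => ?_, fun h => ?_⟩⟩
  · obtain ⟨a, ha⟩ : S.r (Quotient.mk S ⟨x, hx⟩).out ⟨x, hx⟩ := Quotient.mk_out (s := S) ⟨x, hx⟩
    exact ⟨a, e (Quotient.mk S ⟨x, hx⟩), by rw [e.symm_apply_apply]; exact ha⟩
  · rename_i a b y y'
    have h1 := congrArg (α (-b)) h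
    rw [← (e.symm y).out.2.1, ← (e.symm y').out.2.1, neg_add_cancel, (e.symm y').out.2.zero] at h1
    have h2 : Quotient.mk S (e.symm y).out = Quotient.mk S (e.symm y').out :=
      Quotient.sound ⟨-b + a, h1⟩
    rw [Quotient.out_eq, Quotient.out_eq] at h2
    have h3 : y = y' := e.symm.injective h2
    subst h3
    exact ⟨(e.symm y).out.2.injective h, rfl⟩

namespace FreeTransversal

variable (T : FreeTransversal α)

theorem t_injective : Function.Injective T.t := fun _ _ h =>
  (T.eq_of_eq (a := 0) (b := 0) (congrArg (α 0) h)).2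

-- The translates of the transversal cover the free points, so it is not too sparse for density
-- arguments.
open Classical in
theorem card_le [Fintype A] [Fintype X] [DecidablePred (FreePoint α)] :
    ({x | FreePoint α x} : Finset X).card ≤ Fintype.card A * T.k := by
  have h : ({x | FreePoint α x} : Finset X) ⊆
      (Finset.univ : Finset (A × Fin T.k)).image fun p => α p.1 (T.t p.2) := fun x hx => by
    obtain ⟨a, y, h⟩ := T.exists_eq x (Finset.mem_filter.mp hx).2
    exact Finset.mem_image.mpr ⟨(a, y), Finset.mem_univ _, h⟩
  refine (Finset.card_le_card h).trans (Finset.card_image_le.trans ?_)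
  simp

/-- The points of the transversal at which a permutation is compatible with the almost action. -/
def Compatible (τ : Equiv.Perm X) (y : Fin T.k) : Prop :=
  FreePoint α (τ (T.t y)) ∧ ∀ a, τ (α a (T.t y)) = α a (τ (T.t y))

/-- At a compatible point `τ` reaches a translate of a unique transversal point, which defines a
partial injection. It extends to a permutation by finiteness, with arbitrary values elsewhere. -/
theorem exists_perm (τ : Equiv.Perm X) : ∃ (σ : Equiv.Perm (Fin T.k)) (β : Fin T.k → A),
    ∀ y, T.Compatible τ y → τ (T.t y) = α (β (σ y)) (T.t (σ y)) := by
  classical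
  have h : ∀ y : {y // T.Compatible τ y}, ∃ y' a, α a (T.t y') = τ (T.t y) := fun y => by
    obtain ⟨a, y', h⟩ := T.exists_eq _ y.2.1
    exact ⟨y', a, h⟩
  choose f a hf using h
  have hinj : Function.Injective f := fun y₁ y₂ e => by
    have h1 := hf y₁
    have h2 := hf y₂
    rw [← e] at h2
    have h3 : α (a y₂ - a y₁) (τ (T.t y₁)) = τ (T.t y₂) := by
      rw [← h1, ← (T.free _).1, sub_add_cancel, h2]
    rw [← y₁.2.2] at h3
    have h4 : α (a y₂ - a y₁) (T.t y₁) = α 0 (T.t y₂) := by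
      rw [(T.free _).zero]
      exact τ.injective h3
    exact Subtype.ext (T.eq_of_eq h4).2
  let e : {y // T.Compatible τ y} ≃ {y // y ∈ Set.range f} := Equiv.ofInjective f hinj
  let σ := e.extendSubtype
  have hσ : ∀ y (hy : T.Compatible τ y), σ y = f ⟨y, hy⟩ := fun y hy =>
    e.extendSubtype_apply_of_mem y hy
  -- The displacement is indexed by the image point, so that the cocycle rule takes the form of a
  -- left crossed homomorphism. The default `0` is never seen at compatible points.
  refine ⟨σ, fun y' => if h : T.Compatible τ (σ.symm y') then a ⟨_, h⟩ else 0, fun y hy => ?_⟩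
  have h1 : T.Compatible τ (σ.symm (σ y)) := by rwa [σ.symm_apply_apply]
  beta_reduce
  rw [dif_pos h1]
  simp only [σ.symm_apply_apply]
  exact (hf ⟨y, hy⟩).symm.trans (congrArg (fun w => α (a ⟨y, hy⟩) (T.t w)) (hσ y hy).symm)

end FreeTransversal

end Transversal

/-! ### Approximations of the quotient in a group extension -/

section Quotient

variable {Γ : Type u} [Group Γ] {A : Type v} [AddCommGroup A] {G : Type w} [Group G]

/-- A sofic approximation of the quotient in a group extension, together with an approximate
trivialization of the pullback of the extension. -/
structure QuotientApproximation (ext : GroupExtension (Multiplicative A) G Γ) where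
  k : ℕ → ℕ
  k_pos : ∀ n, 0 < k n
  σ : ∀ n, G → Equiv.Perm (Fin (k n))
  β : ∀ n, G → Fin (k n) → A
  mul : ∀ g h, ∀ᶠ z in densityFilter k, σ z.1 (g * h) z.2 = σ z.1 g (σ z.1 h z.2) ∧
    β z.1 (g * h) (σ z.1 g (σ z.1 h z.2)) = β z.1 g (σ z.1 g (σ z.1 h z.2)) + β z.1 h (σ z.1 h z.2)
  inl : ∀ a : A, ∀ᶠ z in densityFilter k, σ z.1 (ext.inl (Multiplicative.ofAdd a)) z.2 = z.2 ∧
    β z.1 (ext.inl (Multiplicative.ofAdd a)) z.2 = a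
  free : ∀ g, ext.rightHom g ≠ 1 → ∀ᶠ z in densityFilter k, σ z.1 g z.2 ≠ z.2

variable {ext : GroupExtension (Multiplicative A) G Γ}

namespace SoficApproximation

variable (ext) in
/-- The almost action of the kernel of a group extension. -/
def kernelAction (Φ : SoficApproximation G) (n : ℕ) (a : A) : Equiv.Perm (Fin (Φ.k n)) :=
  Φ.φ n (ext.inl (Multiplicative.ofAdd a))

theorem eventually_freePoint [Finite A] (Φ : SoficApproximation G) :
    ∀ᶠ z in densityFilter Φ.k, FreePoint (Φ.kernelAction ext z.1) z.2 := by
  have h1 : ∀ᶠ z in densityFilter Φ.k, ∀ a b, Φ.kernelAction ext z.1 (a + b) z.2 =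
      Φ.kernelAction ext z.1 a (Φ.kernelAction ext z.1 b z.2) := by
    refine eventually_all.mpr fun a => eventually_all.mpr fun b => ?_
    filter_upwards [Φ.eventually_mul (ext.inl (Multiplicative.ofAdd a))
      (ext.inl (Multiplicative.ofAdd b))] with z hz
    rw [← map_mul, ← ofAdd_add] at hz
    exact hz
  have h2 : ∀ᶠ z in densityFilter Φ.k, ∀ a, a ≠ 0 → Φ.kernelAction ext z.1 a z.2 ≠ z.2 := by
    refine eventually_all.mpr fun a => ?_
    by_cases ha : a = 0
    · exact Eventually.of_forall fun z h => absurd ha h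
    · have hne : ext.inl (Multiplicative.ofAdd a) ≠ 1 := fun h =>
        ha (Multiplicative.ofAdd.injective (ext.inl_injective (h.trans (map_one _).symm)))
      filter_upwards [Φ.eventually_free hne] with z hz _ using hz
  filter_upwards [h1, h2] with z hz hz' using ⟨hz, hz'⟩

-- Dropping initial terms makes at least half of the points free at every stage, so the transversals
-- are nonempty and of comparable size.
open Classical in
theorem exists_shift [Finite A] (Φ : SoficApproximation G) : ∃ Ψ : SoficApproximation G, ∀ n,
    Ψ.k n ≤ 2 * ({x | FreePoint (Ψ.kernelAction ext n) x} : Finset (Fin (Ψ.k n))).card := by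
  have h := eventually_density.mp (Φ.eventually_freePoint (ext := ext))
  obtain ⟨N, hN⟩ := eventually_atTop.mp (h.eventually_lt_const (show (0 : ℝ) < 1 / 2 by norm_num))
  refine ⟨Φ.shift N, fun n => ?_⟩
  have h1 := hN (n + N) (Nat.le_add_left N n)
  have hk : (0 : ℝ) < Φ.k (n + N) := by exact_mod_cast Φ.k_pos (n + N)
  rw [div_lt_iff₀ hk] at h1
  have h2 := Finset.card_filter_add_card_filter_not (s := Finset.univ)
    (fun x : Fin (Φ.k (n + N)) => FreePoint (Φ.kernelAction ext (n + N)) x)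
  rw [Finset.card_univ, Fintype.card_fin] at h2
  have h3 : 2 * ({x | ¬ FreePoint (Φ.kernelAction ext (n + N)) x} :
      Finset (Fin (Φ.k (n + N)))).card < Φ.k (n + N) := by
    have : (2 : ℝ) * ({x | ¬ FreePoint (Φ.kernelAction ext (n + N)) x} :
      Finset (Fin (Φ.k (n + N)))).card < Φ.k (n + N) := by linarith
    exact_mod_cast this
  change Φ.k (n + N) ≤ 2 * ({x | FreePoint (Φ.kernelAction ext (n + N)) x} :
      Finset (Fin (Φ.k (n + N)))).card
  omega

/-- Centrality makes `φ g` commute with the kernel at almost all points, so it permutes the kernel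
orbits up to a negligible set. The permutation of the transversal is `σ g`, and the displacement
inside the orbits is `β g`. -/
theorem nonempty_quotientApproximation [Finite A] (Φ : SoficApproximation G)
    (hcentral : ext.inl.range ≤ Subgroup.center G) : Nonempty (QuotientApproximation ext) := by
  classical
  have := Fintype.ofFinite A
  obtain ⟨Φ, hΦ⟩ := Φ.exists_shift (ext := ext)
  let α := Φ.kernelAction ext
  let T : ∀ n, FreeTransversal (α n) := fun n => (nonempty_freeTransversal (α n)).some
  let k : ℕ → ℕ := fun n => (T n).k
  let t : ∀ n, Fin (k n) → Fin (Φ.k n) := fun n => (T n).t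
  have hle : ∀ n, Φ.k n ≤ 2 * Fintype.card A * k n := fun n => by
    have h1 := hΦ n
    have h2 := (T n).card_le
    calc Φ.k n ≤ _ := h1
      _ ≤ 2 * (Fintype.card A * k n) := Nat.mul_le_mul_left 2 (by convert h2)
      _ = _ := by ring
  have hpos : ∀ n, 0 < k n := fun n => by
    by_contra h
    have h0 : k n = 0 := by omega
    have h1 := hle n
    rw [h0, mul_zero] at h1
    exact absurd (Φ.k_pos n) (by omega)
  -- The transversal has at least the proportion `1 / (2 |A|)` of the points, so density one passes
  -- to it.
  have pull : ∀ {p : (Σ n, Fin (Φ.k n)) → Prop}, (∀ᶠ z in densityFilter Φ.k, p z) →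
      ∀ᶠ z in densityFilter k, p ⟨z.1, t z.1 z.2⟩ := fun h =>
    eventually_density_comap (fun n => (T n).t_injective) (Eventually.of_forall hle) h
  choose σ β hσβ using fun n g => (T n).exists_perm (Φ.φ n g)
  have hcompat : ∀ g, ∀ᶠ z in densityFilter k, (T z.1).Compatible (Φ.φ z.1 g) z.2 := fun g => by
    have h1 := pull ((eventually_density_perm fun n => Φ.φ n g).mpr
      (Φ.eventually_freePoint (ext := ext)))
    have h2 : ∀ᶠ z in densityFilter Φ.k, ∀ a, Φ.φ z.1 g (α z.1 a z.2) = α z.1 a (Φ.φ z.1 g z.2) := by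
      refine eventually_all.mpr fun a => ?_
      have hc : ext.inl (Multiplicative.ofAdd a) * g = g * ext.inl (Multiplicative.ofAdd a) :=
        (Subgroup.mem_center_iff.mp (hcentral ⟨_, rfl⟩) g).symm
      filter_upwards [Φ.eventually_mul g (ext.inl (Multiplicative.ofAdd a)),
        Φ.eventually_mul (ext.inl (Multiplicative.ofAdd a)) g] with z hz hz'
      rw [hc] at hz'
      exact hz.symm.trans hz'
    filter_upwards [h1, pull h2] with z hz hz' using ⟨hz, hz'⟩
  have hφ : ∀ g, ∀ᶠ z in densityFilter k, Φ.φ z.1 g (t z.1 z.2) =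
      α z.1 (β z.1 g (σ z.1 g z.2)) (t z.1 (σ z.1 g z.2)) := fun g => by
    filter_upwards [hcompat g] with z hz using hσβ z.1 g z.2 hz
  refine ⟨⟨k, hpos, σ, β, fun g h => ?_, fun a => ?_, fun g hg => ?_⟩⟩
  · have push : ∀ {p : (Σ n, Fin (k n)) → Prop}, (∀ᶠ z in densityFilter k, p z) →
        ∀ᶠ z in densityFilter k, p ⟨z.1, σ z.1 h z.2⟩ := fun H =>
      (eventually_density_perm fun n => σ n h).mpr H
    filter_upwards [hφ (g * h), hφ h, push (hφ g), push (hcompat g),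
      pull (Φ.eventually_mul g h)] with z h1 h2 h3 h4 h5
    -- Moving a transversal point by `g * h` at once or in two steps gives two normal forms; their
    -- uniqueness yields the rules for `σ` and `β` together.
    have h6 : Φ.φ z.1 (g * h) (t z.1 z.2) =
        α z.1 (β z.1 h (σ z.1 h z.2) + β z.1 g (σ z.1 g (σ z.1 h z.2)))
          (t z.1 (σ z.1 g (σ z.1 h z.2))) := by
      refine h5.trans ?_
      change Φ.φ z.1 g (Φ.φ z.1 h (t z.1 z.2)) = _
      rw [h2, ((T z.1).free _).1]
      refine (h4.2 _).trans ?_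
      exact congrArg _ h3
    obtain ⟨h7, h8⟩ := (T z.1).eq_of_eq (h1.symm.trans h6)
    refine ⟨h8, ?_⟩
    rw [h8] at h7
    rw [h7, add_comm]
  · have h1 : ∀ᶠ z in densityFilter k, σ z.1 (ext.inl (Multiplicative.ofAdd a)) z.2 = z.2 ∧
        β z.1 (ext.inl (Multiplicative.ofAdd a))
          (σ z.1 (ext.inl (Multiplicative.ofAdd a)) z.2) = a := by
      filter_upwards [hφ (ext.inl (Multiplicative.ofAdd a))] with z hz
      obtain ⟨h1, h2⟩ := (T z.1).eq_of_eq (show α z.1 a (t z.1 z.2) = _ from hz)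
      exact ⟨h2.symm, h1.symm⟩
    filter_upwards [h1] with z hz
    refine ⟨hz.1, ?_⟩
    have h2 := hz.2
    rwa [hz.1] at h2
  -- If `g` is nontrivial in `Γ`, no kernel translate of it is trivial in `G`. So almost surely `g`
  -- moves a point out of its kernel orbit, and `σ g` moves the orbit.
  · have h1 : ∀ᶠ z in densityFilter Φ.k, ∀ a : A, Φ.φ z.1 g z.2 ≠ α z.1 a z.2 := by
      refine eventually_all.mpr fun a => ?_
      have hne : ext.inl (Multiplicative.ofAdd (-a)) * g ≠ 1 := fun h => hg (by
        have h2 := congrArg ext.rightHom h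
        have h3 : ext.rightHom (ext.inl (Multiplicative.ofAdd (-a))) = 1 := by
          rw [← MonoidHom.mem_ker, ← ext.range_inl_eq_ker_rightHom]; exact ⟨_, rfl⟩
        rwa [map_mul, h3, one_mul, map_one] at h2)
      filter_upwards [Φ.eventually_free hne, Φ.eventually_freePoint (ext := ext),
        Φ.eventually_mul (ext.inl (Multiplicative.ofAdd (-a))) g] with z h2 h3 h4 h5
      refine h2 (h4.trans ?_)
      rw [h5]
      change α z.1 (-a) (α z.1 a z.2) = z.2
      rw [← h3.1, neg_add_cancel, h3.zero]
    filter_upwards [pull h1, hφ g] with z h2 h3 h4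
    rw [h4] at h3
    exact h2 _ h3

end SoficApproximation

/-! ### The sofic representation of `Γ` and its crossed relation -/

namespace QuotientApproximation

variable (Ψ : QuotientApproximation ext) (S : FinitePresentation Γ)

/-- A lift of the presentation to the group extension. -/
noncomputable def wordLift (ext : GroupExtension (Multiplicative A) G Γ) (S : FinitePresentation Γ) :
    FreeGroup (Fin S.rank) →* G :=
  FreeGroup.lift fun i => Function.surjInv ext.rightHom_surjective (S.π (FreeGroup.of i))

theorem rightHom_wordLift (w : FreeGroup (Fin S.rank)) : ext.rightHom (wordLift ext S w) = S.π w := by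
  have : ext.rightHom.comp (wordLift ext S) = S.π := FreeGroup.ext_hom _ _ fun i => by
    simp [wordLift, Function.surjInv_eq]
  exact DFunLike.congr_fun this w

/-- The actions of the free group given by a quotient approximation. -/
noncomputable def freeAction (n : ℕ) : FreeGroup (Fin S.rank) →* Equiv.Perm (Fin (Ψ.k n)) :=
  FreeGroup.lift fun i => Ψ.σ n (wordLift ext S (FreeGroup.of i))

theorem eventually_one : ∀ᶠ z in densityFilter Ψ.k, Ψ.σ z.1 1 z.2 = z.2 := by
  have h := Ψ.inl 0
  rw [ofAdd_zero, map_one] at h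
  filter_upwards [h] with z hz using hz.1

theorem eventually_freeAction_wordLift (w : FreeGroup (Fin S.rank)) : ∀ᶠ z in densityFilter Ψ.k,
    Ψ.freeAction S z.1 w z.2 = Ψ.σ z.1 (wordLift ext S w) z.2 := by
  induction w using FreeGroup.induction_on with
  | C1 =>
    filter_upwards [Ψ.eventually_one] with z hz
    rw [map_one, map_one, hz]
    rfl
  | of i =>
    refine Eventually.of_forall fun z => ?_
    rw [freeAction, FreeGroup.lift_apply_of]
  | inv_of i ih =>
    have h1 := (eventually_density_perm fun n => Ψ.σ n (wordLift ext S (FreeGroup.of i)⁻¹)).mpr ih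
    filter_upwards [h1, Ψ.mul (wordLift ext S (FreeGroup.of i)) (wordLift ext S (FreeGroup.of i)⁻¹),
      Ψ.eventually_one] with z hz h2 h3
    have h4 := h2.1
    rw [← map_mul, mul_inv_cancel, map_one, h3] at h4
    rw [map_inv, Equiv.Perm.inv_eq_iff_eq]
    exact h4.trans hz.symm
  | mul v w hv hw =>
    have h1 := (eventually_density_perm fun n => Ψ.σ n (wordLift ext S w)).mpr hv
    filter_upwards [h1, hw, Ψ.mul (wordLift ext S v) (wordLift ext S w)] with z h1 h2 h3
    rw [map_mul, map_mul, h3.1, Equiv.Perm.mul_apply, h2]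
    exact h1

/-- The lift of `w` differs from `g` by an element of the kernel, which `σ` almost fixes. So `σ g`
depends only on the image of `g` in `Γ`. -/
theorem eventually_freeAction {w : FreeGroup (Fin S.rank)} {g : G} (h : S.π w = ext.rightHom g) :
    ∀ᶠ z in densityFilter Ψ.k, Ψ.freeAction S z.1 w z.2 = Ψ.σ z.1 g z.2 := by
  obtain ⟨a, ha⟩ : (wordLift ext S w)⁻¹ * g ∈ ext.inl.range := by
    rw [ext.range_inl_eq_ker_rightHom, MonoidHom.mem_ker, map_mul, map_inv, rightHom_wordLift, h,
      inv_mul_cancel]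
  filter_upwards [Ψ.eventually_freeAction_wordLift S w, Ψ.inl a.toAdd,
    Ψ.mul (wordLift ext S w) (ext.inl a)] with z h1 h2 h3
  rw [ofAdd_toAdd] at h2
  rw [h1, ← mul_inv_cancel_left (wordLift ext S w) g, ← ha, h3.1, h2.1]

/-- The sofic representation given by a quotient approximation. -/
noncomputable def soficRepresentation : SoficRepresentation S where
  k := Ψ.k
  k_pos := Ψ.k_pos
  σ := Ψ.freeAction S
  tendsto_relators r hr := by
    have h0 : S.π r = 1 := by
      have : r ∈ S.π.ker := by
        rw [← S.normalClosure_relators]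
        exact Subgroup.subset_normalClosure hr
      exact this
    refine eventually_density_fixed.mp ?_
    filter_upwards [Ψ.eventually_freeAction S (h0.trans (map_one _).symm), Ψ.eventually_one]
      with z h1 h2
    rw [h1, h2]
  tendsto_not_mem_ker w hw := by
    refine (eventually_density_moved Ψ.k_pos).mp ?_
    filter_upwards [Ψ.eventually_freeAction_wordLift S w, Ψ.free (wordLift ext S w) (by
      rw [rightHom_wordLift]; exact hw)] with z h1 h2
    rwa [h1]

theorem eventually_crossed {w : FreeGroup (Fin S.rank)} {g : G} (hw : S.π w = ext.rightHom g)
    (h : G) : ∀ᶠ z in densityFilter Ψ.k, Ψ.β z.1 (g * h) (Ψ.freeAction S z.1 w z.2) =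
      Ψ.β z.1 g (Ψ.freeAction S z.1 w z.2) + Ψ.β z.1 h z.2 := by
  rw [← eventually_density_perm fun n => Ψ.σ n h]
  filter_upwards [Ψ.mul g h, (eventually_density_perm fun n => Ψ.σ n h).mpr
    (Ψ.eventually_freeAction S hw)] with z h1 h2
  have h2 : Ψ.freeAction S z.1 w (Ψ.σ z.1 h z.2) = Ψ.σ z.1 g (Ψ.σ z.1 h z.2) := h2
  change Ψ.β z.1 (g * h) (Ψ.freeAction S z.1 w (Ψ.σ z.1 h z.2)) =
    Ψ.β z.1 g (Ψ.freeAction S z.1 w (Ψ.σ z.1 h z.2)) + _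
  rw [h2]
  exact h1.2

end QuotientApproximation

end Quotient

/-! ### The limit action of the quotient -/

section Limit

variable {Γ : Type u} [Group Γ] {A : Type v} [AddCommGroup A] {G : Type w} [Group G]
  {ext : GroupExtension (Multiplicative A) G Γ} (Ψ : QuotientApproximation ext)
  (S : FinitePresentation Γ)

namespace SoficRepresentation

variable {S}
variable (ρ : SoficRepresentation S)

/-- The element of the limit action given by a sequence of sets. -/
noncomputable def limitMk (𝒰 : Ultrafilter ℕ) (h𝒰 : (𝒰 : Filter ℕ) ≤ cofinite) (X : ∀ n, Set (Fin (ρ.k n))) :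
    (ρ.limitAction 𝒰 h𝒰).carrier :=
  MeasuredBoolAlg.UltraCarrier.mk 𝒰 ρ.level X

variable {ρ} {𝒰 : Ultrafilter ℕ} {h𝒰 : (𝒰 : Filter ℕ) ≤ cofinite}

theorem limitMk_inf (X Y : ∀ n, Set (Fin (ρ.k n))) :
    ρ.limitMk 𝒰 h𝒰 X ⊓ ρ.limitMk 𝒰 h𝒰 Y = ρ.limitMk 𝒰 h𝒰 fun n => X n ∩ Y n := rfl

theorem limitMk_smul (γ : Γ) (X : ∀ n, Set (Fin (ρ.k n))) :
    γ • ρ.limitMk 𝒰 h𝒰 X =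
      ρ.limitMk 𝒰 h𝒰 fun n => ρ.σ n (Function.surjInv S.surjective γ) '' X n := rfl

/-- The distance at stage `n` is the density of the points where the two sets disagree. -/
theorem limitMk_eq {X Y : ∀ n, Set (Fin (ρ.k n))}
    (h : ∀ᶠ z in densityFilter ρ.k, z.2 ∈ X z.1 ↔ z.2 ∈ Y z.1) :
    ρ.limitMk 𝒰 h𝒰 X = ρ.limitMk 𝒰 h𝒰 Y := by
  classical
  refine Quotient.sound ?_
  refine ((eventually_density.mp h).congr fun n => ?_).mono_left
    (h𝒰.trans Nat.cofinite_eq_atTop.le)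
  refine Eq.trans ?_ (MeasuredBoolAlg.dist_eq _ _ _).symm
  change _ = ((symmDiff (X n) (Y n) : Set (Fin (ρ.k n))).ncard : ℝ) /
    (Nat.card (Fin (ρ.k n)) : ℝ)
  rw [Nat.card_fin, ← Set.ncard_coe_finset]
  congr 3
  ext x
  simp only [Finset.coe_filter, Finset.mem_univ, true_and, Set.mem_ofPred_eq, Set.mem_symmDiff]
  tauto

theorem limitMk_mono {X Y : ∀ n, Set (Fin (ρ.k n))}
    (h : ∀ᶠ z in densityFilter ρ.k, z.2 ∈ X z.1 → z.2 ∈ Y z.1) :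
    ρ.limitMk 𝒰 h𝒰 X ≤ ρ.limitMk 𝒰 h𝒰 Y := by
  rw [← inf_eq_left, limitMk_inf]
  refine limitMk_eq ?_
  filter_upwards [h] with z hz using ⟨And.left, fun hx => ⟨hx, hz hx⟩⟩

variable [Fintype A]

/-- The element of the coefficient group of the limit action given by a sequence of functions. -/
noncomputable def limitFunction (𝒰 : Ultrafilter ℕ) (h𝒰 : (𝒰 : Filter ℕ) ≤ cofinite)
    (F : ∀ n, Fin (ρ.k n) → A) : (ρ.limitAction 𝒰 h𝒰).Coeff A where
  part a := ρ.limitMk 𝒰 h𝒰 fun n => {x | F n x = a}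
  disjoint a b hab := by
    rw [disjoint_iff, limitMk_inf]
    refine (limitMk_eq (Y := fun _ => ∅) (Eventually.of_forall fun z => ?_))
    simp only [Set.mem_inter_iff, Set.mem_ofPred_eq, Set.mem_empty_iff_false, iff_false, not_and]
    exact fun h h' => hab (h.symm.trans h')
  sup_eq_top := by
    let f : BoundedLatticeHom (∀ n, (ρ.level n).carrier) (ρ.limitAction 𝒰 h𝒰).carrier :=
      MeasuredBoolAlg.ultraMk 𝒰 ρ.level
    let Z : A → ∀ n, (ρ.level n).carrier := fun a n => ({x | F n x = a} : Set (Fin (ρ.k n)))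
    have h := map_finset_sup f Finset.univ Z
    refine h.symm.trans (Eq.trans (congrArg f ?_) (TopHomClass.map_top f))
    funext n
    rw [Finset.sup_apply]
    refine Set.ext (α := Fin (ρ.k n)) fun x => ⟨fun _ => trivial, fun _ => ?_⟩
    have h1 : ({y | F n y = F n x} : Set (Fin (ρ.k n))) ≤
      Finset.univ.sup fun a => ({y | F n y = a} : Set (Fin (ρ.k n))) :=
      Finset.le_sup (f := fun a => ({y | F n y = a} : Set (Fin (ρ.k n)))) (Finset.mem_univ (F n x))
    exact h1 rfl

end SoficRepresentation

variable [Fintype A]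

/-- The identity is tested on the pieces where `β g` has value `a` and the translate of `β h` has
value `b`; there it is the pointwise relation `eventually_crossed`. -/
theorem QuotientApproximation.limitFunction_crossed (𝒰 : Ultrafilter ℕ)
    (h𝒰 : (𝒰 : Filter ℕ) ≤ cofinite) (g h : G) :
    (SoficRepresentation.limitFunction (ρ := Ψ.soficRepresentation S) 𝒰 h𝒰
      fun n => Ψ.β n (g * h)) =
    SoficRepresentation.limitFunction 𝒰 h𝒰 (fun n => Ψ.β n g) +
      ext.rightHom g • SoficRepresentation.limitFunction 𝒰 h𝒰 fun n => Ψ.β n h := by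
  refine PTensor.ext_of_cover _ (PTensor.sup_prod
    (SoficRepresentation.limitFunction 𝒰 h𝒰 fun n => Ψ.β n g)
    (ext.rightHom g • SoficRepresentation.limitFunction 𝒰 h𝒰 fun n => Ψ.β n h)) ?_
  rintro ⟨a, b⟩
  refine ⟨a + b, ?_, PTensor.le_add inf_le_left inf_le_right⟩
  change SoficRepresentation.limitMk _ 𝒰 h𝒰 _ ⊓
    ext.rightHom g • SoficRepresentation.limitMk _ 𝒰 h𝒰 _ ≤ SoficRepresentation.limitMk _ 𝒰 h𝒰 _
  rw [SoficRepresentation.limitMk_smul, SoficRepresentation.limitMk_inf]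
  refine SoficRepresentation.limitMk_mono ?_
  have hw := Function.surjInv_eq S.surjective (ext.rightHom g)
  have h1 := Ψ.eventually_crossed S hw h
  -- The relation is rewritten at the image point `z.2`, since membership in a translated set is
  -- tested through a preimage `x`.
  have h2 : ∀ᶠ z in densityFilter Ψ.k, ∀ x, Ψ.freeAction S z.1
      (Function.surjInv S.surjective (ext.rightHom g)) x = z.2 →
      Ψ.β z.1 (g * h) z.2 = Ψ.β z.1 g z.2 + Ψ.β z.1 h x := by
    rw [← eventually_density_perm fun n => Ψ.freeAction S n
      (Function.surjInv S.surjective (ext.rightHom g))]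
    filter_upwards [h1] with z hz x hx
    rw [(Equiv.injective _ hx : x = z.2)]
    exact hz
  filter_upwards [h2] with z hz
  rintro ⟨hg, x, hx, hxz⟩
  exact (hz x hxz).trans (congrArg₂ _ hg hx)

theorem QuotientApproximation.limitFunction_inl (𝒰 : Ultrafilter ℕ)
    (h𝒰 : (𝒰 : Filter ℕ) ≤ cofinite) (a : A) :
    (SoficRepresentation.limitFunction (ρ := Ψ.soficRepresentation S) 𝒰 h𝒰
      fun n => Ψ.β n (ext.inl (Multiplicative.ofAdd a))) = PTensor.const _ a := by
  refine PTensor.ext_of_cover (fun _ : Unit =>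
    ((Ψ.soficRepresentation S).limitMk 𝒰 h𝒰 fun _ => Set.univ)) ?_ fun _ =>
      ⟨a, ?_, PTensor.le_const _ _⟩
  · rw [Finset.univ_unique, Finset.sup_singleton]
    rfl
  · refine SoficRepresentation.limitMk_mono ?_
    filter_upwards [Ψ.inl a] with z hz _ using hz.2

end Limit

end SoficStability

theorem mainTheorem1 {Γ : Type*} [Group Γ] [Countable Γ]
    {A : Type*} [AddCommGroup A] [Fintype A]
    (hres : Group.ResiduallyFinite Γ)
    (E : SoficStability.FiniteClassifyingSpace Γ) (ν : E.FaithfulWeights 2)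
    (hcosys : SoficStability.FiniteClassifyingSpace.CosystolicInequality ν A
      (SoficStability.MeasuredBoolAlg.finiteTransitiveActions.{_, 0} Γ))
    {G : Type*} [Group G] (ext : GroupExtension (Multiplicative A) G Γ)
    (hcentral : ext.inl.range ≤ Subgroup.center G)
    (hnotres : ¬ Group.ResiduallyFinite G)
    (hstable : SoficStability.IsStableInFiniteActions Γ) :
    ¬ SoficStability.IsSofic G := by
  intro hsofic
  refine hnotres ?_
  -- A finite kernel and a countable quotient make `G` countable, which allows a sequence of
  -- approximations.
  have hker : Finite ext.rightHom.ker := by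
    rw [← ext.range_inl_eq_ker_rightHom]
    exact Set.finite_range ext.inl
  have : Countable (G ⧸ ext.rightHom.ker) :=
    (QuotientGroup.quotientKerEquivOfSurjective _ ext.rightHom_surjective).toEquiv.countable_iff.mpr
      inferInstance
  have : Countable G := Countable.of_equiv _
    (Subgroup.groupEquivQuotientProdSubgroup (s := ext.rightHom.ker)).symm
  obtain ⟨Φ⟩ := hsofic.nonempty_approximation
  obtain ⟨Ψ⟩ := Φ.nonempty_quotientApproximation hcentral
  obtain ⟨S, hS⟩ := hstable
  obtain ⟨L⟩ := SoficStability.FiniteClassifyingSpace.nonempty_edgeLift E ext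
  exact L.residuallyFinite_of_weaklyContained hcentral hcosys
    (hS (Ψ.soficRepresentation S) (Filter.hyperfilter ℕ) Filter.hyperfilter_le_cofinite)
    (B := fun g => SoficStability.SoficRepresentation.limitFunction _ _ fun n => Ψ.β n g)
    (Ψ.limitFunction_crossed S _ _) (Ψ.limitFunction_inl S _ _)
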